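/- Consider the budgeted linear maximization problem $$(P_3)\qquad \max_x\; b^\top x \quad\text{subject to } x\in\mathcal X,\ a^\top x\ge s,$$ where $\mathcal X\subset\{0,1\}^d$, $a,b\in\mathbb R^d$ have positive entries and $s\in\mathbb R$. An algorithm solves $(P_3)$ with approximation ratio $\tfrac12$ if, whenever $(P_3)$ is feasible, it returns $\bar x\in\mathcal X$ with $a^\top\bar x\ge s$ and $b^\top\bar x\ge\tfrac12\max\{b^\top x: x\in\mathcal X,\ a^\top x\ge s\}$, and otherwise reports infeasibility. Running times are worst-case numbers of steps on a real random access machine: a fixed program, independent of the input, in which each addition, subtraction or comparison of integers, each arithmetic operation or comparison of real numbers, each memory access and each oracle call takes one unit of time, and real numbers cannot be rounded or converted to integers. (i) There is an algorithm which, for every finite simple graph $G=(V,E)$ given by the list of its edges, and all $a,b\in\mathbb R^{E}$ with positive entries and $s\in\mathbb R$, solves $(P_3)$ with $\mathcal X$ the set of spanning trees of $G$ with approximation ratio $\tfrac12$ in time $$\mathcal O\bigl(|E|^2(\ln|V|)^2+|V|(\ln|E|)^3+1\bigr).$$ (ii) There is an algorithm which, for every matroid of rank $m$ on $d$ elements given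 by an independence oracle, and all $a,b\in\mathbb R^{d}$ with positive entries and $s\in\mathbb R$, solves $(P_3)$ with $\mathcal X$ the set of bases of the matroid with approximation ratio $\tfrac12$ in time $$\mathcal O\bigl(d^2(\ln d)^2+m(\ln d)^3+1\bigr).$$ The constants in $\mathcal O$ are absolute (with the convention $\ln 0=0$). In particular both running times are polynomial, uniformly in the numerical values of $a$, $b$ and $s$. -/

import Mathlib

namespace RealRAM

/-! A real random access machine, given by structured programs.  The memory consists of
integer arrays (used for indices, flags and combinatorial data) and of real arrays.  A program is
a finite piece of syntax that does not depend on the input; its only numerals are natural numbers.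
Reals can be added, subtracted, multiplied, divided and compared; they cannot be rounded or
converted to integers.  Integers can be added, subtracted and compared. -/

/-- A memory: `nat k i` is cell `i` of the integer array `k`, and `real k i` is cell `i` of the
real array `k`. -/
structure Memory where
  nat : ℕ → ℕ → ℕ
  real : ℕ → ℕ → ℝ

/-- Integer expressions; `cell k e` reads the cell of the integer array `k` with address `e`. -/
inductive NatExpr where
  | const (c : ℕ)
  | cell (k : ℕ) (addr : NatExpr)
  | add (e f : NatExpr)
  | sub (e f : NatExpr)

/-- The value of an integer expression (the subtraction is truncated at zero). -/
def NatExpr.eval (σ : Memory) : NatExpr → ℕ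
  | const c => c
  | cell k addr => σ.nat k (addr.eval σ)
  | add e f => e.eval σ + f.eval σ
  | sub e f => e.eval σ - f.eval σ

/-- Real expressions; `cell k e` reads the cell of the real array `k` with address `e`. -/
inductive RealExpr where
  | const (c : ℕ)
  | cell (k : ℕ) (addr : NatExpr)
  | add (e f : RealExpr)
  | sub (e f : RealExpr)
  | mul (e f : RealExpr)
  | div (e f : RealExpr)

/-- The value of a real expression. -/
noncomputable def RealExpr.eval (σ : Memory) : RealExpr → ℝ
  | const c => (c : ℝ)
  | cell k addr => σ.real k (addr.eval σ)
  | add e f => e.eval σ + f.eval σ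
  | sub e f => e.eval σ - f.eval σ
  | mul e f => e.eval σ * f.eval σ
  | div e f => e.eval σ / f.eval σ

/-- Tests.  `query k` asks the oracle about the set `{j | nat k j ≠ 0}` whose indicator is stored
in the integer array `k`. -/
inductive Test where
  | natLE (e f : NatExpr)
  | realLE (e f : RealExpr)
  | query (k : ℕ)
  | not (p : Test)
  | and (p q : Test)

/-- The outcome of a test, for the oracle `O`. -/
def Test.Holds (O : Set ℕ → Prop) (σ : Memory) : Test → Prop
  | natLE e f => e.eval σ ≤ f.eval σ
  | realLE e f => e.eval σ ≤ f.eval σ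
  | query k => O {j | σ.nat k j ≠ 0}
  | not p => ¬ p.Holds O σ
  | and p q => p.Holds O σ ∧ q.Holds O σ

/-- Programs. -/
inductive Program where
  | skip
  | setNat (k : ℕ) (addr : NatExpr) (e : NatExpr)
  | setReal (k : ℕ) (addr : NatExpr) (e : RealExpr)
  | seq (P Q : Program)
  | cond (p : Test) (P Q : Program)
  | loop (p : Test) (P : Program)

/-- Overwrite one integer cell. -/
def Memory.writeNat (σ : Memory) (k i x : ℕ) : Memory where
  nat := Function.update σ.nat k (Function.update (σ.nat k) i x)
  real := σ.real

/-- Overwrite one real cell. -/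
def Memory.writeReal (σ : Memory) (k i : ℕ) (x : ℝ) : Memory where
  nat := σ.nat
  real := Function.update σ.real k (Function.update (σ.real k) i x)

/-- `Runs O P σ t τ`: started in the memory `σ`, the program `P` with oracle `O` halts after
`t` steps in the memory `τ`.  Every assignment and every evaluation of a test is one step.  As the
expressions and tests of a program are fixed pieces of syntax, a step consists of a number of
elementary operations and oracle calls that is bounded in terms of the program alone. -/
inductive Runs (O : Set ℕ → Prop) : Program → Memory → ℕ → Memory → Prop where
  | skip (σ : Memory) : Runs O .skip σ 1 σ
  | setNat (k : ℕ) (addr e : NatExpr) (σ : Memory) :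
      Runs O (.setNat k addr e) σ 1 (σ.writeNat k (addr.eval σ) (e.eval σ))
  | setReal (k : ℕ) (addr : NatExpr) (e : RealExpr) (σ : Memory) :
      Runs O (.setReal k addr e) σ 1 (σ.writeReal k (addr.eval σ) (e.eval σ))
  | seq {P Q : Program} {σ τ ρ : Memory} {t u : ℕ} :
      Runs O P σ t τ → Runs O Q τ u ρ → Runs O (.seq P Q) σ (t + u) ρ
  | condTrue {p : Test} {P Q : Program} {σ τ : Memory} {t : ℕ} :
      p.Holds O σ → Runs O P σ t τ → Runs O (.cond p P Q) σ (t + 1) τ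
  | condFalse {p : Test} {P Q : Program} {σ τ : Memory} {t : ℕ} :
      ¬ p.Holds O σ → Runs O Q σ t τ → Runs O (.cond p P Q) σ (t + 1) τ
  | loopTrue {p : Test} {P : Program} {σ τ ρ : Memory} {t u : ℕ} :
      p.Holds O σ → Runs O P σ t τ → Runs O (.loop p P) τ u ρ →
        Runs O (.loop p P) σ (t + u + 1) ρ
  | loopFalse {p : Test} {P : Program} {σ : Memory} :
      ¬ p.Holds O σ → Runs O (.loop p P) σ 1 σ

/-- The oracle that carries no information. -/
def noOracle : Set ℕ → Prop := fun _ => False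

end RealRAM

namespace BudgetedMax

open RealRAM

/-- The feasible set of the budgeted linear maximization problem: the decisions `x ∈ X` with
`∑ i ∈ x, a i ≥ s`.  A `0`-`1` vector is identified with its support. -/
def feasible {d : ℕ} (X : Set (Finset (Fin d))) (a : Fin d → ℝ) (s : ℝ) :
    Set (Finset (Fin d)) :=
  {x | x ∈ X ∧ s ≤ ∑ i ∈ x, a i}

/-- `x` is an `ε`-optimal solution of: maximize `∑ i ∈ x, b i` subject to `x ∈ X` and
`∑ i ∈ x, a i ≥ s`. -/
def IsApproxSolution {d : ℕ} (ε : ℝ) (X : Set (Finset (Fin d))) (a b : Fin d → ℝ) (s : ℝ)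
    (x : Finset (Fin d)) : Prop :=
  x ∈ feasible X a s ∧ ∀ y ∈ feasible X a s, ε * ∑ i ∈ y, b i ≤ ∑ i ∈ x, b i

/-- Store a vector in an array, padded by zero. -/
def pad {α : Type*} [Zero α] {d : ℕ} (f : Fin d → α) (i : ℕ) : α :=
  if h : i < d then f ⟨i, h⟩ else 0

/-- The real part of the input: `a` in array `0`, `b` in array `1`, `s` in cell `0` of array `2`,
and zero elsewhere. -/
def realInput {d : ℕ} (a b : Fin d → ℝ) (s : ℝ) : ℕ → ℕ → ℝ
  | 0 => pad a
  | 1 => pad b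
  | 2 => fun i => if i = 0 then s else 0
  | _ => fun _ => 0

/-- The input for a matroid on `d` elements: the number `d` in cell `0` of the integer array `0`,
and the real data. -/
def matroidInput {d : ℕ} (a b : Fin d → ℝ) (s : ℝ) : Memory where
  nat := fun k i => if k = 0 ∧ i = 0 then d else 0
  real := realInput a b s

/-- The independence oracle of a matroid on `d` elements. -/
def indepOracle {d : ℕ} (M : Matroid (Fin d)) : Set ℕ → Prop :=
  fun S => M.Indep {i | (i : ℕ) ∈ S}

/-- The input for a graph with `n` vertices and `d` edges: `d` and `n` in the cells `0` and `1`
of the integer array `0`, the two ends of the edge number `i` in cell `i` of the integer arrays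
`1` and `2`, and the real data. -/
def graphInput {n d : ℕ} (u v : Fin d → Fin n) (a b : Fin d → ℝ) (s : ℝ) : Memory where
  nat := fun k => match k with
    | 0 => fun i => if i = 0 then d else if i = 1 then n else 0
    | 1 => pad (fun i => (u i : ℕ))
    | 2 => pad (fun i => (v i : ℕ))
    | _ => fun _ => 0
  real := realInput a b s

/-- The edges of `G` are numbered `0, …, d - 1`, without repetition, and `u i`, `v i` are the two
ends of the edge number `i`. -/
def IsEdgeList {n d : ℕ} (G : SimpleGraph (Fin n)) (u v : Fin d → Fin n) : Prop :=
  Set.BijOn (fun i => s(u i, v i)) Set.univ G.edgeSet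

/-- The sets of edges, given by their numbers, that are spanning trees. -/
def spanningTrees {n d : ℕ} (u v : Fin d → Fin n) : Set (Finset (Fin d)) :=
  {x | (SimpleGraph.fromEdgeSet ((fun i => s(u i, v i)) '' (x : Set (Fin d)))).IsTree}

/-- The bases of a matroid. -/
def bases {d : ℕ} (M : Matroid (Fin d)) : Set (Finset (Fin d)) :=
  {x | M.IsBase (x : Set (Fin d))}

/-- The set held by the output array, the integer array `4`. -/
def output (d : ℕ) (τ : Memory) : Finset (Fin d) :=
  Finset.univ.filter fun i => τ.nat 4 (i : ℕ) ≠ 0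

/-- The program `P`, started on `σ`, halts within `T` steps and solves the budgeted linear
maximization problem with approximation ratio `ε`: if the problem is feasible, then it sets the
flag in cell `0` of the integer array `3` to `1` and outputs an `ε`-optimal solution; otherwise
that flag is `0`. -/
def SolvesWithin (O : Set ℕ → Prop) (P : Program) (σ : Memory) {d : ℕ} (ε : ℝ)
    (X : Set (Finset (Fin d))) (a b : Fin d → ℝ) (s : ℝ) (T : ℝ) : Prop :=
  ∃ (t : ℕ) (τ : Memory), Runs O P σ t τ ∧ (t : ℝ) ≤ T ∧
    ((feasible X a s).Nonempty → τ.nat 3 0 = 1 ∧ IsApproxSolution ε X a b s (output d τ)) ∧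
    (feasible X a s = ∅ → τ.nat 3 0 = 0)

end BudgetedMax

/-!
Both algorithms are instances of one program, which operates on the bases of a matroid through two
subroutines (`Engine`): one finds, for an element `f` outside the current basis, a lightest element
for which `f` can be exchanged, the other performs an exchange.  All that is used of the family of
bases is the symmetric exchange property (`SymmExchange`).  It implies that one pass over the
elements, which exchanges each of them for the lightest possible element if this brings a gain,
turns any basis into one of maximum weight (`Engine.optimize_spec`).

The approximation rests on the Lagrangian weights `(1 - θ) b + θ a`.  For `θ = 1` an optimal basis
`B` decides feasibility.  One exchange in `B` decides for each element whether some feasible basis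
contains it; the others are discarded (`Engine.discard_spec`), and the best feasible basis recorded
from then on is at least as good as any single remaining element (`Engine.takeBest_spec`).  If an
optimal basis for `θ = 0` is feasible, it is an optimal solution.  Otherwise there are a `θ` and two
optimal bases for the weight of `θ`, one feasible and one not.  On a walk between the two by
exchanges through optimal bases, a feasible basis is adjacent to an infeasible one somewhere
(`IsMaxOn.step`).  The infeasible one has at least the optimal objective
(`IsMaxOn.le_of_infeasible`), and the feasible one loses at most the objective of one element against
it.  Hence this basis or the one recorded before is a solution with ratio `1 / 2`
(`IsMaxOn.le_add_of_infeasible`).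

The value `θ` is found without rounding: the order of the weights changes only at the at most `d ^ 2`
points where the weights of two elements cross (`crossing`).  These are sorted by heap sort, and a
binary search determines two neighbouring ones, between which feasibility of the optimal basis
changes.  A basis that is optimal somewhere strictly between two neighbouring crossings is optimal
at both of them (`IsMaxOn.of_no_crossing`).

For a matroid each subroutine takes `O(d)` oracle calls.  For a graph the basis is stored as a rooted
spanning tree; to insert an edge, the tree is rooted at one end of the edge, the edges that can be
removed are those on the way from the other end to the root, and the exchange reverses a part of
this way (`reversePath_spec`).  So each subroutine takes `O(d)` steps, and there are `O(d log d)` calls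
of the subroutines, plus `O(d ^ 2 log d)` steps for sorting.  Correctness and running times are proved
together, with the total correctness assertions `wp`.
-/


namespace RealRAM

/-! ### Reasoning about programs -/

/-- The integer variable `k`: cell `0` of the integer array `k`. -/
abbrev NatExpr.var (k : ℕ) : NatExpr := .cell k (.const 0)

/-- The real variable `k`: cell `0` of the real array `k`. -/
abbrev RealExpr.var (k : ℕ) : RealExpr := .cell k (.const 0)

/-- The test `e < f` of integers. -/
abbrev Test.natLT (e f : NatExpr) : Test := .not (.natLE f e)

/-- The test `e < f` of reals. -/
abbrev Test.realLT (e f : RealExpr) : Test := .not (.realLE f e)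

/-- The test `e = 0`. -/
abbrev Test.isZero (e : NatExpr) : Test := .natLE e (.const 0)

/-- The test `e ≠ 0`. -/
abbrev Test.nonZero (e : NatExpr) : Test := .not (.natLE e (.const 0))

/-- Assignment to an integer variable. -/
abbrev Program.letNat (k : ℕ) (e : NatExpr) : Program := .setNat k (.const 0) e

/-- Assignment to a real variable. -/
abbrev Program.letReal (k : ℕ) (e : RealExpr) : Program := .setReal k (.const 0) e

/-- Sequential composition of programs. -/
infixr:60 " ;; " => Program.seq

/-- `P` is run with the integer variable `v` taking the values `0, 1, …` below `e`. -/
def Program.forLoop (v : ℕ) (e : NatExpr) (P : Program) : Program :=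
  .letNat v (.const 0) ;; .loop (.natLT (.var v) e) (P ;; .letNat v (.add (.var v) (.const 1)))

/-- The program contains an assignment to the integer array `j`. -/
def Program.WritesNat : Program → ℕ → Prop
  | skip, _ => False
  | setNat k _ _, j => j = k
  | setReal _ _ _, _ => False
  | seq P Q, j => P.WritesNat j ∨ Q.WritesNat j
  | cond _ P Q, j => P.WritesNat j ∨ Q.WritesNat j
  | loop _ P, j => P.WritesNat j

/-- The program contains an assignment to the real array `j`. -/
def Program.WritesReal : Program → ℕ → Prop
  | skip, _ => False
  | setNat _ _ _, _ => False
  | setReal k _ _, j => j = k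
  | seq P Q, j => P.WritesReal j ∨ Q.WritesReal j
  | cond _ P Q, j => P.WritesReal j ∨ Q.WritesReal j
  | loop _ P, j => P.WritesReal j

/-- The memories `σ` and `τ` agree on all arrays to which `P` contains no assignment. -/
structure Agree (P : Program) (σ τ : Memory) : Prop where
  nat : ∀ k, ¬ P.WritesNat k → τ.nat k = σ.nat k
  real : ∀ k, ¬ P.WritesReal k → τ.real k = σ.real k

theorem Agree.refl (P : Program) (σ : Memory) : Agree P σ σ :=
  ⟨fun _ _ => rfl, fun _ _ => rfl⟩

theorem Agree.trans {P : Program} {σ τ ρ : Memory} (h : Agree P σ τ) (h' : Agree P τ ρ) :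
    Agree P σ ρ :=
  ⟨fun k hk => (h'.nat k hk).trans (h.nat k hk), fun k hk => (h'.real k hk).trans (h.real k hk)⟩

theorem Agree.mono {P Q : Program} {σ τ : Memory} (h : Agree P σ τ)
    (hn : ∀ k, P.WritesNat k → Q.WritesNat k) (hr : ∀ k, P.WritesReal k → Q.WritesReal k) :
    Agree Q σ τ :=
  ⟨fun k hk => h.nat k fun h => hk (hn k h), fun k hk => h.real k fun h => hk (hr k h)⟩

section Memory

variable (σ : Memory) (k i x : ℕ) (y : ℝ)

@[simp] theorem Memory.writeNat_real : (σ.writeNat k i x).real = σ.real := rfl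

@[simp] theorem Memory.writeReal_nat : (σ.writeReal k i y).nat = σ.nat := rfl

theorem Memory.writeNat_nat (k' j : ℕ) :
    (σ.writeNat k i x).nat k' j = if k' = k ∧ j = i then x else σ.nat k' j := by
  by_cases h : k' = k
  · subst h; by_cases h' : j = i
    · subst h'; simp [Memory.writeNat]
    · simp [Memory.writeNat, h']
  · simp [Memory.writeNat, h]

theorem Memory.writeReal_real (k' j : ℕ) :
    (σ.writeReal k i y).real k' j = if k' = k ∧ j = i then y else σ.real k' j := by
  by_cases h : k' = k
  · subst h; by_cases h' : j = i
    · subst h'; simp [Memory.writeReal]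
    · simp [Memory.writeReal, h']
  · simp [Memory.writeReal, h]

@[simp] theorem Memory.writeNat_nat_same : (σ.writeNat k i x).nat k i = x := by
  simp [Memory.writeNat_nat]

@[simp] theorem Memory.writeReal_real_same : (σ.writeReal k i y).real k i = y := by
  simp [Memory.writeReal_real]

variable {k} in
@[simp] theorem Memory.writeNat_nat_of_ne {k' : ℕ} (h : k' ≠ k) :
    (σ.writeNat k i x).nat k' = σ.nat k' := by
  simp [Memory.writeNat, h]

variable {k} in
@[simp] theorem Memory.writeReal_real_of_ne {k' : ℕ} (h : k' ≠ k) :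
    (σ.writeReal k i y).real k' = σ.real k' := by
  simp [Memory.writeReal, h]

variable {i} in
@[simp] theorem Memory.writeNat_nat_of_ne' {j : ℕ} (h : j ≠ i) :
    (σ.writeNat k i x).nat k j = σ.nat k j := by
  simp [Memory.writeNat, h]

theorem Memory.writeReal_real_self :
    (σ.writeReal k i y).real k = Function.update (σ.real k) i y := by
  simp [Memory.writeReal]

theorem Memory.writeNat_nat_self :
    (σ.writeNat k i x).nat k = Function.update (σ.nat k) i x := by
  simp [Memory.writeNat]

end Memory

theorem Runs.agree {O : Set ℕ → Prop} {P : Program} {σ τ : Memory} {t : ℕ}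
    (h : Runs O P σ t τ) : Agree P σ τ := by
  induction h with
  | skip σ => exact .refl _ _
  | setNat k addr e σ =>
    exact ⟨fun j hj => Memory.writeNat_nat_of_ne _ _ _ hj, fun _ _ => rfl⟩
  | setReal k addr e σ =>
    exact ⟨fun _ _ => rfl, fun j hj => Memory.writeReal_real_of_ne _ _ _ hj⟩
  | seq _ _ h1 h2 =>
    exact (h1.mono (fun _ => Or.inl) (fun _ => Or.inl)).trans
      (h2.mono (fun _ => Or.inr) (fun _ => Or.inr))
  | condTrue _ _ h => exact h.mono (fun _ => Or.inl) (fun _ => Or.inl)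
  | condFalse _ _ h => exact h.mono (fun _ => Or.inr) (fun _ => Or.inr)
  | loopTrue _ _ _ h1 h2 => exact Agree.trans ⟨h1.nat, h1.real⟩ h2
  | loopFalse _ => exact .refl _ _

/-- Started in `σ`, the program `P` halts within `T` steps in a memory that satisfies `Q`. -/
def wp (O : Set ℕ → Prop) (P : Program) (T : ℕ) (Q : Memory → Prop) (σ : Memory) : Prop :=
  ∃ t τ, Runs O P σ t τ ∧ t ≤ T ∧ Q τ

section wp

variable {O : Set ℕ → Prop} {P P' : Program} {p : Test} {T T' c n N k v : ℕ}
  {Q R : Memory → Prop} {σ : Memory} {addr e : NatExpr} {r : RealExpr}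

theorem wp.mono (h : wp O P T Q σ) (hT : T ≤ T') (hQ : ∀ τ, Agree P σ τ → Q τ → R τ) :
    wp O P T' R σ := by
  obtain ⟨t, τ, hr, ht, hq⟩ := h
  exact ⟨t, τ, hr, ht.trans hT, hQ τ hr.agree hq⟩

theorem wp.weaken (h : wp O P T Q σ) (hT : T ≤ T') : wp O P T' Q σ :=
  h.mono hT fun _ _ => id

theorem wp.imp (h : wp O P T Q σ) (hQ : ∀ τ, Agree P σ τ → Q τ → R τ) : wp O P T R σ :=
  h.mono le_rfl hQ

theorem wp_skip (h : Q σ) : wp O .skip 1 Q σ := ⟨1, σ, .skip σ, le_rfl, h⟩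

theorem wp_setNat (h : Q (σ.writeNat k (addr.eval σ) (e.eval σ))) :
    wp O (.setNat k addr e) 1 Q σ := ⟨1, _, .setNat _ _ _ _, le_rfl, h⟩

theorem wp_setReal (h : Q (σ.writeReal k (addr.eval σ) (r.eval σ))) :
    wp O (.setReal k addr r) 1 Q σ := ⟨1, _, .setReal _ _ _ _, le_rfl, h⟩

theorem wp_seq (h : wp O P T Q σ) (h' : ∀ τ, Agree P σ τ → Q τ → wp O P' T' R τ) :
    wp O (P ;; P') (T + T') R σ := by
  obtain ⟨t, τ, hr, ht, hq⟩ := h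
  obtain ⟨t', τ', hr', ht', hq'⟩ := h' τ hr.agree hq
  exact ⟨t + t', τ', .seq hr hr', add_le_add ht ht', hq'⟩

theorem wp_setNat_seq (h : wp O P T Q (σ.writeNat k (addr.eval σ) (e.eval σ))) :
    wp O (.setNat k addr e ;; P) (T + 1) Q σ := by
  obtain ⟨t, τ, hr, ht, hq⟩ := h
  exact ⟨1 + t, τ, .seq (.setNat _ _ _ _) hr, by lia, hq⟩

theorem wp_setReal_seq (h : wp O P T Q (σ.writeReal k (addr.eval σ) (r.eval σ))) :
    wp O (.setReal k addr r ;; P) (T + 1) Q σ := by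
  obtain ⟨t, τ, hr, ht, hq⟩ := h
  exact ⟨1 + t, τ, .seq (.setReal _ _ _ _) hr, by lia, hq⟩

theorem wp_cond (h : p.Holds O σ → wp O P T Q σ) (h' : ¬ p.Holds O σ → wp O P' T Q σ) :
    wp O (.cond p P P') (T + 1) Q σ := by
  by_cases hp : p.Holds O σ
  · obtain ⟨t, τ, hr, ht, hq⟩ := h hp
    exact ⟨t + 1, τ, .condTrue hp hr, by lia, hq⟩
  · obtain ⟨t, τ, hr, ht, hq⟩ := h' hp
    exact ⟨t + 1, τ, .condFalse hp hr, by lia, hq⟩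

/-- The rule for loops: `I k τ` says that `τ` satisfies the invariant and that at most `k` rounds
remain. -/
theorem wp_loop (I : ℕ → Memory → Prop) (h0 : I n σ)
    (hstep : ∀ k τ, Agree P σ τ → I k τ → p.Holds O τ →
      wp O P c (fun τ' => ∃ k' < k, I k' τ') τ)
    (hexit : ∀ k τ, Agree P σ τ → I k τ → ¬ p.Holds O τ → Q τ) :
    wp O (.loop p P) (n * (c + 1) + 1) Q σ := by
  suffices H : ∀ n τ, Agree P σ τ → I n τ → wp O (.loop p P) (n * (c + 1) + 1) Q τ from
    H n σ (.refl _ _) h0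
  intro n
  induction n using Nat.strong_induction_on with
  | _ n ih =>
    intro τ hA hI
    by_cases hp : p.Holds O τ
    · obtain ⟨t, τ', hr, ht, k', hk', hI'⟩ := hstep n τ hA hI hp
      obtain ⟨t', τ'', hr', ht', hq⟩ := ih k' hk' τ' (hA.trans hr.agree) hI'
      refine ⟨_, τ'', .loopTrue hp hr hr', ?_, hq⟩
      have : (k' + 1) * (c + 1) ≤ n * (c + 1) := Nat.mul_le_mul_right _ hk'
      lia
    · exact ⟨1, τ, .loopFalse hp, by lia, hexit n τ hA hI hp⟩

/-- The rule for counting loops: `I i τ` is the invariant before the round number `i`. -/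
theorem wp_forLoop (I : ℕ → Memory → Prop) (hv : ¬ P.WritesNat v)
    (he : ∀ τ, Agree (.forLoop v e P) σ τ → e.eval τ = N)
    (h0 : I 0 (σ.writeNat v 0 0))
    (hstep : ∀ i τ, i < N → Agree (.forLoop v e P) σ τ → τ.nat v 0 = i → I i τ →
      wp O P c (fun τ' => I (i + 1) (τ'.writeNat v 0 (i + 1))) τ) :
    wp O (.forLoop v e P) (N * (c + 2) + 2) (fun τ => I N τ) σ := by
  have hA0 : Agree (.forLoop v e P) σ (σ.writeNat v 0 0) :=
    ⟨fun k hk => Memory.writeNat_nat_of_ne _ _ _ fun h => hk (Or.inl h), fun _ _ => rfl⟩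
  refine (wp_setNat_seq ?_).weaken (T := N * (c + 1 + 1) + 1 + 1) (by lia)
  refine wp_loop (fun k τ => k + τ.nat v 0 = N ∧ I (τ.nat v 0) τ) ⟨?_, ?_⟩ ?_ ?_
  · simp [NatExpr.eval]
  · simpa [NatExpr.eval] using h0
  · rintro k τ hA ⟨hk, hI⟩ hp
    have hA' : Agree (.forLoop v e P) σ τ :=
      hA0.trans (hA.mono (fun k hk => Or.inr hk) (fun k hk => Or.inr hk))
    have hlt : τ.nat v 0 < N := by
      have := he τ hA'
      simp only [Test.Holds, NatExpr.eval, this] at hp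
      lia
    refine wp_seq (hstep _ τ hlt hA' rfl hI) fun τ' hB hI' => wp_setNat ?_
    have hv' : τ'.nat v = τ.nat v := hB.nat v hv
    refine ⟨k - 1, by lia, ?_, ?_⟩
    · simp only [NatExpr.eval, Memory.writeNat_nat_same, hv']; lia
    · simpa [NatExpr.eval, hv'] using hI'
  · rintro k τ hA ⟨hk, hI⟩ hp
    have hA' : Agree (.forLoop v e P) σ τ :=
      hA0.trans (hA.mono (fun k hk => Or.inr hk) (fun k hk => Or.inr hk))
    have := he τ hA'
    simp only [Test.Holds, NatExpr.eval, this] at hp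
    have : τ.nat v 0 = N := by lia
    rwa [this] at hI

end wp

end RealRAM

namespace BudgetedMax

/-! ### Families of sets with the symmetric exchange property -/

section Exchange

variable {α : Type*} [DecidableEq α] {X : Set (Finset α)} {w : α → ℝ} {A B S T Y Z : Finset α}
  {f g y : α}

/-- The symmetric exchange property, shared by the bases of a matroid and the spanning trees of a
graph. -/
def SymmExchange (X : Set (Finset α)) : Prop :=
  ∀ A ∈ X, ∀ B ∈ X, ∀ y ∈ B \ A, ∃ g ∈ A \ B,
    insert y (A.erase g) ∈ X ∧ insert g (B.erase y) ∈ X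

/-- `B` has maximum weight among the members of `X` that are contained in `S`. -/
structure IsMaxOn (X : Set (Finset α)) (S : Finset α) (w : α → ℝ) (B : Finset α) : Prop where
  mem : B ∈ X
  subset : B ⊆ S
  le : ∀ A ∈ X, A ⊆ S → ∑ i ∈ A, w i ≤ ∑ i ∈ B, w i

theorem sum_swap (hg : g ∈ B) (hf : f ∉ B) :
    ∑ i ∈ insert f (B.erase g), w i = ∑ i ∈ B, w i - w g + w f := by
  rw [Finset.sum_insert (fun h => hf (Finset.mem_of_mem_erase h)), ← Finset.add_sum_erase B w hg]
  ring

theorem SymmExchange.eq_of_subset (hX : SymmExchange X) (hA : A ∈ X) (hB : B ∈ X) (h : A ⊆ B) :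
    A = B := by
  refine h.antisymm fun y hy => ?_
  by_contra hy'
  obtain ⟨g, hg, -⟩ := hX A hA B hB y (by simp [hy, hy'])
  simp only [Finset.mem_sdiff] at hg
  exact hg.2 (h hg.1)

theorem SymmExchange.isMaxOn_self (hX : SymmExchange X) (hB : B ∈ X) : IsMaxOn X B w B :=
  ⟨hB, subset_rfl, fun _ hA h => (hX.eq_of_subset hA hB h ▸ le_rfl)⟩

/-- A member that contains the new element `f` is compared with an optimal member `B` by one
symmetric exchange, which removes `f` from it. -/
theorem IsMaxOn.exists_swap (hX : SymmExchange X) (hB : IsMaxOn X S w B) (hf : f ∉ B)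
    (hA : A ∈ X) (hAS : A ⊆ insert f S) (hfA : f ∈ A) :
    ∃ g ∈ B \ A, insert f (B.erase g) ∈ X ∧ ∑ i ∈ A, w i ≤ ∑ i ∈ B, w i - w g + w f := by
  obtain ⟨g, hg, h1, h2⟩ := hX B hB.mem A hA f (by simp [hf, hfA])
  refine ⟨g, hg, h1, ?_⟩
  simp only [Finset.mem_sdiff] at hg
  have hsub : insert g (A.erase f) ⊆ S := by
    intro i hi
    rcases Finset.mem_insert.1 hi with rfl | hi
    · exact hB.subset hg.1
    · exact (Finset.mem_insert.1 (hAS (Finset.mem_of_mem_erase hi))).resolve_left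
        (Finset.ne_of_mem_erase hi)
  have := hB.le _ h2 hsub
  rw [sum_swap hfA hg.2] at this
  linarith

/-- The swap that inserts `f` for the lightest possible element is optimal among the members that
contain `f`. -/
theorem IsMaxOn.le_swap (hX : SymmExchange X) (hB : IsMaxOn X S w B) (hf : f ∉ B)
    (hmin : ∀ g' ∈ B, insert f (B.erase g') ∈ X → w g ≤ w g')
    (hA : A ∈ X) (hAS : A ⊆ insert f S) (hfA : f ∈ A) :
    ∑ i ∈ A, w i ≤ ∑ i ∈ B, w i - w g + w f := by
  obtain ⟨g', hg', h1, h2⟩ := hB.exists_swap hX hf hA hAS hfA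
  have := hmin g' (Finset.mem_sdiff.1 hg').1 h1
  linarith

theorem IsMaxOn.insert_of_mem (hB : IsMaxOn X S w B) (hf : f ∈ B) :
    IsMaxOn X (insert f S) w B := by
  rwa [Finset.insert_eq_of_mem (hB.subset hf)]

/-- If the best swap for `f` brings no gain, then the optimal member stays optimal when `f` becomes
available. -/
theorem IsMaxOn.insert_of_le (hX : SymmExchange X) (hB : IsMaxOn X S w B) (hf : f ∉ B)
    (hmin : ∀ g' ∈ B, insert f (B.erase g') ∈ X → w f ≤ w g') :
    IsMaxOn X (insert f S) w B := by
  refine ⟨hB.mem, hB.subset.trans (Finset.subset_insert _ _), fun A hA hAS => ?_⟩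
  by_cases hfA : f ∈ A
  · have := hB.le_swap hX hf (g := f) hmin hA hAS hfA
    linarith
  · exact hB.le A hA ((Finset.subset_insert_iff_of_notMem hfA).1 hAS)

/-- If the best swap for `f` brings a gain, then it yields an optimal member when `f` becomes
available. -/
theorem IsMaxOn.insert_swap (hX : SymmExchange X) (hB : IsMaxOn X S w B) (hf : f ∉ B)
    (hg : g ∈ B) (hgX : insert f (B.erase g) ∈ X) (hgf : w g ≤ w f)
    (hmin : ∀ g' ∈ B, insert f (B.erase g') ∈ X → w g ≤ w g') :
    IsMaxOn X (insert f S) w (insert f (B.erase g)) := by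
  refine ⟨hgX, Finset.insert_subset_insert _ ((Finset.erase_subset _ _).trans hB.subset),
    fun A hA hAS => ?_⟩
  rw [sum_swap hg hf]
  by_cases hfA : f ∈ A
  · exact hB.le_swap hX hf hmin hA hAS hfA
  · have := hB.le A hA ((Finset.subset_insert_iff_of_notMem hfA).1 hAS)
    linarith

/-- A member that no single swap improves is optimal. -/
theorem SymmExchange.isMaxOn_of_local (hX : SymmExchange X) (hB : B ∈ X) (hBS : B ⊆ S)
    (hloc : ∀ f ∈ S, f ∉ B → ∀ g ∈ B, insert f (B.erase g) ∈ X → w f ≤ w g) :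
    IsMaxOn X S w B := by
  refine ⟨hB, hBS, ?_⟩
  suffices H : ∀ n, ∀ A ∈ X, A ⊆ S → (A \ B).card = n → ∑ i ∈ A, w i ≤ ∑ i ∈ B, w i from
    fun A hA hAS => H _ A hA hAS rfl
  intro n
  induction n with
  | zero =>
    intro A hA hAS hn
    rw [hX.eq_of_subset hA hB (Finset.sdiff_eq_empty_iff_subset.1 (Finset.card_eq_zero.1 hn))]
  | succ n ih =>
    intro A hA hAS hn
    obtain ⟨y, hy⟩ : (A \ B).Nonempty := Finset.card_pos.1 (by lia)
    obtain ⟨g, hg, h1, h2⟩ := hX B hB A hA y hy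
    simp only [Finset.mem_sdiff] at hy hg
    have hle := hloc y (hAS hy.1) hy.2 g hg.1 h1
    have hsub : insert g (A.erase y) ⊆ S :=
      Finset.insert_subset (hBS hg.1) ((Finset.erase_subset _ _).trans hAS)
    have hcard : (insert g (A.erase y) \ B).card = n := by
      have : insert g (A.erase y) \ B = (A \ B).erase y := by
        ext i
        simp only [Finset.mem_sdiff, Finset.mem_insert, Finset.mem_erase]
        constructor
        · rintro ⟨rfl | h, h'⟩
          · exact absurd hg.1 h'
          · exact ⟨h.1, h.2, h'⟩
        · rintro ⟨h, h', h''⟩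
          exact ⟨Or.inr ⟨h, h'⟩, h''⟩
      rw [this, Finset.card_erase_of_mem (by simp [hy]), hn]
      rfl
    have := ih _ h2 hsub hcard
    rw [sum_swap hy.1 hg.2] at this
    linarith

theorem IsMaxOn.local (hB : IsMaxOn X S w B) (hf : f ∈ S) (hfB : f ∉ B) (hg : g ∈ B)
    (h : insert f (B.erase g) ∈ X) : w f ≤ w g := by
  have := hB.le _ h (Finset.insert_subset hf ((Finset.erase_subset _ _).trans hB.subset))
  rw [sum_swap hg hfB] at this
  linarith

/-- Between two optimal members there is an exchange that keeps optimality and moves the first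
towards the second. -/
theorem IsMaxOn.exists_step (hX : SymmExchange X) (hZ : IsMaxOn X S w Z) (hY : IsMaxOn X S w Y)
    (hy : y ∈ Y) (hyZ : y ∉ Z) :
    ∃ g ∈ Z, g ∉ Y ∧ insert y (Z.erase g) ∈ X ∧ w g = w y := by
  obtain ⟨g, hg, h1, h2⟩ := hX Z hZ.mem Y hY.mem y (by simp [hy, hyZ])
  simp only [Finset.mem_sdiff] at hg
  exact ⟨g, hg.1, hg.2, h1, le_antisymm (hY.local (hZ.subset hg.1) hg.2 hy h2)
    (hZ.local (hY.subset hy) hyZ hg.1 h1)⟩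

theorem IsMaxOn.step (hX : SymmExchange X) (hZ : IsMaxOn X S w Z) (hY : IsMaxOn X S w Y)
    (hy : y ∈ Y) (hyZ : y ∉ Z) (hg : g ∈ Z) (hgX : insert y (Z.erase g) ∈ X)
    (hmin : ∀ g' ∈ Z, g' ∉ Y → insert y (Z.erase g') ∈ X → w g ≤ w g') :
    IsMaxOn X S w (insert y (Z.erase g)) := by
  obtain ⟨g', hg', hgY', h1, h2⟩ := hZ.exists_step hX hY hy hyZ
  have := hmin g' hg' hgY' h1
  refine ⟨hgX, Finset.insert_subset (hY.subset hy) ((Finset.erase_subset _ _).trans hZ.subset),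
    fun A hA hAS => ?_⟩
  rw [sum_swap hg hyZ]
  have := hZ.le A hA hAS
  linarith

end Exchange

/-! ### Lagrangian weights -/

section Lagrange

variable {α : Type*} {X : Set (Finset α)} {a b : α → ℝ} {θ s β : ℝ}
  {B S x y z : Finset α} {f g : α}

/-- The convex combination of the two objectives with parameter `θ`. -/
def lagrange (a b : α → ℝ) (θ : ℝ) (i : α) : ℝ := (1 - θ) * b i + θ * a i

theorem sum_lagrange (x : Finset α) :
    ∑ i ∈ x, lagrange a b θ i = (1 - θ) * ∑ i ∈ x, b i + θ * ∑ i ∈ x, a i := by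
  simp [lagrange, Finset.sum_add_distrib, Finset.mul_sum]

/-- An infeasible member that is optimal for a Lagrangian weight is at least as good as every
feasible one. -/
theorem IsMaxOn.le_of_infeasible (h0 : 0 ≤ θ) (h1 : θ ≤ 1)
    (hy : IsMaxOn X S (lagrange a b θ) y) (hys : ∑ i ∈ y, a i < s)
    (hz : z ∈ X) (hzS : z ⊆ S) (hzs : s ≤ ∑ i ∈ z, a i) : ∑ i ∈ z, b i ≤ ∑ i ∈ y, b i := by
  have := hy.le z hz hzS
  rw [sum_lagrange, sum_lagrange] at this
  rcases h1.lt_or_eq with h1 | rfl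
  · have h2 : θ * ∑ i ∈ y, a i ≤ θ * ∑ i ∈ z, a i :=
      mul_le_mul_of_nonneg_left (by linarith) h0
    have h3 : (1 - θ) * ∑ i ∈ z, b i ≤ (1 - θ) * ∑ i ∈ y, b i := by linarith
    exact le_of_mul_le_mul_left h3 (by linarith)
  · linarith

/-- The parameter at which the elements `i` and `j` have equal Lagrangian weight, if there is
exactly one. -/
noncomputable def crossing (a b : α → ℝ) (i j : α) : ℝ :=
  (b j - b i) / ((b j - b i) + (a i - a j))

/-- The order of two elements cannot change between two parameters without a crossing in
between. -/
theorem lagrange_le_of_no_crossing {i j : α} {p m q t : ℝ} (hpm : p ≤ m) (hmq : m ≤ q)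
    (ht : t = p ∨ t = q)
    (hcross : crossing a b i j ≤ p ∨ q ≤ crossing a b i j)
    (hm : p < m ∧ m < q ∨ p = m ∧ m = q) (h : lagrange a b m i ≤ lagrange a b m j) :
    lagrange a b t i ≤ lagrange a b t j := by
  rcases hm with ⟨hm1, hm2⟩ | ⟨rfl, rfl⟩
  swap
  · rcases ht with rfl | rfl <;> exact h
  unfold lagrange at *
  by_contra! hlt
  set u := (b j - b i) + (a i - a j) with hu
  set v := b j - b i with hv
  have e1 : m * u ≤ v := by rw [hu, hv]; linarith
  have e2 : v < t * u := by rw [hu, hv]; linarith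
  have hu0 : u ≠ 0 := by
    intro h0
    rw [h0] at e1 e2
    linarith
  have hc : crossing a b i j * u = v := by
    rw [crossing, ← hu, ← hv]
    exact div_mul_cancel₀ v hu0
  generalize crossing a b i j = c at *
  rw [← hc] at e1 e2
  rcases lt_or_gt_of_ne hu0 with h0 | h0
  · have e1' := (mul_le_mul_right_of_neg h0).1 e1
    have e2' := (mul_lt_mul_right_of_neg h0).1 e2
    rcases ht with rfl | rfl <;> rcases hcross with h | h <;> linarith
  · have e1' := le_of_mul_le_mul_right e1 h0
    have e2' := lt_of_mul_lt_mul_right e2 h0.le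
    rcases ht with rfl | rfl <;> rcases hcross with h | h <;> linarith

variable [DecidableEq α]

/-- A feasible member that arises by one swap from an infeasible optimal one loses at most the
objective of the element that is swapped out. -/
theorem IsMaxOn.le_add_of_infeasible (h0 : 0 ≤ θ) (h1 : θ ≤ 1) (hb : ∀ i, 0 < b i)
    (hy : IsMaxOn X S (lagrange a b θ) y) (hys : ∑ i ∈ y, a i < s)
    (hsub : y.erase g ⊆ x) (hg : g ∈ y) (hgβ : b g ≤ β) (hxβ : ∑ i ∈ x, b i ≤ β)
    (hz : z ∈ X) (hzS : z ⊆ S) (hzs : s ≤ ∑ i ∈ z, a i) : ∑ i ∈ z, b i ≤ 2 * β := by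
  have h2 := hy.le_of_infeasible h0 h1 hys hz hzS hzs
  have h3 : ∑ i ∈ y.erase g, b i ≤ ∑ i ∈ x, b i :=
    Finset.sum_le_sum_of_subset_of_nonneg hsub fun i _ _ => (hb i).le
  have h4 := Finset.add_sum_erase y b hg
  linarith

/-- A member that is optimal at the midpoint of an interval without inner crossings is optimal at
both ends. -/
theorem IsMaxOn.of_no_crossing (hX : SymmExchange X) {p q t : ℝ} (hpq : p ≤ q)
    (ht : t = p ∨ t = q)
    (hcross : ∀ i j, crossing a b i j ≤ p ∨ q ≤ crossing a b i j)
    (hB : IsMaxOn X S (lagrange a b ((p + q) / 2)) B) : IsMaxOn X S (lagrange a b t) B := by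
  refine hX.isMaxOn_of_local hB.mem hB.subset fun f hf hfB g hg hgX => ?_
  refine lagrange_le_of_no_crossing (m := (p + q) / 2) (by linarith) (by linarith) ht (hcross f g)
    ?_ (hB.local hf hfB hg hgX)
  rcases hpq.lt_or_eq with h | rfl
  · left; constructor <;> linarith
  · right; constructor <;> linarith

end Lagrange

end BudgetedMax

namespace BudgetedMax

open RealRAM

/-! ### Sorting by a heap -/

/-- The heap condition at the nodes `p, …, N - 1`; the children of `q` are `2 q` and `2 q + 1`, and
the nodes `N, …, 2 N - 1` are leaves. -/
def IsHeap (N p : ℕ) (H : ℕ → ℝ) : Prop :=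
  ∀ q, p ≤ q → q < N → H (2 * q) ≤ H q ∧ H (2 * q + 1) ≤ H q

theorem IsHeap.le_root {N : ℕ} {H : ℕ → ℝ} (h : IsHeap N 1 H) :
    ∀ q, 1 ≤ q → q < 2 * N → H q ≤ H 1 := by
  intro q
  induction q using Nat.strong_induction_on with
  | _ q ih =>
    intro h1 h2
    rcases Nat.eq_or_lt_of_le h1 with rfl | h1
    · rfl
    · have := h (q / 2) (by lia) (by lia)
      have hq := ih (q / 2) (by lia) (by lia) (by lia)
      rcases Nat.even_or_odd' q with ⟨c, hc | hc⟩
      · have e : q / 2 = c := by lia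
        rw [e] at this hq
        rw [hc]
        exact this.1.trans hq
      · have e : q / 2 = c := by lia
        rw [e] at this hq
        rw [hc]
        exact this.2.trans hq

/-- Lowering the value at a node to the value of its larger child, or at a leaf, keeps the heap
condition. -/
theorem IsHeap.update {N p q : ℕ} {H : ℕ → ℝ} {x : ℝ} (h : IsHeap N p H) (hp : 1 ≤ p)
    (hx : x ≤ H q) (hc : q < N → H (2 * q) ≤ x ∧ H (2 * q + 1) ≤ x) :
    IsHeap N p (Function.update H q x) := by
  intro r hr hrN
  obtain ⟨h1, h2⟩ := h r hr hrN
  simp only [Function.update_apply]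
  by_cases hrq : r = q
  · subst hrq
    have := hc hrN
    rw [if_neg (show ¬ 2 * r = r by lia), if_neg (show ¬ 2 * r + 1 = r by lia), if_pos rfl]
    exact this
  · rw [if_neg hrq]
    constructor <;> split_ifs with e
    · exact hx.trans (e ▸ h1)
    · exact h1
    · exact hx.trans (e ▸ h2)
    · exact h2

/-- The number of nonnegative entries at the nodes `p, …, m - 1`. -/
noncomputable def countNonneg (p m : ℕ) (H : ℕ → ℝ) : ℕ :=
  open Classical in ((Finset.Ico p m).filter fun q => 0 ≤ H q).card

/-- `H'` arises from `H` by putting `-1` at the node `p` and permuting the nodes `p, …, m - 1`. -/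
def IsPull (p m : ℕ) (H H' : ℕ → ℝ) : Prop :=
  ∃ π : Equiv.Perm ℕ, (∀ q, ¬ (p ≤ q ∧ q < m) → π q = q) ∧
    ∀ q, H' q = Function.update H p (-1) (π q)

section IsPull

variable {p m : ℕ} {H H' : ℕ → ℝ}

theorem perm_mem_range {π : Equiv.Perm ℕ} (h : ∀ q, ¬ (p ≤ q ∧ q < m) → π q = q) {q : ℕ} :
    (p ≤ π q ∧ π q < m) ↔ (p ≤ q ∧ q < m) := by
  constructor <;> intro hq
  · by_contra h'
    rw [h q h'] at hq
    exact h' hq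
  · by_contra h'
    rw [π.injective (h _ h')] at h'
    exact h' hq

theorem IsPull.bounds (h : IsPull p m H H') {l u : ℝ} (hl : l ≤ -1) (hu : -1 ≤ u)
    (hH : ∀ q, p < q → q < m → l ≤ H q ∧ H q ≤ u) :
    ∀ q, p ≤ q → q < m → l ≤ H' q ∧ H' q ≤ u := by
  obtain ⟨π, hπ, h⟩ := h
  intro q hq hqm
  have := (perm_mem_range hπ).2 ⟨hq, hqm⟩
  rw [h, Function.update_apply]
  split_ifs with e
  · exact ⟨hl, hu⟩
  · exact hH _ (lt_of_le_of_ne this.1 (Ne.symm e)) this.2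

theorem IsPull.exists_eq (h : IsPull p m H H') {r : ℕ} (hr : p < r) (hrm : r < m) :
    ∃ q, p ≤ q ∧ q < m ∧ H' q = H r := by
  obtain ⟨π, hπ, h⟩ := h
  have : p ≤ π (π.symm r) ∧ π (π.symm r) < m := by simp [hr.le, hrm]
  obtain ⟨h1, h2⟩ := (perm_mem_range hπ).1 this
  refine ⟨π.symm r, h1, h2, ?_⟩
  rw [h, Equiv.apply_symm_apply, Function.update_of_ne hr.ne']

theorem IsPull.countNonneg_eq (h : IsPull p m H H') :
    countNonneg p m H' = countNonneg (p + 1) m H := by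
  classical
  obtain ⟨π, hπ, h⟩ := h
  unfold countNonneg
  refine Finset.card_equiv π fun q => ?_
  have hr := perm_mem_range hπ (q := q)
  simp only [Finset.mem_filter, Finset.mem_Ico, h q, Function.update_apply]
  by_cases e : π q = p
  · simp [e]
  · rw [if_neg e]
    constructor
    · rintro ⟨h1, h2⟩
      have := hr.2 h1
      exact ⟨⟨lt_of_le_of_ne this.1 (Ne.symm e), this.2⟩, h2⟩
    · rintro ⟨h1, h2⟩
      exact ⟨hr.1 ⟨by lia, h1.2⟩, h2⟩

theorem countNonneg_succ (hp : p < m) (h : 0 ≤ H p) :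
    countNonneg p m H = countNonneg (p + 1) m H + 1 := by
  classical
  unfold countNonneg
  rw [← Finset.insert_Ico_add_one_left_eq_Ico hp, Finset.filter_insert, if_pos h,
    Finset.card_insert_of_notMem (by simp)]

end IsPull

/-- Starting from the node held by the variable `14`, whose value is given up, the values of the
larger children are moved up until a leaf is reached, which gets the value `-1`.  The number of
leaves is held by the variable `13`. -/
def pull : Program :=
  .loop (.natLT (.var 14) (.var 13))
    (.letNat 15 (.add (.var 14) (.var 14)) ;;
      .cond (.realLT (.cell 5 (.var 15)) (.cell 5 (.add (.var 15) (.const 1))))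
        (.letNat 15 (.add (.var 15) (.const 1))) .skip ;;
      .setReal 5 (.var 14) (.cell 5 (.var 15)) ;; .letNat 14 (.var 15)) ;;
  .setReal 5 (.var 14) (.sub (.const 0) (.const 1))

theorem pull_spec {O : Set ℕ → Prop} {σ : Memory} {N p k : ℕ} (hN : σ.nat 13 0 = N)
    (hp : σ.nat 14 0 = p) (h1 : 1 ≤ p) (h2 : p < 2 * N) (hk : N ≤ p * 2 ^ k)
    (hheap : IsHeap N p (σ.real 5)) (hlow : ∀ q, p ≤ q → q < 2 * N → -1 ≤ σ.real 5 q) :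
    wp O pull (k * 6 + 2)
      (fun τ => IsHeap N p (τ.real 5) ∧ IsPull p (2 * N) (σ.real 5) (τ.real 5)) σ := by
  refine wp_seq (T := k * (5 + 1) + 1) (T' := 1)
    (Q := fun τ => N ≤ τ.nat 14 0 ∧ p ≤ τ.nat 14 0 ∧ τ.nat 14 0 < 2 * N ∧
      IsHeap N p (τ.real 5) ∧ (∀ q, p ≤ q → q < 2 * N → -1 ≤ τ.real 5 q) ∧
      ∃ π : Equiv.Perm ℕ, (∀ q, ¬ (p ≤ q ∧ q < 2 * N) → π q = q) ∧ π (τ.nat 14 0) = p ∧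
        ∀ q, q ≠ τ.nat 14 0 → τ.real 5 q = σ.real 5 (π q)) ?_ ?_
  · refine wp_loop (fun k τ => N ≤ τ.nat 14 0 * 2 ^ k ∧ p ≤ τ.nat 14 0 ∧ τ.nat 14 0 < 2 * N ∧
      IsHeap N p (τ.real 5) ∧ (∀ q, p ≤ q → q < 2 * N → -1 ≤ τ.real 5 q) ∧
      ∃ π : Equiv.Perm ℕ, (∀ q, ¬ (p ≤ q ∧ q < 2 * N) → π q = q) ∧ π (τ.nat 14 0) = p ∧
        ∀ q, q ≠ τ.nat 14 0 → τ.real 5 q = σ.real 5 (π q)) ?_ ?_ ?_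
    · rw [hp]
      exact ⟨hk, le_rfl, h2, hheap, hlow, 1, fun _ _ => rfl, rfl, fun _ _ => rfl⟩
    · rintro k τ hA ⟨hk, hp1, hp2, hh, hl, π, hπ, hπp, hπH⟩ hlt
      have hN' : τ.nat 13 0 = N := by
        rw [hA.nat 13 (by simp [Program.WritesNat]), hN]
      simp only [Test.Holds, NatExpr.eval, hN', not_le] at hlt
      obtain ⟨k, rfl⟩ : ∃ k', k = k' + 1 := by
        refine ⟨k - 1, ?_⟩
        rcases k with _ | k
        · simp at hk; lia
        · rfl
      generalize hp' : τ.nat 14 0 = p' at *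
      -- the child that is moved up
      have key : ∀ c, c = 2 * p' ∨ c = 2 * p' + 1 → τ.real 5 (2 * p') ≤ τ.real 5 c →
          τ.real 5 (2 * p' + 1) ≤ τ.real 5 c →
          ∀ ρ : Memory, ρ.nat 14 0 = c → ρ.real 5 = Function.update (τ.real 5) p' (τ.real 5 c) →
          N ≤ ρ.nat 14 0 * 2 ^ k ∧ p ≤ ρ.nat 14 0 ∧ ρ.nat 14 0 < 2 * N ∧
          IsHeap N p (ρ.real 5) ∧ (∀ q, p ≤ q → q < 2 * N → -1 ≤ ρ.real 5 q) ∧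
          ∃ π : Equiv.Perm ℕ, (∀ q, ¬ (p ≤ q ∧ q < 2 * N) → π q = q) ∧ π (ρ.nat 14 0) = p ∧
            ∀ q, q ≠ ρ.nat 14 0 → ρ.real 5 q = σ.real 5 (π q) := by
        intro c hc hc1 hc2 ρ hρ hρ'
        rw [hρ, hρ']
        refine ⟨?_, by lia, by lia, ?_, ?_, (Equiv.swap p' c).trans π, ?_, ?_, ?_⟩
        · rw [pow_succ] at hk
          have : p' * 2 * 2 ^ k ≤ c * 2 ^ k := Nat.mul_le_mul_right _ (by lia)
          nlinarith
        · refine hh.update h1 ?_ fun _ => ⟨hc1, hc2⟩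
          have := hh p' hp1 hlt
          rcases hc with rfl | rfl
          · exact this.1
          · exact this.2
        · intro q hq1 hq2
          rw [Function.update_apply]
          split_ifs
          · exact hl c (by lia) (by lia)
          · exact hl q hq1 hq2
        · intro q hq
          rw [Equiv.trans_apply, Equiv.swap_apply_of_ne_of_ne (by lia) (by lia), hπ q hq]
        · simp [hπp]
        · intro q hq
          rw [Equiv.trans_apply, Function.update_apply]
          split_ifs with e
          · rw [e, Equiv.swap_apply_left, hπH c (by lia)]
          · rw [Equiv.swap_apply_of_ne_of_ne e hq, hπH q e]
      refine wp_setNat_seq (wp_seq (T := 2) (T' := 2)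
        (Q := fun ρ => ρ.nat 14 0 = p' ∧ ρ.real 5 = τ.real 5 ∧ ∃ c, ρ.nat 15 0 = c ∧
          (c = 2 * p' ∨ c = 2 * p' + 1) ∧ τ.real 5 (2 * p') ≤ τ.real 5 c ∧
          τ.real 5 (2 * p' + 1) ≤ τ.real 5 c) ?_ ?_)
      · refine wp_cond (fun h => wp_setNat ?_) (fun h => wp_skip ?_)
        · simp [Test.Holds, NatExpr.eval, RealExpr.eval, hp', ← two_mul] at h ⊢
          exact h.le
        · simp [Test.Holds, NatExpr.eval, RealExpr.eval, hp', ← two_mul] at h ⊢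
          exact h
      · rintro ρ - ⟨e1, e2, c, hc, h3, h4, h5⟩
        refine wp_setReal_seq (wp_setNat ⟨k, by lia, key c h3 h4 h5 _ ?_ ?_⟩)
        · simp [NatExpr.eval, hc]
        · simp [NatExpr.eval, RealExpr.eval, Memory.writeReal_real_self, e1, e2, hc]
    · rintro k τ hA ⟨hk, hp1, hp2, hh⟩ hlt
      have hN' : τ.nat 13 0 = N := by
        rw [hA.nat 13 (by simp [Program.WritesNat]), hN]
      simp only [Test.Holds, NatExpr.eval, hN', not_le, not_lt] at hlt
      exact ⟨hlt, hp1, hp2, hh⟩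
  · rintro τ - ⟨hp0, hp1, hp2, hh, hl, π, hπ, hπp, hπH⟩
    refine wp_setReal ?_
    simp only [NatExpr.eval, RealExpr.eval, Memory.writeReal_real_self, Nat.cast_zero, zero_sub,
      Nat.cast_one]
    refine ⟨hh.update h1 (hl _ hp1 hp2) fun h => absurd h (by lia), π, hπ, fun q => ?_⟩
    rw [Function.update_apply, Function.update_apply]
    by_cases e : q = τ.nat 14 0
    · rw [if_pos e, e, if_pos hπp]
    · rw [if_neg e, if_neg fun h => e (π.injective (h.trans hπp.symm)), hπH q e]

/-- The leaves `N, …, 2 N - 1` of array `5` are made into a heap, where `N` is held by the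
variable `13`. -/
def buildHeap : Program :=
  .forLoop 17 (.sub (.var 13) (.const 1))
    (.letNat 14 (.sub (.sub (.var 13) (.const 1)) (.var 17)) ;;
      .setReal 5 (.var 14) (.const 2) ;; pull)

/-- The heap in array `5` is emptied; its nonnegative entries are put in decreasing order into the
cells `1, 2, …` of array `6`, and their number into the variable `16`. -/
def emptyHeap : Program :=
  .letNat 16 (.const 0) ;;
  .loop (.realLE (.const 0) (.cell 5 (.const 1)))
    (.letNat 16 (.add (.var 16) (.const 1)) ;;
      .setReal 6 (.var 16) (.cell 5 (.const 1)) ;;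
      .letNat 14 (.const 1) ;; pull)

theorem pull_writesNat {k : ℕ} : pull.WritesNat k ↔ k = 14 ∨ k = 15 := by
  simp only [pull, Program.WritesNat]; lia

theorem pull_writesReal {k : ℕ} : pull.WritesReal k ↔ k = 5 := by
  simp only [pull, Program.WritesReal]; lia

theorem buildHeap_writesNat {k : ℕ} : buildHeap.WritesNat k ↔ k = 14 ∨ k = 15 ∨ k = 17 := by
  simp only [buildHeap, Program.forLoop, Program.WritesNat, pull_writesNat]; lia

theorem buildHeap_writesReal {k : ℕ} : buildHeap.WritesReal k ↔ k = 5 := by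
  simp only [buildHeap, Program.forLoop, Program.WritesReal, pull_writesReal]; lia

theorem emptyHeap_writesNat {k : ℕ} : emptyHeap.WritesNat k ↔ k = 14 ∨ k = 15 ∨ k = 16 := by
  simp only [emptyHeap, Program.WritesNat, pull_writesNat]; lia

theorem emptyHeap_writesReal {k : ℕ} : emptyHeap.WritesReal k ↔ k = 5 ∨ k = 6 := by
  simp only [emptyHeap, Program.WritesReal, pull_writesReal]; lia

/-- The state of the heap: the entries of the nodes `p, …, 2 N - 1` lie between `-1` and `1`, and
at most `c` of them are nonnegative. -/
structure HeapState (N p c : ℕ) (H : ℕ → ℝ) : Prop where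
  heap : IsHeap N p H
  bounds : ∀ q, p ≤ q → q < 2 * N → -1 ≤ H q ∧ H q ≤ 1
  count : countNonneg p (2 * N) H ≤ c

theorem buildHeap_spec {O : Set ℕ → Prop} {σ : Memory} {N k : ℕ} (hN : σ.nat 13 0 = N)
    (h1 : 1 ≤ N) (hk : N ≤ 2 ^ k)
    (hH : ∀ q, N ≤ q → q < 2 * N → 0 ≤ σ.real 5 q ∧ σ.real 5 q ≤ 1) :
    wp O buildHeap ((N - 1) * (k * 6 + 6) + 2)
      (fun τ => HeapState N 1 N (τ.real 5) ∧
        ∀ r, N ≤ r → r < 2 * N → ∃ q, 1 ≤ q ∧ q < 2 * N ∧ τ.real 5 q = σ.real 5 r) σ := by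
  refine (wp_forLoop (N := N - 1) (c := k * 6 + 4)
    (fun i τ => HeapState N (N - i) N (τ.real 5) ∧
      ∀ r, N ≤ r → r < 2 * N → ∃ q, N - i ≤ q ∧ q < 2 * N ∧ τ.real 5 q = σ.real 5 r)
    (by simp [Program.WritesNat, pull_writesNat]) ?_ ?_ ?_).mono (by lia) ?_
  · intro τ hA
    have : τ.nat 13 = σ.nat 13 := hA.nat 13 (by
      change ¬ buildHeap.WritesNat 13
      simp [buildHeap_writesNat])
    simp [NatExpr.eval, this, hN]
  · refine ⟨⟨fun q h h' => absurd h (by lia), fun q h h' => ?_, ?_⟩,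
      fun r h h' => ⟨r, by lia, h', rfl⟩⟩
    · have := hH q (by lia) h'
      rw [Memory.writeNat_real]
      exact ⟨by linarith [this.1], this.2⟩
    · unfold countNonneg
      refine (Finset.card_filter_le _ _).trans ?_
      rw [Nat.card_Ico]; lia
  · rintro i τ hi hA hiv ⟨⟨hh, hb, hc⟩, hv⟩
    have hN' : τ.nat 13 0 = N := by
      rw [hA.nat 13 (by change ¬ buildHeap.WritesNat 13; simp [buildHeap_writesNat]), hN]
    obtain ⟨p, hp⟩ : ∃ p, N - i = p + 1 := ⟨N - i - 1, by lia⟩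
    have hp' : N - 1 - i = p := by lia
    refine (wp_setNat_seq (wp_setReal_seq (wp.imp (pull_spec (N := N) (p := p) (k := k)
      ?_ ?_ (by lia) (by lia) ?_ ?_ ?_) ?_))).weaken (by lia)
    · simpa using hN'
    · simp [NatExpr.eval, hiv, hN', hp']
    · exact hk.trans (Nat.le_mul_of_pos_left _ (by lia))
    · intro q hq hqN
      simp only [NatExpr.eval, RealExpr.eval, Memory.writeNat_nat_same, hiv, hN', hp',
        Memory.writeReal_real_self, Function.update_apply, Memory.writeNat_real]
      rw [if_neg (show ¬ 2 * q = p by lia), if_neg (show ¬ 2 * q + 1 = p by lia)]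
      split_ifs with e
      · have h1 := hb (2 * q) (by lia) (by lia)
        have h2 := hb (2 * q + 1) (by lia) (by lia)
        constructor <;> norm_num <;> linarith
      · exact hh q (by lia) hqN
    · intro q hq hqN
      simp only [NatExpr.eval, RealExpr.eval, Memory.writeNat_nat_same, hiv, hN', hp',
        Memory.writeReal_real_self, Function.update_apply, Memory.writeNat_real]
      split_ifs with e
      · norm_num
      · exact (hb q (by lia) hqN).1
    · rintro ρ - ⟨hheap, hpull⟩
      simp only [NatExpr.eval, RealExpr.eval, Memory.writeNat_nat_same, hiv, hN', hp',
        Memory.writeReal_real_self, Memory.writeNat_real] at hpull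
      have hpi : N - (i + 1) = p := by lia
      simp only [Memory.writeNat_real, hpi]
      have hne : ∀ q, p < q → Function.update (τ.real 5) p ((2 : ℕ) : ℝ) q = τ.real 5 q :=
        fun q hq => Function.update_of_ne hq.ne' _ _
      refine ⟨⟨hheap, hpull.bounds le_rfl (by norm_num) fun q hq hq' => ?_, ?_⟩, fun r hr hr' => ?_⟩
      · rw [hne q hq]
        exact hb q (by lia) hq'
      · rw [hpull.countNonneg_eq]
        refine le_trans (le_of_eq ?_) (hp ▸ hc)
        unfold countNonneg
        congr 1
        refine Finset.filter_congr fun q hq => ?_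
        rw [hne q (by simp at hq; lia)]
      · obtain ⟨q, hq, hq', e⟩ := hv r hr hr'
        obtain ⟨q', h1, h2, h3⟩ := hpull.exists_eq (r := q) (by lia) hq'
        exact ⟨q', h1, h2, by rw [h3, hne q (by lia), e]⟩
  · intro τ _ h
    rwa [show N - (N - 1) = 1 by lia] at h

/-- The cells `1, …, K` of `L` are in decreasing order and lie between `0` and `1`. -/
structure IsSortedList (K : ℕ) (L : ℕ → ℝ) : Prop where
  anti : ∀ i j, 1 ≤ i → i ≤ j → j ≤ K → L j ≤ L i
  bounds : ∀ i, 1 ≤ i → i ≤ K → 0 ≤ L i ∧ L i ≤ 1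

theorem IsSortedList.snoc {K : ℕ} {L : ℕ → ℝ} {x : ℝ} (h : IsSortedList K L) (h0 : 0 ≤ x)
    (h1 : x ≤ 1) (hx : ∀ i, 1 ≤ i → i ≤ K → x ≤ L i) :
    IsSortedList (K + 1) (Function.update L (K + 1) x) := by
  refine ⟨fun i j hi hij hj => ?_, fun i hi hiK => ?_⟩
  · simp only [Function.update_apply]
    split_ifs with e1 e2
    · exact le_rfl
    · exact hx i hi (by lia)
    · lia
    · exact h.anti i j hi hij (by lia)
  · simp only [Function.update_apply]
    split_ifs with e1
    · exact ⟨h0, h1⟩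
    · exact h.bounds i hi (by lia)

theorem emptyHeap_spec {O : Set ℕ → Prop} {σ : Memory} {N k : ℕ} (hN : σ.nat 13 0 = N)
    (h1 : 1 ≤ N) (hk : N ≤ 2 ^ k) (hH : HeapState N 1 N (σ.real 5)) :
    wp O emptyHeap (N * (k * 6 + 6) + 2)
      (fun τ => τ.nat 16 0 ≤ N ∧ IsSortedList (τ.nat 16 0) (τ.real 6) ∧
        ∀ q, 1 ≤ q → q < 2 * N → 0 ≤ σ.real 5 q →
          ∃ j, 1 ≤ j ∧ j ≤ τ.nat 16 0 ∧ τ.real 6 j = σ.real 5 q) σ := by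
  refine (wp_setNat_seq (T := N * ((k * 6 + 5) + 1) + 1)
    (wp_loop (fun c τ => c + τ.nat 16 0 = N ∧ HeapState N 1 c (τ.real 5) ∧
      IsSortedList (τ.nat 16 0) (τ.real 6) ∧
      (∀ j, 1 ≤ j → j ≤ τ.nat 16 0 → τ.real 5 1 ≤ τ.real 6 j) ∧
      ∀ q, 1 ≤ q → q < 2 * N → 0 ≤ σ.real 5 q →
        (∃ j, 1 ≤ j ∧ j ≤ τ.nat 16 0 ∧ τ.real 6 j = σ.real 5 q) ∨
        ∃ q', 1 ≤ q' ∧ q' < 2 * N ∧ τ.real 5 q' = σ.real 5 q) ?_ ?_ ?_)).weaken (by lia)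
  · simp only [NatExpr.eval, Memory.writeNat_nat_same, Memory.writeNat_real]
    exact ⟨by lia, hH, ⟨fun i j _ _ _ => by lia, fun i _ _ => by lia⟩, fun j _ _ => by lia,
      fun q hq hq' _ => Or.inr ⟨q, hq, hq', rfl⟩⟩
  · rintro c τ hA ⟨hcK, ⟨hh, hb, hc⟩, hs, hr, hv⟩ hp
    have hN' : τ.nat 13 0 = N := by
      rw [hA.nat 13 (by simp [Program.WritesNat, pull_writesNat])]
      simp [hN]
    simp only [Test.Holds, RealExpr.eval, NatExpr.eval, Nat.cast_zero] at hp
    rw [countNonneg_succ (by lia) hp] at hc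
    generalize hK : τ.nat 16 0 = K at *
    refine (wp_setNat_seq (wp_setReal_seq (wp_setNat_seq (wp.imp
      (pull_spec (N := N) (p := 1) (k := k) ?_ ?_ le_rfl (by lia) (by lia) ?_ ?_) ?_)))).weaken
        (by lia)
    · simpa using hN'
    · simp [NatExpr.eval]
    · simpa using hh
    · simpa using fun q hq hq' => (hb q hq hq').1
    · rintro ρ hB ⟨hheap, hpull⟩
      have eK : ρ.nat 16 0 = K + 1 := by
        rw [hB.nat 16 (by simp [pull_writesNat])]
        simp [NatExpr.eval, hK]
      have eL : ρ.real 6 = Function.update (τ.real 6) (K + 1) (τ.real 5 1) := by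
        rw [hB.real 6 (by simp [pull_writesReal])]
        simp [NatExpr.eval, RealExpr.eval, Memory.writeReal_real_self, hK]
      have eH : (((τ.writeNat 16 0 (K + 1)).writeReal 6 (K + 1) (τ.real 5 1)).writeNat 14 0 1).real 5
          = τ.real 5 := by simp
      simp only [NatExpr.eval, RealExpr.eval, Memory.writeNat_real, Memory.writeNat_nat_same, hK,
        eH] at hpull
      have hbd := hpull.bounds le_rfl (by norm_num) fun q hq hq' => hb q hq.le hq'
      have hroot : ρ.real 5 1 ≤ τ.real 5 1 := by
        obtain ⟨π, hπ, hpi⟩ := hpull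
        have := (perm_mem_range hπ (q := 1)).2 ⟨le_rfl, by lia⟩
        rw [hpi 1, Function.update_apply]
        split_ifs
        · linarith
        · exact hh.le_root _ this.1 this.2
      refine ⟨c - 1, by lia, ?_⟩
      rw [eK, eL]
      refine ⟨by lia, ⟨hheap, hbd, ?_⟩, hs.snoc hp (hb 1 le_rfl (by lia)).2 hr, ?_, ?_⟩
      · rw [hpull.countNonneg_eq]
        lia
      · intro j hj hj'
        rw [Function.update_apply]
        split_ifs
        · exact hroot
        · exact hroot.trans (hr j hj (by lia))
      · intro q hq hq' h0
        rcases hv q hq hq' h0 with ⟨j, hj, hj', e⟩ | ⟨q', h1, h2, e⟩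
        · exact Or.inl ⟨j, hj, by lia, by rw [Function.update_of_ne (by lia), e]⟩
        · rcases Nat.eq_or_lt_of_le h1 with rfl | h1
          · exact Or.inl ⟨K + 1, by lia, le_rfl, by simpa using e⟩
          · obtain ⟨q'', h3, h4, h5⟩ := hpull.exists_eq h1 h2
            exact Or.inr ⟨q'', h3, h4, h5.trans e⟩
  · rintro c τ hA ⟨hcK, ⟨hh, hb, hc⟩, hs, hr, hv⟩ hp
    simp only [Test.Holds, RealExpr.eval, NatExpr.eval, Nat.cast_zero, not_le] at hp
    refine ⟨by lia, hs, fun q hq hq' h0 => (hv q hq hq' h0).resolve_right ?_⟩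
    rintro ⟨q', h3, h4, h5⟩
    have := hh.le_root q' h3 h4
    linarith

end BudgetedMax

namespace BudgetedMax

open RealRAM

/-! ### Sets, sums and weights in memory -/

/-! The integer arrays are used as follows: `0`, `1`, `2` for the input, `3` for the flag and `4` for
the output; `5` for the current basis; `6` and `7` for the elements of an exchange; `8` for the
elements that must not be removed, `9` for those that are still available; `11` and `12` for a
feasible and an infeasible basis during the search; `20`, …, `39` for the subroutines of an `Engine`;
the others for counters and addresses.  The real arrays `0`, `1`, `2` hold the input, `3` the weights,
`5` the heap, `6` the sorted crossings; the real variable `8` is `θ`, `9` and `10` are the values of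
constraint and objective at the current basis, `11` is the best objective recorded so far and `12`
the largest objective of an available element. -/

section Basic

variable {d : ℕ} {O : Set ℕ → Prop} {a b : Fin d → ℝ} {s : ℝ} {σ τ : Memory} {P : Program}

/-- The set whose indicator is held by the integer array `k`. -/
def held (d k : ℕ) (σ : Memory) : Finset (Fin d) :=
  Finset.univ.filter fun i => σ.nat k (i : ℕ) ≠ 0

@[simp] theorem mem_held {k : ℕ} {i : Fin d} : i ∈ held d k σ ↔ σ.nat k i ≠ 0 := by
  simp [held]

theorem held_congr {k k' : ℕ} (h : ∀ i < d, τ.nat k i = σ.nat k' i) :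
    held d k τ = held d k' σ := by
  ext i
  simp [h i i.2]

theorem held_of_nat_eq {k : ℕ} (h : τ.nat k = σ.nat k) : held d k τ = held d k σ :=
  held_congr fun i _ => by rw [h]

theorem output_eq_held : output d σ = held d 4 σ := rfl

@[simp] theorem pad_coe (f : Fin d → ℝ) (i : Fin d) : pad f (i : ℕ) = f i := by
  simp [pad]

/-- The memory holds the input of the problem. -/
structure HasData (a b : Fin d → ℝ) (s : ℝ) (σ : Memory) : Prop where
  dim : σ.nat 0 0 = d
  ra : σ.real 0 = pad a
  rb : σ.real 1 = pad b
  rs : σ.real 2 0 = s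

theorem HasData.congr (h : HasData a b s σ) (h0 : τ.nat 0 = σ.nat 0)
    (hr : ∀ k ≤ 2, τ.real k = σ.real k) : HasData a b s τ := by
  refine ⟨?_, ?_, ?_, ?_⟩
  · rw [h0, h.dim]
  · rw [hr 0 (by lia), h.ra]
  · rw [hr 1 (by lia), h.rb]
  · rw [hr 2 (by lia), h.rs]

theorem HasData.agree (h : HasData a b s σ) (hA : Agree P σ τ)
    (hn : ∀ k, P.WritesNat k → k ≠ 0 := by simp [Program.WritesNat])
    (hr : ∀ k, P.WritesReal k → 2 < k := by simp [Program.WritesReal]) : HasData a b s τ :=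
  h.congr (hA.nat 0 fun h => hn 0 h rfl) fun k hk => hA.real k fun h => by have := hr k h; lia

theorem filter_lt_succ {B : Finset (Fin d)} {i : ℕ} (hi : i < d) :
    B.filter (fun j : Fin d => (j : ℕ) < i + 1) =
      if (⟨i, hi⟩ : Fin d) ∈ B then insert ⟨i, hi⟩ (B.filter fun j : Fin d => (j : ℕ) < i)
      else B.filter fun j : Fin d => (j : ℕ) < i := by
  split_ifs with h
  · ext j
    simp only [Finset.mem_filter, Finset.mem_insert, Fin.ext_iff]
    constructor
    · rintro ⟨h1, h2⟩
      by_cases e : (j : ℕ) = i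
      · exact Or.inl e
      · exact Or.inr ⟨h1, by lia⟩
    · rintro (e | ⟨h1, h2⟩)
      · have : j = ⟨i, hi⟩ := Fin.ext e
        exact ⟨this ▸ h, by lia⟩
      · exact ⟨h1, by lia⟩
  · refine Finset.filter_congr fun j hj => ?_
    have : (j : ℕ) ≠ i := fun e => h ((Fin.ext e : j = ⟨i, hi⟩) ▸ hj)
    lia

/-- The real variable `r` is set to the sum of the array `q` over the current basis. -/
def sumOver (r q : ℕ) : Program :=
  .letReal r (.const 0) ;;
  .forLoop 18 (.var 0) (.cond (.nonZero (.cell 5 (.var 18)))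
    (.letReal r (.add (.var r) (.cell q (.var 18)))) .skip)

theorem sumOver_nat {r q k : ℕ} : (sumOver r q).WritesNat k ↔ k = 18 := by
  simp only [sumOver, Program.forLoop, Program.WritesNat]; lia

theorem sumOver_real {r q k : ℕ} : (sumOver r q).WritesReal k ↔ k = r := by
  simp only [sumOver, Program.forLoop, Program.WritesReal]; lia

theorem sumOver_spec {r q : ℕ} (hrq : q ≠ r) (hd : σ.nat 0 0 = d) :
    wp O (sumOver r q) (d * 4 + 3)
      (fun τ => τ.real r 0 = ∑ i ∈ held d 5 σ, σ.real q i) σ := by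
  refine (wp_setReal_seq (wp.imp (wp_forLoop (N := d) (c := 2)
    (fun i τ => τ.real r 0 = ∑ j ∈ (held d 5 σ).filter (fun j : Fin d => (j : ℕ) < i), σ.real q j)
    ?_ ?_ ?_ ?_) ?_)).weaken (by lia)
  · simp [Program.WritesNat]
  · intro τ hA
    rw [NatExpr.eval, hA.nat 0 (by simp [Program.forLoop, Program.WritesNat])]
    simpa [NatExpr.eval] using hd
  · simp [NatExpr.eval, RealExpr.eval]
  · intro i τ hi hA hiv hI
    have h5 : τ.nat 5 = σ.nat 5 := by
      rw [hA.nat 5 (by simp [Program.forLoop, Program.WritesNat])]; simp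
    have hq : τ.real q = σ.real q := by
      rw [hA.real q (by simp [Program.forLoop, Program.WritesReal, hrq])]; simp [hrq]
    have hmem : (⟨i, hi⟩ : Fin d) ∈ held d 5 σ ↔ ¬ σ.nat 5 i ≤ 0 := by simp
    simp only [filter_lt_succ hi, hmem, Memory.writeNat_real]
    refine wp_cond (fun hp => wp_setReal ?_) (fun hp => wp_skip ?_)
    · simp only [Test.Holds, NatExpr.eval, hiv, h5] at hp
      rw [if_pos hp, Finset.sum_insert (by simp)]
      simp only [RealExpr.eval, NatExpr.eval, Memory.writeReal_real_same, hI, hiv, hq]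
      ring
    · simp only [Test.Holds, NatExpr.eval, hiv, h5] at hp
      rw [if_neg hp, hI]
  · intro τ _ h
    rw [h]
    refine Finset.sum_congr (Finset.filter_true_of_mem fun j _ => j.2) fun _ _ => rfl

/-- The first `d` cells of the integer array `k'` are copied to the array `k`. -/
def copySet (k k' : ℕ) : Program :=
  .forLoop 18 (.var 0) (.setNat k (.var 18) (.cell k' (.var 18)))

theorem copySet_nat {k k' j : ℕ} : (copySet k k').WritesNat j ↔ j = 18 ∨ j = k := by
  simp only [copySet, Program.forLoop, Program.WritesNat]; lia

theorem copySet_real {k k' j : ℕ} : ¬ (copySet k k').WritesReal j := by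
  simp [copySet, Program.forLoop, Program.WritesReal]

theorem copySet_spec {k k' : ℕ} (hk : k' ≠ k) (h0 : k ≠ 0) (h1 : k ≠ 18) (h2 : k' ≠ 18)
    (hd : σ.nat 0 0 = d) :
    wp O (copySet k k') (d * 3 + 2) (fun τ => held d k τ = held d k' σ) σ := by
  refine (wp_forLoop (N := d) (c := 1)
    (fun i τ => ∀ j < i, τ.nat k j = σ.nat k' j) ?_ ?_ ?_ ?_).imp ?_
  · simp [Program.WritesNat, h1.symm]
  · intro τ hA
    rw [NatExpr.eval, hA.nat 0 (by simp [Program.forLoop, Program.WritesNat, h0.symm])]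
    exact hd
  · simp
  · intro i τ hi hA hiv hI
    have hq : τ.nat k' = σ.nat k' :=
      hA.nat k' (by simp [Program.forLoop, Program.WritesNat, hk, h2])
    refine wp_setNat fun j hj => ?_
    rw [Memory.writeNat_nat_of_ne _ _ _ h1]
    simp only [NatExpr.eval, hiv, hq, Memory.writeNat_nat]
    split_ifs with e
    · rw [e.2]
    · exact hI j (by lia)
  · exact fun τ _ h => held_congr h

/-- The weight array is set to the Lagrangian weight with the parameter in the real variable
`8`. -/
def setWeight : Program :=
  .forLoop 18 (.var 0) (.setReal 3 (.var 18)
    (.add (.mul (.sub (.const 1) (.var 8)) (.cell 1 (.var 18)))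
      (.mul (.var 8) (.cell 0 (.var 18)))))

theorem setWeight_nat {j : ℕ} : setWeight.WritesNat j ↔ j = 18 := by
  simp only [setWeight, Program.forLoop, Program.WritesNat]; lia

theorem setWeight_real {j : ℕ} : setWeight.WritesReal j ↔ j = 3 := by
  simp only [setWeight, Program.forLoop, Program.WritesReal]; lia

/-- The weight array holds `w`. -/
def HasWeight (w : Fin d → ℝ) (σ : Memory) : Prop := ∀ i : Fin d, σ.real 3 i = w i

theorem setWeight_spec (hd : HasData a b s σ) :
    wp O setWeight (d * 3 + 2) (HasWeight (lagrange a b (σ.real 8 0))) σ := by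
  refine (wp_forLoop (N := d) (c := 1)
    (fun i τ => ∀ j : Fin d, (j : ℕ) < i → τ.real 3 j = lagrange a b (σ.real 8 0) j)
    ?_ ?_ ?_ ?_).imp ?_
  · simp [Program.WritesNat]
  · intro τ hA
    rw [NatExpr.eval, hA.nat 0 (by simp [Program.forLoop, Program.WritesNat])]
    exact hd.dim
  · simp
  · intro i τ hi hA hiv hI
    have hd' : HasData a b s τ := hd.agree hA (by simp [Program.forLoop, Program.WritesNat])
      (by simp [Program.forLoop, Program.WritesReal])
    have h8 : τ.real 8 = σ.real 8 := hA.real 8 (by simp [Program.forLoop, Program.WritesReal])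
    refine wp_setReal fun j hj => ?_
    rw [Memory.writeNat_real]
    simp only [NatExpr.eval, RealExpr.eval, hiv, hd'.ra, hd'.rb, h8, Memory.writeReal_real]
    split_ifs with e
    · simp [← e.2, lagrange]
    · exact hI j (by lia)
  · exact fun τ _ h j => h j j.2

end Basic

/-! ### The operations on bases -/

/-- The programs `bo` and `ex` operate on a member `B` of `X` that is represented in the memory.
The member is held by the integer array `5`, the weights by the real array `3`.  For an element
`f ∉ B`, held by the variable `6`, the program `bo` finds an element `g` of least weight such that
`f` can be exchanged for `g`, among those not marked in the integer array `8`, and puts it into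
the variable `7`; a value `≥ d` says that there is none.  The program `ex` performs the exchange.
Both work on the integer arrays `5`, `7`, `10` and `20, …, 39` only, and take `c` steps. -/
structure Engine {d : ℕ} (X : Set (Finset (Fin d))) (O : Set ℕ → Prop) (bo ex : Program) (c : ℕ)
    (Rep : Memory → Finset (Fin d) → Prop) : Prop where
  mem : ∀ {σ B}, Rep σ B → B ∈ X
  held_eq : ∀ {σ B}, Rep σ B → held d 5 σ = B
  congr : ∀ {σ τ B}, (∀ k, k ≤ 2 ∨ k = 5 ∨ 20 ≤ k ∧ k < 40 → τ.nat k = σ.nat k) → Rep σ B → Rep τ B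
  bo_nat : ∀ {k}, bo.WritesNat k → k = 5 ∨ k = 7 ∨ k = 10 ∨ 20 ≤ k ∧ k < 40
  ex_nat : ∀ {k}, ex.WritesNat k → k = 5 ∨ k = 7 ∨ k = 10 ∨ 20 ≤ k ∧ k < 40
  bo_real : ∀ {k}, ¬ bo.WritesReal k
  ex_real : ∀ {k}, ¬ ex.WritesReal k
  bo_spec : ∀ {σ B} {f : Fin d}, σ.nat 0 0 = d → Rep σ B → σ.nat 6 0 = f → f ∉ B →
    wp O bo (c) (fun τ => Rep τ B ∧
      (d ≤ τ.nat 7 0 → ∀ g ∈ B, g ∉ held d 8 σ → insert f (B.erase g) ∉ X) ∧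
      ∀ g : Fin d, τ.nat 7 0 = g → g ∈ B ∧ g ∉ held d 8 σ ∧ insert f (B.erase g) ∈ X ∧
        ∀ g' ∈ B, g' ∉ held d 8 σ → insert f (B.erase g') ∈ X → σ.real 3 g ≤ σ.real 3 g') σ
  ex_spec : ∀ {σ B} {f g : Fin d}, σ.nat 0 0 = d → Rep σ B → σ.nat 6 0 = f → σ.nat 7 0 = g →
    f ∉ B → g ∈ B → insert f (B.erase g) ∈ X →
    wp O ex (c) (fun τ => Rep τ (insert f (B.erase g))) σ

section Engine

variable {d : ℕ} {X : Set (Finset (Fin d))} {O : Set ℕ → Prop} {bo ex : Program} {c : ℕ}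
  {Rep : Memory → Finset (Fin d) → Prop} {a b : Fin d → ℝ} {s : ℝ} {σ τ : Memory} {P : Program}
  {B : Finset (Fin d)}

theorem Engine.writeNat (E : Engine X O bo ex c Rep) (hR : Rep σ B) {k i x : ℕ}
    (hk : ¬ (k ≤ 2 ∨ k = 5 ∨ 20 ≤ k ∧ k < 40)) : Rep (σ.writeNat k i x) B :=
  E.congr (fun _ hj => Memory.writeNat_nat_of_ne _ _ _ fun h => hk (h ▸ hj)) hR

theorem Engine.writeReal (E : Engine X O bo ex c Rep) (hR : Rep σ B) {k i : ℕ} {x : ℝ} :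
    Rep (σ.writeReal k i x) B :=
  E.congr (σ := σ) (fun _ _ => rfl) hR

/-! ### Recording the best feasible basis -/

/-- The current basis is recorded in the output array if it is feasible and better than the best
one so far, whose objective is held by the real variable `11`. -/
def consider : Program :=
  sumOver 9 0 ;; sumOver 10 1 ;;
  .cond (.and (.realLE (.var 2) (.var 9)) (.realLT (.var 11) (.var 10)))
    (copySet 4 5 ;; .letReal 11 (.var 10)) .skip

theorem consider_nat {k : ℕ} : consider.WritesNat k ↔ k = 4 ∨ k = 18 := by
  simp only [consider, Program.WritesNat, sumOver_nat, copySet_nat]; lia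

theorem consider_real {k : ℕ} : consider.WritesReal k ↔ k = 9 ∨ k = 10 ∨ k = 11 := by
  simp only [consider, Program.WritesReal, sumOver_real, copySet_real]; lia

/-- The output array holds a feasible basis whose objective is held by the real variable `11`. -/
def Recorded (X : Set (Finset (Fin d))) (a b : Fin d → ℝ) (s : ℝ) (σ : Memory) : Prop :=
  output d σ ∈ feasible X a s ∧ σ.real 11 0 = ∑ i ∈ output d σ, b i

theorem consider_spec (E : Engine X O bo ex c Rep) (hd : HasData a b s σ) (hR : Rep σ B) :
    wp O consider (d * 11 + 11) (fun τ => Rep τ B ∧ HasData a b s τ ∧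
      σ.real 11 0 ≤ τ.real 11 0 ∧ τ.real 9 0 = ∑ i ∈ B, a i ∧
      (s ≤ ∑ i ∈ B, a i → ∑ i ∈ B, b i ≤ τ.real 11 0) ∧
      (Recorded X a b s σ ∨ s ≤ ∑ i ∈ B, a i ∧ σ.real 11 0 < ∑ i ∈ B, b i →
        Recorded X a b s τ)) σ := by
  have hB := E.held_eq hR
  have hX := E.mem hR
  refine wp.weaken (wp_seq (sumOver_spec (d := d) (by lia) hd.dim) fun τ1 hA1 h1 =>
    wp_seq (sumOver_spec (d := d) (by lia) ?_) fun τ2 hA2 h2 =>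
    wp_cond (T := d * 3 + 2 + 1) ?_ ?_) (T := (d * 4 + 3) + ((d * 4 + 3) + (d * 3 + 2 + 1 + 1)))
    (by lia)
  · rw [hA1.nat 0 (by simp [sumOver_nat]), hd.dim]
  all_goals
    rw [hB, hd.ra] at h1
    have n2 : ∀ k, k ≠ 18 → τ2.nat k = σ.nat k := fun k hk => by
      rw [hA2.nat k (by simp [sumOver_nat, hk]), hA1.nat k (by simp [sumOver_nat, hk])]
    have r2 : ∀ k, k ≠ 9 → k ≠ 10 → τ2.real k = σ.real k := fun k hk hk' => by
      rw [hA2.real k (by simp [sumOver_real, hk']), hA1.real k (by simp [sumOver_real, hk])]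
    have e9 : τ2.real 9 0 = ∑ i ∈ B, a i := by
      rw [hA2.real 9 (by simp [sumOver_real]), h1]; simp
    have e10 : τ2.real 10 0 = ∑ i ∈ B, b i := by
      rw [h2, hA1.real 1 (by simp [sumOver_real]), hd.rb,
        held_congr (σ := σ) (k' := 5) fun i _ => by rw [hA1.nat 5 (by simp [sumOver_nat])], hB]
      simp
    have hd2 : HasData a b s τ2 := hd.congr (n2 0 (by lia)) fun k hk => r2 k (by lia) (by lia)
    have hR2 : Rep τ2 B := E.congr (fun k hk => n2 k (by lia)) hR
    intro hp
    simp only [Test.Holds, RealExpr.eval, NatExpr.eval, hd2.rs, e9, e10, r2 11 (by lia) (by lia),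
      not_le] at hp
  · refine wp_seq (copySet_spec (d := d) (by lia) (by lia) (by lia) (by lia) hd2.dim)
      fun τ3 hA3 h3 => wp_setReal ?_
    have n3 : ∀ k, k ≠ 18 → k ≠ 4 → τ3.nat k = σ.nat k := fun k hk hk' => by
      rw [hA3.nat k (by simp [copySet_nat, hk, hk']), n2 k hk]
    have r3 : ∀ k, τ3.real k = τ2.real k := fun k => hA3.real k copySet_real
    simp only [RealExpr.eval, NatExpr.eval, r3, e10, Memory.writeReal_real_same]
    rw [E.held_eq hR2] at h3
    have hout : output d (τ3.writeReal 11 0 (∑ i ∈ B, b i)) = B := h3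
    refine ⟨E.writeReal (E.congr (fun k hk => n3 k (by lia) (by lia)) hR),
      hd.congr (n3 0 (by lia) (by lia)) fun k hk => ?_, hp.2.le, ?_, fun _ => le_rfl, fun _ => ?_⟩
    · rw [Memory.writeReal_real_of_ne _ _ _ (by lia), r3, r2 k (by lia) (by lia)]
    · rw [Memory.writeReal_real_of_ne _ _ _ (by lia), r3, e9]
    · simp only [Recorded, hout, Memory.writeReal_real_same, and_true]
      exact ⟨hX, hp.1⟩
  · refine wp.weaken (wp_skip ⟨hR2, hd2, (r2 11 (by lia) (by lia) ▸ le_rfl), e9, ?_, ?_⟩) (by lia)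
    · intro hs
      rw [r2 11 (by lia) (by lia)]
      by_contra! h
      exact hp ⟨hs, h⟩
    · rintro (h | h)
      · have : output d τ2 = output d σ := held_congr fun i _ => by rw [n2 4 (by lia)]
        simpa only [Recorded, this, r2 11 (by lia) (by lia)] using h
      · exact absurd h hp

end Engine

end BudgetedMax

namespace BudgetedMax

open RealRAM

section Engine

variable {d : ℕ} {X : Set (Finset (Fin d))} {O : Set ℕ → Prop} {bo ex : Program} {c : ℕ}
  {Rep : Memory → Finset (Fin d) → Prop} {a b : Fin d → ℝ} {s : ℝ} {σ τ : Memory} {P : Program}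
  {B : Finset (Fin d)}

/-! ### Optimizing a linear objective -/

/-- One pass over all available elements, the set held by the array `9`, each of which is exchanged
for the lightest possible element if this brings a gain. -/
def optimize (bo ex : Program) : Program :=
  .forLoop 6 (.var 0)
    (.cond (.and (.nonZero (.cell 9 (.var 6))) (.isZero (.cell 5 (.var 6))))
      (bo ;; .cond (.and (.natLT (.var 7) (.var 0))
          (.realLT (.cell 3 (.var 7)) (.cell 3 (.var 6)))) ex .skip)
      .skip)

theorem Engine.optimize_nat (E : Engine X O bo ex c Rep) {k : ℕ}
    (h : (optimize bo ex).WritesNat k) : k = 5 ∨ k = 6 ∨ k = 7 ∨ k = 10 ∨ 20 ≤ k ∧ k < 40 := by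
  simp only [optimize, Program.forLoop, Program.WritesNat] at h
  have h1 := @E.bo_nat k
  have h2 := @E.ex_nat k
  lia

theorem Engine.optimize_real (E : Engine X O bo ex c Rep) {k : ℕ} :
    ¬ (optimize bo ex).WritesReal k := by
  simp [optimize, Program.forLoop, Program.WritesReal, E.bo_real, E.ex_real]

/-- After each round the current member is optimal among those that consist of elements of the
initial one and of available elements that have been processed. -/
theorem Engine.optimize_spec (E : Engine X O bo ex c Rep) (hX : SymmExchange X)
    {w : Fin d → ℝ} (hd : σ.nat 0 0 = d) (hR : Rep σ B) (hB : B ⊆ held d 9 σ)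
    (h8 : held d 8 σ = ∅) (hw : HasWeight w σ) :
    wp O (optimize bo ex) (d * (2 * c + 5) + 2)
      (fun τ => ∃ B', Rep τ B' ∧ IsMaxOn X (held d 9 σ) w B') σ := by
  refine (wp_forLoop (N := d) (c := 2 * c + 3) (fun i τ => ∃ B', Rep τ B' ∧
    IsMaxOn X (B ∪ (held d 9 σ).filter (fun j : Fin d => (j : ℕ) < i)) w B') ?_ ?_ ?_ ?_).imp ?_
  · intro h
    simp only [Program.WritesNat] at h
    have h1 := @E.bo_nat 6
    have h2 := @E.ex_nat 6
    lia
  · intro τ hA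
    rw [NatExpr.eval, hA.nat 0 fun h => by have := E.optimize_nat h; lia]
    exact hd
  · exact ⟨B, E.writeNat hR (by lia), by simpa using hX.isMaxOn_self (E.mem hR)⟩
  · rintro i τ hi hA hiv ⟨B', hR', hB'⟩
    have n9 : τ.nat 9 = σ.nat 9 := hA.nat 9 fun h => by have := E.optimize_nat h; lia
    have n8 : τ.nat 8 = σ.nat 8 := hA.nat 8 fun h => by have := E.optimize_nat h; lia
    have n0 : τ.nat 0 = σ.nat 0 := hA.nat 0 fun h => by have := E.optimize_nat h; lia
    have r3 : ∀ g : Fin d, τ.real 3 g = w g := fun g => by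
      rw [hA.real 3 E.optimize_real]; exact hw g
    have hb8 : held d 8 τ = ∅ := by rw [held_of_nat_eq n8, h8]
    have hBh := E.held_eq hR'
    have e : B ∪ (held d 9 σ).filter (fun j : Fin d => (j : ℕ) < i + 1) =
        if (⟨i, hi⟩ : Fin d) ∈ held d 9 σ then
          insert ⟨i, hi⟩ (B ∪ (held d 9 σ).filter fun j : Fin d => (j : ℕ) < i)
        else B ∪ (held d 9 σ).filter fun j : Fin d => (j : ℕ) < i := by
      rw [filter_lt_succ hi]; split_ifs
      · rw [Finset.union_insert]
      · rfl
    simp only [e]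
    have m9 : (⟨i, hi⟩ : Fin d) ∈ held d 9 σ ↔ σ.nat 9 i ≠ 0 := by simp
    have m5 : (⟨i, hi⟩ : Fin d) ∈ B' ↔ τ.nat 5 i ≠ 0 := by rw [← hBh]; simp
    refine wp_cond (T := 2 * c + 2) (fun hp => ?_) (fun hp => ?_)
    · simp only [Test.Holds, NatExpr.eval, hiv, n9, Nat.le_zero] at hp
      rw [if_pos (m9.2 hp.1)]
      have hf : (⟨i, hi⟩ : Fin d) ∉ B' := by rw [m5]; simp [hp.2]
      refine (wp_seq (E.bo_spec (f := ⟨i, hi⟩) (by rw [n0, hd]) hR' hiv hf) fun τ1 hA1 h1 =>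
        wp_cond (T := c + 1) ?_ ?_).weaken
        (T := c + (c + 1 + 1)) (by lia)
      · obtain ⟨hR1, -, h1⟩ := h1
        intro hp1
        have n1 : τ1.nat 0 = σ.nat 0 := by
          rw [hA1.nat 0 fun h => by have := E.bo_nat h; lia, n0]
        have n6 : τ1.nat 6 = τ.nat 6 := hA1.nat 6 fun h => by have := E.bo_nat h; lia
        simp only [Test.Holds, NatExpr.eval, RealExpr.eval, n1, hd, n6, hiv, not_le,
          hA1.real 3 E.bo_real] at hp1
        obtain ⟨hg, -, hgX, hmin⟩ := h1 ⟨τ1.nat 7 0, hp1.1⟩ rfl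
        have hlt : w ⟨τ1.nat 7 0, hp1.1⟩ < w ⟨i, hi⟩ := by
          rw [← r3, ← r3]; exact hp1.2
        refine (wp.mono (E.ex_spec (f := ⟨i, hi⟩) (g := ⟨τ1.nat 7 0, hp1.1⟩) (by rw [n1, hd]) hR1
          (by rw [n6, hiv]) rfl hf hg hgX) (by lia) fun τ2 hA2 hR2 => ⟨_, E.writeNat hR2 (by lia),
          hB'.insert_swap hX hf hg hgX hlt.le fun g' hg' hgX' => ?_⟩)
        rw [← r3, ← r3]
        exact hmin g' hg' (by simp [hb8]) hgX'
      · obtain ⟨hR1, h0, h1⟩ := h1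
        intro hp1
        have n1 : τ1.nat 0 = σ.nat 0 := by
          rw [hA1.nat 0 fun h => by have := E.bo_nat h; lia, n0]
        have n6 : τ1.nat 6 = τ.nat 6 := hA1.nat 6 fun h => by have := E.bo_nat h; lia
        simp only [Test.Holds, NatExpr.eval, RealExpr.eval, n1, hd, n6, hiv, not_le,
          hA1.real 3 E.bo_real] at hp1
        refine wp.weaken (wp_skip ⟨B', E.writeNat hR1 (by lia), hB'.insert_of_le hX hf
          fun g' hg' hgX' => ?_⟩) (by lia)
        by_cases hlt : τ1.nat 7 0 < d
        · obtain ⟨-, -, -, hmin⟩ := h1 ⟨τ1.nat 7 0, hlt⟩ rfl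
          have := hmin g' hg' (by simp [hb8]) hgX'
          rw [r3, r3] at this
          refine le_trans ?_ this
          rw [← r3, ← r3]
          exact not_lt.1 fun h => hp1 ⟨hlt, h⟩
        · exact absurd hgX' (h0 (not_lt.1 hlt) g' hg' (by simp [hb8]))
    · simp only [Test.Holds, NatExpr.eval, hiv, n9, Nat.le_zero] at hp
      refine wp.weaken (wp_skip ⟨B', E.writeNat hR' (by lia), ?_⟩) (by lia)
      split_ifs with h
      · exact hB'.insert_of_mem (m5.2 fun h' => hp ⟨m9.1 h, h'⟩)
      · exact hB'
  · rintro τ - ⟨B', hR', hB'⟩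
    refine ⟨B', hR', ?_⟩
    rwa [Finset.filter_true_of_mem fun j _ => j.2, Finset.union_eq_right.2 hB] at hB'

/-- The Lagrangian weight with the parameter in the real variable `8` is maximized, and the value
of the constraint is put into the real variable `9`. -/
def maximize (bo ex : Program) : Program :=
  setWeight ;; optimize bo ex ;; sumOver 9 0

theorem Engine.maximize_nat (E : Engine X O bo ex c Rep) {k : ℕ}
    (h : (maximize bo ex).WritesNat k) :
    k = 5 ∨ k = 6 ∨ k = 7 ∨ k = 10 ∨ k = 18 ∨ 20 ≤ k ∧ k < 40 := by
  simp only [maximize, Program.WritesNat, setWeight_nat, sumOver_nat] at h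
  have h1 := @Engine.optimize_nat _ _ _ _ _ _ _ E k
  lia

theorem Engine.maximize_real (E : Engine X O bo ex c Rep) {k : ℕ}
    (h : (maximize bo ex).WritesReal k) : k = 3 ∨ k = 9 := by
  simpa [maximize, Program.WritesReal, setWeight_real, sumOver_real, E.optimize_real] using h

theorem Engine.maximize_spec (E : Engine X O bo ex c Rep) (hX : SymmExchange X)
    (hd : HasData a b s σ) (hR : Rep σ B) (hB : B ⊆ held d 9 σ) (h8 : held d 8 σ = ∅) :
    wp O (maximize bo ex) (d * (2 * c + 12) + 7)
      (fun τ => HasData a b s τ ∧ HasWeight (lagrange a b (σ.real 8 0)) τ ∧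
        ∃ B', Rep τ B' ∧ IsMaxOn X (held d 9 σ) (lagrange a b (σ.real 8 0)) B' ∧
        τ.real 9 0 = ∑ i ∈ B', a i) σ := by
  refine wp.weaken (wp_seq (setWeight_spec hd) fun τ1 hA1 h1 => wp_seq (E.optimize_spec hX
    (σ := τ1) (B := B) (w := lagrange a b (σ.real 8 0)) ?_ ?_ ?_ ?_ h1)
    fun τ2 hA2 ⟨B', hR', hB'⟩ => wp.imp (sumOver_spec (d := d) (by lia) ?_)
    fun τ3 hA3 h3 => ⟨?_, ?_, B', ?_, ?_, ?_⟩)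
    (T := (d * 3 + 2) + ((d * (2 * c + 5) + 2) + (d * 4 + 3))) (by lia)
  all_goals
    have n1 : ∀ k, k ≠ 18 → τ1.nat k = σ.nat k := fun k hk => hA1.nat k (by
      simp [setWeight_nat, hk])
    have e9 : held d 9 τ1 = held d 9 σ := held_of_nat_eq (n1 9 (by lia))
  · rw [n1 0 (by lia), hd.dim]
  · exact E.congr (fun k hk => n1 k (by lia)) hR
  · rwa [e9]
  · rw [held_of_nat_eq (n1 8 (by lia)), h8]
  all_goals
    have n2 : ∀ k, ¬ (k = 5 ∨ k = 6 ∨ k = 7 ∨ k = 10 ∨ k = 18 ∨ 20 ≤ k ∧ k < 40) →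
      τ2.nat k = σ.nat k := fun k hk => by
        rw [hA2.nat k fun h => by have := E.optimize_nat h; lia, n1 k (by lia)]
  · rw [n2 0 (by lia), hd.dim]
  all_goals
    have n3 : ∀ k, k ≠ 18 → τ3.nat k = τ2.nat k := fun k hk => hA3.nat k (by
      simp [sumOver_nat, hk])
    have r3 : ∀ k, k ≠ 9 → τ3.real k = τ1.real k := fun k hk => by
      rw [hA3.real k (by simp [sumOver_real, hk]), hA2.real k E.optimize_real]
    have r1 : ∀ k, k ≠ 3 → τ1.real k = σ.real k := fun k hk => hA1.real k (by
      simp [setWeight_real, hk])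
  · refine hd.congr ?_ fun k hk => ?_
    · rw [n3 0 (by lia), n2 0 (by lia)]
    · rw [r3 k (by lia), r1 k (by lia)]
  · intro i
    rw [r3 3 (by lia)]
    exact h1 i
  · exact E.congr (fun k hk => n3 k (by lia)) hR'
  · rwa [e9] at hB'
  · rw [h3, E.held_eq hR', hA2.real 0 E.optimize_real, r1 0 (by lia), hd.ra]
    simp

/-! ### Discarding the elements that lie in no feasible basis -/

/-- For a basis that is optimal for the constraint, whose value is in the real variable `9`, the
elements that lie in no feasible basis are removed from the set held by the array `9`.  Among the
remaining elements one with the largest objective is put into the variable `44`, and the element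
for which it can be exchanged into the variable `45`. -/
def discard (bo : Program) : Program :=
  .letNat 44 (.var 0) ;; .letReal 12 (.const 0) ;;
  .forLoop 6 (.var 0)
    (.cond (.nonZero (.cell 5 (.var 6))) (.letNat 7 (.var 6)) bo ;;
      .cond (.and (.natLT (.var 7) (.var 0))
          (.realLE (.var 2) (.add (.sub (.var 9) (.cell 0 (.var 7))) (.cell 0 (.var 6)))))
        (.cond (.realLT (.var 12) (.cell 1 (.var 6)))
          (.letReal 12 (.cell 1 (.var 6)) ;; .letNat 44 (.var 6) ;; .letNat 45 (.var 7)) .skip)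
        (.setNat 9 (.var 6) (.const 0)))

theorem Engine.discard_nat (E : Engine X O bo ex c Rep) {k : ℕ} (h : (discard bo).WritesNat k) :
    k = 5 ∨ k = 6 ∨ k = 7 ∨ k = 9 ∨ k = 10 ∨ k = 44 ∨ k = 45 ∨ 20 ≤ k ∧ k < 40 := by
  simp only [discard, Program.forLoop, Program.WritesNat] at h
  have h1 := @E.bo_nat k
  lia

theorem Engine.discard_real (E : Engine X O bo ex c Rep) {k : ℕ} :
    (discard bo).WritesReal k ↔ k = 12 := by
  simp [discard, Program.forLoop, Program.WritesReal, E.bo_real]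

/-- The set in the array `9` contains all feasible members.  The real variable `12` bounds the
objectives of its elements below `i`, and is attained by the element in the variable `44`, if that
is one, which lies in a feasible member: either in `B` or in the result of a swap. -/
structure DiscardState (X : Set (Finset (Fin d))) (a b : Fin d → ℝ) (s : ℝ) (B : Finset (Fin d))
    (i : ℕ) (τ : Memory) : Prop where
  mem : ∀ A ∈ feasible X a s, ∀ j ∈ A, τ.nat 9 (j : ℕ) ≠ 0
  le : ∀ j : Fin d, (j : ℕ) < i → τ.nat 9 (j : ℕ) ≠ 0 → b j ≤ τ.real 12 0
  empty : d ≤ τ.nat 44 0 → τ.real 12 0 ≤ 0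
  best : ∀ f : Fin d, τ.nat 44 0 = f → b f = τ.real 12 0 ∧ ∃ g : Fin d, τ.nat 45 0 = g ∧ g ∈ B ∧
    (f ∉ B → insert f (B.erase g) ∈ feasible X a s)

/-- An element outside the optimal member `B` lies in some feasible member if and only if its best
swap into `B` is feasible. -/
theorem Engine.discard_spec (E : Engine X O bo ex c Rep) (hX : SymmExchange X)
    (hd : HasData a b s σ) (hR : Rep σ B) (hB : IsMaxOn X Finset.univ a B)
    (h8 : held d 8 σ = ∅) (h9 : held d 9 σ = Finset.univ)
    (hw : HasWeight a σ) (hs : σ.real 9 0 = ∑ i ∈ B, a i) :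
    wp O (discard bo) (d * (c + 9) + 4)
      (fun τ => Rep τ B ∧ DiscardState X a b s B d τ) σ := by
  refine wp.weaken (wp_setNat_seq (wp_setReal_seq (wp_forLoop (N := d) (c := c + 7)
    (fun i τ => Rep τ B ∧ DiscardState X a b s B i τ) ?_ ?_ ?_ ?_))) (by lia)
  · intro h
    simp only [Program.WritesNat] at h
    have h1 := @E.bo_nat 6
    lia
  · intro τ hA
    have := hA.nat 0 fun h => by
      have := @Engine.discard_nat _ _ _ _ _ _ _ E 0 (Or.inr (Or.inr h)); lia
    rw [NatExpr.eval, this]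
    simpa [NatExpr.eval] using hd.dim
  · refine ⟨E.writeNat (E.writeReal (E.writeNat hR (by lia))) (by lia), ?_, ?_, ?_, ?_⟩
    · intro A hA j hj
      have : j ∈ held d 9 σ := by simp [h9]
      simpa using this
    · intro j hj
      lia
    · simp [NatExpr.eval, RealExpr.eval]
    · intro f hf
      simp [NatExpr.eval, hd.dim] at hf
      have := f.2
      lia
  · rintro i τ hi hA hiv ⟨hR', h⟩
    have nn : ∀ k, ¬ (k = 5 ∨ k = 6 ∨ k = 7 ∨ k = 9 ∨ k = 10 ∨ k = 44 ∨ k = 45 ∨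
        20 ≤ k ∧ k < 40) → τ.nat k = σ.nat k := fun k hk => by
      rw [hA.nat k fun h => hk (E.discard_nat (Or.inr (Or.inr h)))]
      simp [show k ≠ 44 by lia]
    have rr : ∀ k, k ≠ 12 → τ.real k = σ.real k := fun k hk => by
      rw [hA.real k fun h => hk (E.discard_real.1 (Or.inr (Or.inr h)))]
      simp [hk]
    obtain ⟨f, hf⟩ : ∃ f : Fin d, (f : ℕ) = i := ⟨⟨i, hi⟩, rfl⟩
    subst hf
    have m5 : f ∈ B ↔ τ.nat 5 f ≠ 0 := by rw [← E.held_eq hR']; simp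
    have hb8 : held d 8 τ = ∅ := by
      rw [held_of_nat_eq (nn 8 (by lia)), h8]
    have hle := hB.le
    -- the best swap for `f`
    refine wp.weaken (wp_seq (T := c + 1 + 1) (T' := 4 + 1) (Q := fun ρ =>
      Rep ρ B ∧ (∀ k, ¬ (k = 5 ∨ k = 7 ∨ k = 10 ∨ 20 ≤ k ∧ k < 40) → ρ.nat k = τ.nat k) ∧
      (∀ k, ρ.real k = τ.real k) ∧
      (d ≤ ρ.nat 7 0 → ∀ A ∈ X, f ∉ A) ∧
      ∀ g : Fin d, ρ.nat 7 0 = g → g ∈ B ∧ (∀ A ∈ X, f ∈ A →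
        ∑ i ∈ A, a i ≤ ∑ i ∈ B, a i - a g + a f) ∧ (f ∉ B → insert f (B.erase g) ∈ X)) ?_
      ?_) (by lia)
    · refine wp_cond (fun hp => ?_) (fun hp => ?_)
      · simp only [Test.Holds, NatExpr.eval, hiv, Nat.le_zero] at hp
        refine wp.weaken (wp_setNat ⟨E.writeNat hR' (by lia), fun k hk =>
          Memory.writeNat_nat_of_ne _ _ _ (by lia), fun k => rfl, ?_, ?_⟩) (by lia)
        · simp only [NatExpr.eval, hiv, Memory.writeNat_nat_same]
          intro h
          have := f.2
          lia
        · intro g hg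
          simp only [NatExpr.eval, hiv, Memory.writeNat_nat_same] at hg
          have hfg : f = g := Fin.ext hg
          subst hfg
          refine ⟨m5.2 hp, fun A hA _ => ?_, fun h => absurd (m5.2 hp) h⟩
          rw [sub_add_cancel]
          exact hle A hA (Finset.subset_univ _)
      · simp only [Test.Holds, NatExpr.eval, hiv, Nat.le_zero, not_not] at hp
        have hfB : f ∉ B := by rw [m5]; simp [hp]
        refine wp.mono (E.bo_spec (f := f) (by rw [nn 0 (by lia), hd.dim]) hR' hiv hfB) (by lia)
          fun ρ hB' ⟨h1, h2, h3⟩ => ⟨h1, fun k hk => hB'.nat k fun h => hk (E.bo_nat h),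
            fun k => hB'.real k E.bo_real, fun h A hA hfA => ?_, fun g hg => ?_⟩
        · obtain ⟨g, hg, hgX, -⟩ := hB.exists_swap hX hfB hA (by simp) hfA
          exact h2 h g (Finset.mem_sdiff.1 hg).1 (by simp [hb8]) hgX
        · obtain ⟨hgB, -, hgX, hmin⟩ := h3 g hg
          refine ⟨hgB, fun A hA hfA => hB.le_swap hX hfB (fun g' hg' hgX' => ?_) hA (by simp) hfA,
            fun _ => hgX⟩
          have := hmin g' hg' (by simp [hb8]) hgX'
          rw [rr 3 (by lia)] at this
          rwa [hw, hw] at this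
    · rintro ρ - ⟨hR1, n1, r1, h2, h3⟩
      have n6 : ρ.nat 6 0 = f := by rw [n1 6 (by lia), hiv]
      have r2 : ∀ k, k ≠ 12 → ρ.real k = σ.real k := fun k hk => by rw [r1, rr k hk]
      refine wp_cond (fun hp => ?_) (fun hp => ?_)
      · simp only [Test.Holds, NatExpr.eval, RealExpr.eval, n6, n1 0 (by lia), nn 0 (by lia),
          hd.dim, r2 2 (by lia), r2 9 (by lia), r2 0 (by lia), hd.rs, hd.ra, hs, not_le,
          pad_coe] at hp
        obtain ⟨g, hg⟩ : ∃ g : Fin d, ρ.nat 7 0 = g := ⟨⟨_, hp.1⟩, rfl⟩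
        rw [hg, pad_coe] at hp
        obtain ⟨hgB, -, hgX⟩ := h3 g hg
        have hfeas : f ∉ B → insert f (B.erase g) ∈ feasible X a s := fun hf =>
          ⟨hgX hf, by rw [sum_swap hgB hf]; exact hp.2⟩
        refine wp_cond (fun hp1 => ?_) (fun hp1 => ?_)
        · simp only [Test.Holds, RealExpr.eval, NatExpr.eval, r1 12, n6, r2 1 (by lia), hd.rb,
            pad_coe, not_le] at hp1
          refine wp_setReal_seq (wp_setNat_seq (wp_setNat ⟨E.writeNat (E.writeNat (E.writeNat
            (E.writeReal hR1) (by lia)) (by lia)) (by lia), ?_, ?_, ?_, ?_⟩))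
          · intro A hA j hj
            simpa [n1 9] using h.mem A hA j hj
          · intro j hj h9j
            simp [NatExpr.eval, RealExpr.eval, r2 1, hd.rb, n6, n1 9] at h9j ⊢
            rcases (show (j : ℕ) < f ∨ (j : ℕ) = f by lia) with hj | hj
            · exact (h.le j hj h9j).trans hp1.le
            · rw [Fin.ext hj]
          · simp [NatExpr.eval, n6]
          · intro f' hf'
            simp [NatExpr.eval, n6] at hf'
            have : f = f' := Fin.ext hf'
            subst this
            exact ⟨by simp [NatExpr.eval, RealExpr.eval, r2 1, hd.rb, n6], g, by
              simp [NatExpr.eval, hg], hgB, hfeas⟩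
        · simp only [Test.Holds, RealExpr.eval, NatExpr.eval, r1 12, n6, r2 1 (by lia), hd.rb,
            pad_coe, not_not] at hp1
          refine wp.weaken (wp_skip ⟨E.writeNat hR1 (by lia), ?_, ?_, ?_, ?_⟩) (by lia)
          · intro A hA j hj
            simpa [n1 9] using h.mem A hA j hj
          · intro j hj h9j
            simp [r1 12, n1 9] at h9j ⊢
            rcases (show (j : ℕ) < f ∨ (j : ℕ) = f by lia) with hj | hj
            · exact (h.le j hj h9j)
            · rwa [Fin.ext hj]
          · simpa [n1 44, r1 12] using h.empty
          · simpa [n1 44, n1 45, r1 12] using h.best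
      · simp only [Test.Holds, NatExpr.eval, RealExpr.eval, n6, n1 0 (by lia), nn 0 (by lia),
          hd.dim, r2 2 (by lia), r2 9 (by lia), r2 0 (by lia), hd.rs, hd.ra, hs, not_le,
          pad_coe] at hp
        have hno : ∀ A ∈ feasible X a s, f ∉ A := by
          rintro A ⟨hA, hAs⟩ hfA
          by_cases hlt : ρ.nat 7 0 < d
          · obtain ⟨-, h4, -⟩ := h3 ⟨_, hlt⟩ rfl
            have h5 := h4 A hA hfA
            refine hp ⟨hlt, ?_⟩
            have : pad a (ρ.nat 7 0) = a ⟨_, hlt⟩ := by simp [pad, hlt]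
            rw [this]
            linarith
          · exact h2 (not_lt.1 hlt) A hA hfA
        refine wp.weaken (wp_setNat ⟨E.writeNat (E.writeNat hR1 (by lia)) (by lia), ?_, ?_, ?_, ?_⟩)
          (by lia)
        · intro A hA j hj
          have hjf : (j : ℕ) ≠ f := fun e => hno A hA (Fin.ext e ▸ hj)
          simpa [NatExpr.eval, n6, hjf, n1 9] using h.mem A hA j hj
        · intro j hj h9j
          by_cases hjf : (j : ℕ) = f
          · simp [NatExpr.eval, n6, hjf] at h9j
          · simp [NatExpr.eval, n6, hjf, n1 9, r1 12] at h9j ⊢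
            exact h.le j (by lia) h9j
        · simpa [n1 44, r1 12] using h.empty
        · simpa [n1 44, n1 45, r1 12] using h.best

end Engine

end BudgetedMax

namespace BudgetedMax

open RealRAM

section Engine

variable {d : ℕ} {X : Set (Finset (Fin d))} {O : Set ℕ → Prop} {bo ex : Program} {c : ℕ}
  {Rep : Memory → Finset (Fin d) → Prop} {a b : Fin d → ℝ} {s θ : ℝ} {σ τ : Memory} {P : Program}
  {B S Z : Finset (Fin d)}

/-- If the element in the variable `44` exists and is missing in the current basis, then it is
exchanged for the one in the variable `45`. -/
def takeBest (ex : Program) : Program :=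
  .cond (.and (.natLT (.var 44) (.var 0)) (.isZero (.cell 5 (.var 44))))
    (.letNat 6 (.var 44) ;; .letNat 7 (.var 45) ;; ex) .skip

theorem Engine.takeBest_nat (E : Engine X O bo ex c Rep) {k : ℕ} (h : (takeBest ex).WritesNat k) :
    k = 5 ∨ k = 6 ∨ k = 7 ∨ k = 10 ∨ 20 ≤ k ∧ k < 40 := by
  simp only [takeBest, Program.WritesNat] at h
  have h1 := @E.ex_nat k
  lia

theorem Engine.takeBest_real (E : Engine X O bo ex c Rep) {k : ℕ} :
    ¬ (takeBest ex).WritesReal k := by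
  simp [takeBest, Program.WritesReal, E.ex_real]

/-- Afterwards the objective of the current member alone bounds that of every available element. -/
theorem Engine.takeBest_spec (E : Engine X O bo ex c Rep) (hb : ∀ i, 0 < b i)
    (hd : σ.nat 0 0 = d) (hR : Rep σ B) (hB : B ∈ feasible X a s)
    (h : DiscardState X a b s B d σ) :
    wp O (takeBest ex) (c + 3) (fun τ => ∃ B', Rep τ B' ∧ B' ∈ feasible X a s ∧
      ∀ f ∈ held d 9 σ, b f ≤ ∑ i ∈ B', b i) σ := by
  have hle : ∀ f ∈ held d 9 σ, b f ≤ σ.real 12 0 := fun f hf => h.le f f.2 (mem_held.1 hf)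
  have hmem : ∀ (B' : Finset (Fin d)), ∀ f ∈ B', b f ≤ ∑ i ∈ B', b i := fun B' f hf =>
    Finset.single_le_sum (f := b) (fun i _ => (hb i).le) hf
  refine wp_cond (T := c + 2) (fun hp => ?_) (fun hp => ?_)
  · simp only [Test.Holds, NatExpr.eval, hd, not_le, Nat.le_zero] at hp
    obtain ⟨f, hf⟩ : ∃ f : Fin d, σ.nat 44 0 = f := ⟨⟨_, hp.1⟩, rfl⟩
    obtain ⟨hf1, g, hg, hgB, hgX⟩ := h.best f hf
    have hfB : f ∉ B := by
      rw [← E.held_eq hR, mem_held, ← hf, hp.2]; simp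
    refine wp_setNat_seq (wp_setNat_seq (wp.imp (E.ex_spec (f := f) (g := g) ?_ ?_ ?_ ?_ hfB hgB
      (hgX hfB).1) fun τ _ hτ => ⟨_, hτ, hgX hfB, fun f' hf' => (hle f' hf').trans ?_⟩))
    · simpa using hd
    · exact E.writeNat (E.writeNat hR (by lia)) (by lia)
    · simpa [NatExpr.eval] using hf
    · simpa [NatExpr.eval] using hg
    · rw [← hf1]
      exact hmem _ f (Finset.mem_insert_self _ _)
  · simp only [Test.Holds, NatExpr.eval, hd, not_le, Nat.le_zero] at hp
    refine wp.weaken (wp_skip ⟨B, hR, hB, fun f' hf' => (hle f' hf').trans ?_⟩) (by lia)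
    by_cases hlt : σ.nat 44 0 < d
    · obtain ⟨f, hf⟩ : ∃ f : Fin d, σ.nat 44 0 = f := ⟨⟨_, hlt⟩, rfl⟩
      obtain ⟨hf1, -⟩ := h.best f hf
      rw [← hf1]
      refine hmem _ f ?_
      rw [← E.held_eq hR, mem_held, ← hf]
      exact fun h => hp ⟨hlt, h⟩
    · exact (h.empty (not_lt.1 hlt)).trans (Finset.sum_nonneg fun i _ => (hb i).le)

/-! ### Walking between two optimal bases -/

/-- The value `β` is at least half of the optimum. -/
def IsHalf (X : Set (Finset (Fin d))) (a b : Fin d → ℝ) (s β : ℝ) : Prop :=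
  ∀ z ∈ feasible X a s, ∑ i ∈ z, b i ≤ 2 * β

/-- The current basis is transformed by exchanges into the basis held by the array `8`; all bases on
the way are considered. -/
def walk (bo ex : Program) : Program :=
  .forLoop 6 (.var 0)
    (.cond (.and (.nonZero (.cell 8 (.var 6))) (.isZero (.cell 5 (.var 6))))
      (bo ;; ex ;; consider) .skip)

theorem Engine.walk_nat (E : Engine X O bo ex c Rep) {k : ℕ} (h : (walk bo ex).WritesNat k) :
    k = 4 ∨ k = 5 ∨ k = 6 ∨ k = 7 ∨ k = 10 ∨ k = 18 ∨ 20 ≤ k ∧ k < 40 := by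
  simp only [walk, Program.forLoop, Program.WritesNat, consider_nat] at h
  have h1 := @E.bo_nat k
  have h2 := @E.ex_nat k
  lia

theorem Engine.walk_real (E : Engine X O bo ex c Rep) {k : ℕ} (h : (walk bo ex).WritesReal k) :
    k = 9 ∨ k = 10 ∨ k = 11 := by
  simpa [walk, Program.forLoop, Program.WritesReal, E.bo_real, E.ex_real, consider_real] using h

/-- If exactly one of the two ends of the walk is feasible, then there are two neighbours on the
way of which exactly one is feasible, and the best basis found so far reaches half of the
optimum. -/
theorem Engine.walk_spec (E : Engine X O bo ex c Rep) (hX : SymmExchange X)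
    (hb : ∀ i, 0 < b i) (h0 : 0 ≤ θ) (h1 : θ ≤ 1) (hd : HasData a b s σ) (hR : Rep σ Z)
    (hrec : Recorded X a b s σ) (hS : ∀ A ∈ feasible X a s, A ⊆ S)
    (hSb : ∀ f ∈ S, b f ≤ σ.real 11 0) (hZ : IsMaxOn X S (lagrange a b θ) Z)
    (hT : IsMaxOn X S (lagrange a b θ) (held d 8 σ)) (hw : HasWeight (lagrange a b θ) σ)
    (hflip : s ≤ ∑ i ∈ Z, a i ↔ ¬ s ≤ ∑ i ∈ held d 8 σ, a i)
    (hcons : s ≤ ∑ i ∈ Z, a i → ∑ i ∈ Z, b i ≤ σ.real 11 0) :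
    wp O (walk bo ex) (d * (2 * c + d * 11 + 14) + 2)
      (fun τ => Recorded X a b s τ ∧ IsHalf X a b s (τ.real 11 0)) σ := by
  refine (wp_forLoop (N := d) (c := 2 * c + d * 11 + 12) (fun i τ => HasData a b s τ ∧
    Recorded X a b s τ ∧ σ.real 11 0 ≤ τ.real 11 0 ∧ ∃ Z', Rep τ Z' ∧
    IsMaxOn X S (lagrange a b θ) Z' ∧ (∀ t ∈ held d 8 σ, (t : ℕ) < i → t ∈ Z') ∧
    (s ≤ ∑ i ∈ Z', a i → ∑ i ∈ Z', b i ≤ τ.real 11 0) ∧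
    (IsHalf X a b s (τ.real 11 0) ∨ (s ≤ ∑ i ∈ Z', a i ↔ s ≤ ∑ i ∈ Z, a i)))
    ?_ ?_ ?_ ?_).imp ?_
  · intro h
    simp only [Program.WritesNat, consider_nat] at h
    have h1 := @E.bo_nat 6
    have h2 := @E.ex_nat 6
    lia
  · intro τ hA
    rw [NatExpr.eval, hA.nat 0 fun h => by have := E.walk_nat h; lia]
    exact hd.dim
  · exact ⟨hd.congr (by simp) (fun _ _ => rfl), hrec, le_rfl, Z, E.writeNat hR (by lia), hZ,
      fun t _ ht => by lia, hcons, Or.inr Iff.rfl⟩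
  · rintro i τ hi hA hiv ⟨hd', hrec', hβ, Z', hR', hZ', hsub, hcons', hgoal⟩
    have n8 : τ.nat 8 = σ.nat 8 := hA.nat 8 fun h => by have := E.walk_nat h; lia
    have r3 : τ.real 3 = σ.real 3 := hA.real 3 fun h => by have := E.walk_real h; lia
    obtain ⟨y, hy⟩ : ∃ y : Fin d, (y : ℕ) = i := ⟨⟨i, hi⟩, rfl⟩
    subst hy
    have e8 : held d 8 τ = held d 8 σ := held_of_nat_eq n8
    have m8 : y ∈ held d 8 σ ↔ σ.nat 8 y ≠ 0 := by simp
    have m5 : y ∈ Z' ↔ τ.nat 5 y ≠ 0 := by rw [← E.held_eq hR']; simp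
    refine wp_cond (T := 2 * c + d * 11 + 11) (fun hp => ?_) (fun hp => ?_)
    · simp only [Test.Holds, NatExpr.eval, hiv, n8, Nat.le_zero] at hp
      have hyT : y ∈ held d 8 σ := m8.2 hp.1
      have hyZ : y ∉ Z' := by rw [m5]; simp [hp.2]
      refine wp.weaken (wp_seq (E.bo_spec (f := y) hd'.dim hR' hiv hyZ)
        fun τ1 hA1 ⟨hR1, hno, hg⟩ => ?_) (T := c + (c + (d * 11 + 11))) (by lia)
      have n1 : ∀ k, ¬ (k = 5 ∨ k = 7 ∨ k = 10 ∨ 20 ≤ k ∧ k < 40) → τ1.nat k = τ.nat k :=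
        fun k hk => hA1.nat k fun h => hk (E.bo_nat h)
      have r1 : ∀ k, τ1.real k = τ.real k := fun k => hA1.real k E.bo_real
      rw [e8] at hno hg
      have hlt : τ1.nat 7 0 < d := by
        by_contra! hle
        obtain ⟨g, hgZ, hgT, hgX, -⟩ := hZ'.exists_step hX hT hyT hyZ
        exact hno hle g hgZ hgT hgX
      obtain ⟨g, hg7⟩ : ∃ g : Fin d, τ1.nat 7 0 = g := ⟨⟨_, hlt⟩, rfl⟩
      obtain ⟨hgZ, hgT, hgX, hmin⟩ := hg g hg7
      refine wp_seq (E.ex_spec (f := y) (g := g) (by rw [n1 0 (by lia), hd'.dim]) hR1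
        (by rw [n1 6 (by lia), hiv]) hg7 hyZ hgZ hgX) fun τ2 hA2 hR2 => ?_
      have n2 : ∀ k, ¬ (k = 5 ∨ k = 7 ∨ k = 10 ∨ 20 ≤ k ∧ k < 40) → τ2.nat k = τ.nat k :=
        fun k hk => by rw [hA2.nat k fun h => hk (E.ex_nat h), n1 k hk]
      have r2 : ∀ k, τ2.real k = τ.real k := fun k => by rw [hA2.real k E.ex_real, r1]
      have hd2 : HasData a b s τ2 := hd'.congr (n2 0 (by lia)) fun k _ => r2 k
      have hrec2 : Recorded X a b s τ2 := by
        simpa only [Recorded, output_eq_held, held_of_nat_eq (n2 4 (by lia)), r2] using hrec'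
      have hZ2 : IsMaxOn X S (lagrange a b θ) (insert y (Z'.erase g)) := by
        refine hZ'.step hX hT hyT hyZ hgZ hgX fun g' hg' hgT' hgX' => ?_
        rw [← hw, ← hw, ← r3]
        exact hmin g' hg' hgT' hgX'
      refine wp.imp (consider_spec E hd2 hR2) fun τ3 hA3 ⟨hR3, hd3, hβ3, _, hc3, hrec3⟩ => ?_
      rw [r2] at hβ3
      refine ⟨hd3.congr (by simp) (fun _ _ => rfl), ?_, hβ.trans hβ3, _,
        E.writeNat hR3 (by lia), hZ2, fun t ht hty => ?_, hc3, ?_⟩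
      · exact hrec3 (Or.inl hrec2)
      · rcases (show (t : ℕ) < y ∨ (t : ℕ) = y by lia) with h | h
        · refine Finset.mem_insert_of_mem (Finset.mem_erase.2 ⟨fun e => ?_, hsub t ht h⟩)
          exact hgT (e ▸ ht)
        · exact Fin.ext h ▸ Finset.mem_insert_self _ _
      · rw [Memory.writeNat_real]
        have hSb' : ∀ f ∈ S, b f ≤ τ3.real 11 0 := fun f hf => (hSb f hf).trans (hβ.trans hβ3)
        rcases hgoal with hgoal | hgoal
        · exact Or.inl fun z hz => (hgoal z hz).trans (by linarith)
        · by_cases hs1 : s ≤ ∑ i ∈ Z', a i <;>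
            by_cases hs2 : s ≤ ∑ i ∈ insert y (Z'.erase g), a i
          · exact Or.inr (by simp [← hgoal, hs1, hs2])
          · refine Or.inl fun z hz => hZ2.le_add_of_infeasible h0 h1 hb (x := Z') (g := y)
              (not_le.1 hs2) ?_ (Finset.mem_insert_self _ _) (hSb' y (hT.subset hyT))
              ((hcons' hs1).trans hβ3) hz.1 (hS z hz) hz.2
            rw [Finset.erase_insert fun h => hyZ (Finset.mem_of_mem_erase h)]
            exact Finset.erase_subset _ _
          · exact Or.inl fun z hz => hZ'.le_add_of_infeasible h0 h1 hb
              (x := insert y (Z'.erase g)) (g := g) (not_le.1 hs1) (Finset.subset_insert _ _) hgZ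
              (hSb' g (hZ'.subset hgZ)) (hc3 hs2) hz.1 (hS z hz) hz.2
          · exact Or.inr (by simp [← hgoal, hs1, hs2])
    · simp only [Test.Holds, NatExpr.eval, hiv, n8, Nat.le_zero] at hp
      refine wp.weaken (wp_skip ⟨hd'.congr (by simp) (fun _ _ => rfl), hrec', hβ, Z',
        E.writeNat hR' (by lia), hZ', fun t ht hty => ?_, hcons', hgoal⟩) (by lia)
      rcases (show (t : ℕ) < y ∨ (t : ℕ) = y by lia) with h | h
      · exact hsub t ht h
      · rw [Fin.ext h] at ht ⊢
        exact m5.2 fun h' => hp ⟨m8.1 ht, h'⟩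
  · rintro τ - ⟨-, hrec', -, Z', hR', hZ', hsub, -, hgoal⟩
    refine ⟨hrec', hgoal.resolve_right fun h => ?_⟩
    have : held d 8 σ = Z' := hX.eq_of_subset hT.mem hZ'.mem fun t ht => hsub t ht t.2
    rw [← this, hflip] at h
    by_cases h' : s ≤ ∑ i ∈ held d 8 σ, a i <;> simp [h'] at h

/-! ### The list of crossings -/

/-- The square of `d` is put into the variable `13`. -/
def square : Program :=
  .letNat 13 (.const 0) ;; .forLoop 18 (.var 0) (.letNat 13 (.add (.var 13) (.var 0)))

theorem square_nat {k : ℕ} : square.WritesNat k ↔ k = 13 ∨ k = 18 := by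
  simp only [square, Program.forLoop, Program.WritesNat]; lia

theorem square_real {k : ℕ} : ¬ square.WritesReal k := by
  simp [square, Program.forLoop, Program.WritesReal]

theorem square_spec (hd : σ.nat 0 0 = d) :
    wp O square (d * 3 + 3) (fun τ => τ.nat 13 0 = d * d) σ := by
  refine wp.weaken (wp_setNat_seq (wp_forLoop (N := d) (c := 1)
    (fun i τ => τ.nat 13 0 = i * d) ?_ ?_ ?_ ?_)) (by lia)
  · simp [Program.WritesNat]
  · intro τ hA
    rw [NatExpr.eval, hA.nat 0 (by simp [Program.forLoop, Program.WritesNat])]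
    simpa [NatExpr.eval] using hd
  · simp [NatExpr.eval]
  · intro i τ hi hA hiv hI
    refine wp_setNat ?_
    have h0 : τ.nat 0 = σ.nat 0 := by
      rw [hA.nat 0 (by simp [Program.forLoop, Program.WritesNat])]; simp
    simp [NatExpr.eval, hI, h0, hd, add_mul]

/-- The crossing of the elements held by the variables `19` and `18`, or `0` if it is not between
`0` and `1`, is stored in array `5` at the address held by the variable `46`, which is then
increased. -/
def storeCrossing : Program :=
  .letReal 13 (.div (.sub (.cell 1 (.var 18)) (.cell 1 (.var 19)))
    (.add (.sub (.cell 1 (.var 18)) (.cell 1 (.var 19)))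
      (.sub (.cell 0 (.var 19)) (.cell 0 (.var 18))))) ;;
  .cond (.and (.realLE (.const 0) (.var 13)) (.realLE (.var 13) (.const 1)))
    (.setReal 5 (.var 46) (.var 13)) (.setReal 5 (.var 46) (.const 0)) ;;
  .letNat 46 (.add (.var 46) (.const 1))

theorem storeCrossing_nat {k : ℕ} : storeCrossing.WritesNat k ↔ k = 46 := by
  simp only [storeCrossing, Program.WritesNat]; lia

theorem storeCrossing_real {k : ℕ} : storeCrossing.WritesReal k ↔ k = 5 ∨ k = 13 := by
  simp only [storeCrossing, Program.WritesReal]; lia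

theorem storeCrossing_spec (hd : HasData a b s σ) {i j : Fin d} {p : ℕ} (hi : σ.nat 19 0 = i)
    (hj : σ.nat 18 0 = j) (hp : σ.nat 46 0 = p) :
    wp O storeCrossing 4 (fun τ => τ.nat 46 0 = p + 1 ∧ ∃ x : ℝ, 0 ≤ x ∧ x ≤ 1 ∧
      (0 ≤ crossing a b i j → crossing a b i j ≤ 1 → x = crossing a b i j) ∧
      τ.real 5 = Function.update (σ.real 5) p x) σ := by
  refine wp_setReal_seq (wp_seq (T := 2) (T' := 1) (Q := fun τ => τ.nat 46 0 = p ∧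
    ∃ x : ℝ, 0 ≤ x ∧ x ≤ 1 ∧
      (0 ≤ crossing a b i j → crossing a b i j ≤ 1 → x = crossing a b i j) ∧
      τ.real 5 = Function.update (σ.real 5) p x) ?_ ?_)
  · simp only [RealExpr.eval, NatExpr.eval, hi, hj, hd.ra, hd.rb, pad_coe]
    change wp O _ 2 _ (σ.writeReal 13 0 (crossing a b i j))
    refine wp_cond (fun h => wp_setReal ⟨hp, crossing a b i j, ?_⟩)
      (fun h => wp_setReal ⟨hp, 0, le_rfl, zero_le_one, ?_, ?_⟩)
    · simp [Test.Holds, RealExpr.eval, NatExpr.eval] at h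
      exact ⟨h.1, h.2, fun _ _ => rfl, by
        simp [Memory.writeReal_real_self, NatExpr.eval, RealExpr.eval, hp]⟩
    · intro hc0 hc1
      simp [Test.Holds, RealExpr.eval, NatExpr.eval] at h
      linarith [h hc0]
    · simp [Memory.writeReal_real_self, NatExpr.eval, RealExpr.eval, hp]
  · rintro τ - ⟨e46, x, hx⟩
    exact wp_setNat ⟨by simp [NatExpr.eval, e46], x, by simpa using hx⟩

/-- The crossings of all pairs of elements are stored in the cells `N, …, 2 N - 1` of array `5`,
where `N = d ^ 2` is put into the variable `13`. -/
def storeCrossings : Program :=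
  square ;; .letNat 46 (.var 13) ;;
  .forLoop 19 (.var 0) (.forLoop 18 (.var 0) storeCrossing)

theorem storeCrossings_nat {k : ℕ} :
    storeCrossings.WritesNat k ↔ k = 13 ∨ k = 18 ∨ k = 19 ∨ k = 46 := by
  simp only [storeCrossings, Program.forLoop, Program.WritesNat, square_nat, storeCrossing_nat]
  lia

theorem storeCrossings_real {k : ℕ} : storeCrossings.WritesReal k ↔ k = 5 ∨ k = 13 := by
  simp [storeCrossings, Program.forLoop, Program.WritesReal, square_real, storeCrossing_real]

/-- The crossings of the pairs that precede `(i, j)` lexicographically are stored. -/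
structure CrossingState (a b : Fin d → ℝ) (i j : ℕ) (τ : Memory) : Prop where
  next : τ.nat 46 0 = d * d + (i * d + j)
  bounds : ∀ q, d * d ≤ q → q < d * d + (i * d + j) → 0 ≤ τ.real 5 q ∧ τ.real 5 q ≤ 1
  stored : ∀ i' j' : Fin d, (i' : ℕ) < i ∨ (i' : ℕ) = i ∧ (j' : ℕ) < j →
    0 ≤ crossing a b i' j' → crossing a b i' j' ≤ 1 →
      ∃ q, d * d ≤ q ∧ q < d * d + (i * d + j) ∧ τ.real 5 q = crossing a b i' j'

theorem CrossingState.writeNat {i j k x : ℕ} (h : CrossingState a b i j τ) (hk : 46 ≠ k) :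
    CrossingState a b i j (τ.writeNat k 0 x) :=
  ⟨by rw [Memory.writeNat_nat_of_ne _ _ _ hk, h.next], h.bounds, h.stored⟩

theorem CrossingState.next_row {i : ℕ} (h : CrossingState a b i d τ) :
    CrossingState a b (i + 1) 0 τ := by
  have e : i * d + d = (i + 1) * d + 0 := by ring
  have h1 := h.next
  have h2 := h.bounds
  have h3 := h.stored
  rw [e] at h1 h2
  simp only [e] at h3
  exact ⟨h1, h2, fun i' j' hij => h3 i' j' (by have := j'.2; lia)⟩

theorem CrossingState.succ {i j : Fin d} {x : ℝ} (h : CrossingState a b i j σ)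
    (hx0 : 0 ≤ x) (hx1 : x ≤ 1)
    (hx : 0 ≤ crossing a b i j → crossing a b i j ≤ 1 → x = crossing a b i j)
    (e5 : τ.real 5 = Function.update (σ.real 5) (d * d + (i * d + j)) x)
    (e46 : τ.nat 46 0 = d * d + (i * d + j) + 1) : CrossingState a b i (j + 1) τ := by
  refine ⟨e46, fun q hq hq' => ?_, fun i' j' hij hc0 hc1 => ?_⟩
  · rw [e5, Function.update_apply]
    split_ifs
    · exact ⟨hx0, hx1⟩
    · exact h.bounds q hq (by lia)
  · by_cases hlt : (i' : ℕ) < i ∨ (i' : ℕ) = i ∧ (j' : ℕ) < j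
    · obtain ⟨q, hq, hq', e⟩ := h.stored i' j' hlt hc0 hc1
      exact ⟨q, hq, by lia, by rw [e5, Function.update_of_ne (by lia), e]⟩
    · have hi' : i' = i := Fin.ext (by lia)
      have hj' : j' = j := Fin.ext (by lia)
      subst hi' hj'
      exact ⟨d * d + (i' * d + j'), by lia, by lia,
        by rw [e5, Function.update_self, hx hc0 hc1]⟩

theorem storeCrossings_spec (hd : HasData a b s σ) :
    wp O storeCrossings (d * (d * 6 + 4) + 3 * d + 6) (fun τ => τ.nat 13 0 = d * d ∧
      (∀ q, d * d ≤ q → q < 2 * (d * d) → 0 ≤ τ.real 5 q ∧ τ.real 5 q ≤ 1) ∧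
      ∀ i j : Fin d, 0 ≤ crossing a b i j → crossing a b i j ≤ 1 →
        ∃ q, d * d ≤ q ∧ q < 2 * (d * d) ∧ τ.real 5 q = crossing a b i j) σ := by
  refine wp.weaken (wp_seq (square_spec hd.dim) fun τ1 hA1 h1 => wp_setNat_seq ?_)
    (T := (d * 3 + 3) + (d * ((d * (4 + 2) + 2) + 2) + 2 + 1)) (by lia)
  have hd1 : HasData a b s τ1 := hd.agree hA1 (fun k hk => by rw [square_nat] at hk; lia)
    fun k hk => absurd hk square_real
  have e2 : (NatExpr.var 13).eval τ1 = d * d := by simp [NatExpr.eval, h1]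
  rw [e2]
  have hd2 : HasData a b s (τ1.writeNat 46 ((NatExpr.const 0).eval τ1) (d * d)) :=
    hd1.congr (by simp) (fun k _ => by simp)
  have h13 : (τ1.writeNat 46 ((NatExpr.const 0).eval τ1) (d * d)).nat 13 0 = d * d := by simp [h1]
  have h46 : (τ1.writeNat 46 ((NatExpr.const 0).eval τ1) (d * d)).nat 46 0 = d * d := by
    simp [NatExpr.eval]
  generalize τ1.writeNat 46 ((NatExpr.const 0).eval τ1) (d * d) = σ2 at hd2 h13 h46
  refine wp.imp (wp_forLoop (N := d) (c := d * (4 + 2) + 2) (fun i τ => CrossingState a b i 0 τ)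
    ?_ ?_ ?_ ?_) ?_
  · simp [Program.forLoop, Program.WritesNat, storeCrossing_nat]
  · intro τ hA
    rw [NatExpr.eval, hA.nat 0 (by simp [Program.forLoop, Program.WritesNat, storeCrossing_nat])]
    exact hd2.dim
  · exact CrossingState.writeNat ⟨by simpa using h46, fun q _ _ => by lia,
      fun i' j' h => by lia⟩ (by lia)
  · intro i τ hi hA hiv hI
    have hdτ : HasData a b s τ := hd2.agree hA
      (fun k hk => by simp only [Program.forLoop, Program.WritesNat, storeCrossing_nat] at hk; lia)
      (by simp [Program.forLoop, Program.WritesReal, storeCrossing_real])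
    obtain ⟨i, rfl⟩ : ∃ i' : Fin d, (i' : ℕ) = i := ⟨⟨i, hi⟩, rfl⟩
    refine wp.imp (wp_forLoop (N := d) (c := 4) (fun j τ => CrossingState a b i j τ) ?_ ?_
      (hI.writeNat (by lia)) ?_) fun ρ _ h => h.next_row.writeNat (by lia)
    · simp [storeCrossing_nat]
    · intro ρ hB
      rw [NatExpr.eval, hB.nat 0 (by simp [Program.forLoop, Program.WritesNat, storeCrossing_nat])]
      exact hdτ.dim
    · intro j ρ hj hB hjv h
      obtain ⟨j, rfl⟩ : ∃ j' : Fin d, (j' : ℕ) = j := ⟨⟨j, hj⟩, rfl⟩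
      have hdρ : HasData a b s ρ := hdτ.agree hB
        (by simp [Program.forLoop, Program.WritesNat, storeCrossing_nat])
        (by simp [Program.forLoop, Program.WritesReal, storeCrossing_real])
      have hiv' : ρ.nat 19 0 = i := by
        rw [hB.nat 19 (by simp [Program.forLoop, Program.WritesNat, storeCrossing_nat]), hiv]
      refine wp.imp (storeCrossing_spec hdρ hiv' hjv h.next) ?_
      rintro ρ' - ⟨e46, x, hx0, hx1, hx, e5⟩
      exact (h.succ hx0 hx1 hx e5 e46).writeNat (by lia)
  · intro τ hA h
    refine ⟨?_, fun q hq hq' => h.bounds q hq (by lia), fun i j hi hj => ?_⟩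
    · rw [hA.nat 13 (by simp [Program.forLoop, Program.WritesNat, storeCrossing_nat]), h13]
    · obtain ⟨q, hq, hq', e⟩ := h.stored i j (Or.inl i.2) hi hj
      exact ⟨q, hq, by lia, e⟩

end Engine

end BudgetedMax

namespace BudgetedMax

open RealRAM

section Engine

variable {d : ℕ} {X : Set (Finset (Fin d))} {O : Set ℕ → Prop} {bo ex : Program} {c : ℕ}
  {Rep : Memory → Finset (Fin d) → Prop} {a b : Fin d → ℝ} {s θ : ℝ} {σ τ : Memory} {P : Program}
  {B S Z : Finset (Fin d)}

/-! ### Bisection over the crossings -/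

/-- The cells `0, …, M` of `L` form a decreasing list from `1` to `0` that contains all crossings
between `0` and `1`. -/
structure IsGrid (a b : Fin d → ℝ) (M : ℕ) (L : ℕ → ℝ) : Prop where
  anti : ∀ i j, i ≤ j → j ≤ M → L j ≤ L i
  first : L 0 = 1
  last : L M = 0
  crossing_mem : ∀ i j, 0 ≤ crossing a b i j → crossing a b i j ≤ 1 →
    ∃ q ≤ M, L q = crossing a b i j

theorem IsGrid.bounds {M i : ℕ} {L : ℕ → ℝ} (h : IsGrid a b M L) (hi : i ≤ M) :
    0 ≤ L i ∧ L i ≤ 1 :=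
  ⟨h.last ▸ h.anti i M hi le_rfl, h.first ▸ h.anti 0 i (Nat.zero_le _) hi⟩

theorem IsGrid.gap {M k : ℕ} {L : ℕ → ℝ} (h : IsGrid a b M L) (hk : k + 1 ≤ M) (i j : Fin d) :
    crossing a b i j ≤ L (k + 1) ∨ L k ≤ crossing a b i j := by
  by_cases h0 : 0 ≤ crossing a b i j
  · by_cases h1 : crossing a b i j ≤ 1
    · obtain ⟨q, hq, e⟩ := h.crossing_mem i j h0 h1
      rw [← e]
      rcases Nat.lt_or_ge k q with hqk | hqk
      · exact Or.inl (h.anti (k + 1) q hqk hq)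
      · exact Or.inr (h.anti q k hqk (by lia))
    · exact Or.inr ((h.bounds (by lia)).2.trans (not_le.1 h1).le)
  · exact Or.inl ((not_le.1 h0).le.trans (h.bounds hk).1)

/-- The variable `42` is set to the middle of the variables `40` and `41`, rounded down. -/
def halve : Program :=
  .letNat 42 (.var 40) ;; .letNat 43 (.var 41) ;;
  .loop (.natLT (.add (.var 42) (.const 1)) (.var 43))
    (.letNat 42 (.add (.var 42) (.const 1)) ;; .letNat 43 (.sub (.var 43) (.const 1)))

theorem halve_nat {k : ℕ} : halve.WritesNat k ↔ k = 42 ∨ k = 43 := by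
  simp only [halve, Program.WritesNat]; lia

theorem halve_real {k : ℕ} : ¬ halve.WritesReal k := by
  simp [halve, Program.WritesReal]

theorem halve_spec {l h : ℕ} (hl : σ.nat 40 0 = l) (hh : σ.nat 41 0 = h) (hlh : l ≤ h) :
    wp O halve (3 * h + 3) (fun τ => τ.nat 42 0 = (l + h) / 2) σ := by
  refine wp.weaken (wp_setNat_seq (wp_setNat_seq (wp_loop (n := h) (c := 2)
    (fun k τ => τ.nat 42 0 ≤ τ.nat 43 0 ∧ τ.nat 43 0 ≤ k ∧ τ.nat 42 0 + τ.nat 43 0 = l + h)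
    ?_ ?_ ?_))) (by lia)
  · simp [NatExpr.eval, hl, hh, hlh]
  · rintro k τ - ⟨h1, h2, h3⟩ hp
    simp only [Test.Holds, NatExpr.eval, not_le] at hp
    refine wp_setNat_seq (wp_setNat ⟨k - 1, by lia, ?_⟩)
    simp [NatExpr.eval]
    lia
  · rintro k τ - ⟨h1, h2, h3⟩ hp
    simp only [Test.Holds, NatExpr.eval, not_le, not_lt] at hp
    lia

/-- Bisection over the cells `0, …, M` of array `6`, between the bounds in the variables `40` and
`41`.  Bases that are optimal for the two bounds are held by the arrays `11` and `12`; the first is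
feasible, the second is not. -/
def bisect (bo ex : Program) : Program :=
  .loop (.natLT (.add (.var 40) (.const 1)) (.var 41))
    (halve ;; .letReal 8 (.cell 6 (.var 42)) ;; maximize bo ex ;;
      .cond (.realLE (.var 2) (.var 9))
        (.letNat 40 (.var 42) ;; copySet 11 5) (.letNat 41 (.var 42) ;; copySet 12 5))

theorem Engine.bisect_nat (E : Engine X O bo ex c Rep) {k : ℕ} (h : (bisect bo ex).WritesNat k) :
    k = 5 ∨ k = 6 ∨ k = 7 ∨ k = 10 ∨ k = 11 ∨ k = 12 ∨ k = 18 ∨ 20 ≤ k ∧ k < 44 := by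
  simp only [bisect, Program.WritesNat, halve_nat, copySet_nat] at h
  have h1 := @Engine.maximize_nat _ _ _ _ _ _ _ E k
  lia

theorem Engine.bisect_real (E : Engine X O bo ex c Rep) {k : ℕ}
    (h : (bisect bo ex).WritesReal k) : k = 3 ∨ k = 8 ∨ k = 9 := by
  simp only [bisect, Program.WritesReal, halve_real, copySet_real] at h
  have h1 := @Engine.maximize_real _ _ _ _ _ _ _ E k
  lia

/-- The invariant of the bisection. -/
structure BisectState (X : Set (Finset (Fin d))) (Rep : Memory → Finset (Fin d) → Prop)
    (a b : Fin d → ℝ) (s : ℝ) (S : Finset (Fin d)) (M : ℕ) (L : ℕ → ℝ) (τ : Memory) : Prop where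
  data : HasData a b s τ
  rep : ∃ B ⊆ S, Rep τ B
  lt : τ.nat 40 0 < τ.nat 41 0
  le : τ.nat 41 0 ≤ M
  lower : IsMaxOn X S (lagrange a b (L (τ.nat 40 0))) (held d 11 τ)
  feasible : s ≤ ∑ i ∈ held d 11 τ, a i
  upper : IsMaxOn X S (lagrange a b (L (τ.nat 41 0))) (held d 12 τ)
  infeasible : ∑ i ∈ held d 12 τ, a i < s

theorem Engine.bisect_spec (E : Engine X O bo ex c Rep) (hX : SymmExchange X) {M k : ℕ}
    (hM : M ≤ 2 ^ k) (h8 : held d 8 σ = ∅)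
    (h : BisectState X Rep a b s (held d 9 σ) M (σ.real 6) σ) :
    wp O (bisect bo ex) (k * (3 * M + d * (2 * c + 15) + 16) + 1)
      (fun τ => BisectState X Rep a b s (held d 9 σ) M (σ.real 6) τ ∧
        τ.nat 41 0 = τ.nat 40 0 + 1) σ := by
  refine wp_loop (c := 3 * M + d * (2 * c + 15) + 15) (fun k τ => BisectState X Rep a b s
    (held d 9 σ) M (σ.real 6) τ ∧ τ.nat 41 0 - τ.nat 40 0 ≤ 2 ^ k)
    ⟨h, (Nat.sub_le _ _).trans (h.le.trans hM)⟩ ?_ ?_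
  · rintro k τ hA ⟨h, hk⟩ hp
    have hA' : Agree (bisect bo ex) σ τ := ⟨hA.nat, hA.real⟩
    simp only [Test.Holds, NatExpr.eval, not_le] at hp
    obtain ⟨k, rfl⟩ : ∃ k', k = k' + 1 := by
      refine ⟨k - 1, ?_⟩
      rcases k with _ | k
      · simp at hk; lia
      · rfl
    rw [pow_succ] at hk
    have r6 : τ.real 6 = σ.real 6 := hA'.real 6 fun h => by have := E.bisect_real h; lia
    have e8 : held d 8 τ = ∅ := by
      rw [held_of_nat_eq (hA'.nat 8 fun h => by have := E.bisect_nat h; lia), h8]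
    have e9 : held d 9 τ = held d 9 σ :=
      held_of_nat_eq (hA'.nat 9 fun h => by have := E.bisect_nat h; lia)
    obtain ⟨B, hBS, hB⟩ := h.rep
    have hle := h.le
    generalize hl : τ.nat 40 0 = l at *
    generalize hh : τ.nat 41 0 = u at *
    refine wp.weaken (wp_seq (halve_spec hl hh (by lia)) fun τ1 hA1 h1 => wp_setReal_seq
      (wp_seq (E.maximize_spec (a := a) (b := b) (s := s) hX (B := B) ?_ ?_ ?_ ?_)
      fun τ2 hA2 h2 => wp_cond (T := d * 3 + 3) (fun hp2 => ?_) (fun hp2 => ?_)))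
      (T := (3 * u + 3) + ((d * (2 * c + 12) + 7 + (d * 3 + 3 + 1)) + 1)) (by lia)
    all_goals
      have n1 : ∀ k, ¬ (k = 42 ∨ k = 43) → τ1.nat k = τ.nat k := fun k hk =>
        hA1.nat k fun h => hk (halve_nat.1 h)
      have r1 : ∀ k, τ1.real k = τ.real k := fun k => hA1.real k halve_real
      generalize hm : (l + u) / 2 = m at *
      have e42 : RealExpr.eval τ1 (.cell 6 (.var 42)) = σ.real 6 m := by
        simp [RealExpr.eval, NatExpr.eval, h1, r1, r6]
      have ea : NatExpr.eval τ1 (.const 0) = 0 := rfl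
    · exact h.data.congr (n1 0 (by lia)) fun k hk => by
        rw [Memory.writeReal_real_of_ne _ _ _ (by lia), r1]
    · exact E.writeReal (E.congr (fun k hk => n1 k (by lia)) hB)
    · rw [held_of_nat_eq (τ := τ1.writeReal _ _ _) (n1 9 (by lia)), e9]
      exact hBS
    · rw [held_of_nat_eq (τ := τ1.writeReal _ _ _) (n1 8 (by lia)), e8]
    all_goals
      obtain ⟨hd2, -, B', hR2, hB2, hs2⟩ := h2
      rw [held_of_nat_eq (τ := τ1.writeReal _ _ _) (n1 9 (by lia)), e9, e42, ea,
        Memory.writeReal_real_same] at hB2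
      have n2 : ∀ k, ¬ (k = 5 ∨ k = 6 ∨ k = 7 ∨ k = 10 ∨ k = 18 ∨ 20 ≤ k ∧ k < 40 ∨ k = 42 ∨
          k = 43) → τ2.nat k = τ.nat k := fun k hk => by
        rw [hA2.nat k fun h => by have := E.maximize_nat h; lia]
        exact n1 k (by lia)
      have n42 : τ2.nat 42 0 = m := by
        rw [hA2.nat 42 fun h => by have := E.maximize_nat h; lia]
        exact h1
      have n40 : τ2.nat 40 0 = l := by rw [n2 40 (by lia), hl]
      have n41 : τ2.nat 41 0 = u := by rw [n2 41 (by lia), hh]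
      simp only [Test.Holds, RealExpr.eval, NatExpr.eval, hd2.rs, hs2, not_le] at hp2
    · refine wp.weaken (wp_setNat_seq (wp.imp (copySet_spec (d := d) (by lia) (by lia) (by lia)
        (by lia) (by simpa using hd2.dim)) fun τ3 hA3 h3 => ?_)) (by lia)
      have hd3 : held d 11 τ3 = B' := by
        rw [h3, ← E.held_eq hR2]
        exact held_of_nat_eq (by simp)
      have n3 : ∀ k, ¬ (k = 18 ∨ k = 11 ∨ k = 40) → τ3.nat k = τ2.nat k := fun k hk => by
        rw [hA3.nat k fun h => by rw [copySet_nat] at h; lia]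
        exact Memory.writeNat_nat_of_ne _ _ _ (by lia)
      have m40 : τ3.nat 40 0 = m := by
        rw [hA3.nat 40 fun h => by rw [copySet_nat] at h; lia]
        simpa [NatExpr.eval] using n42
      have m41 : τ3.nat 41 0 = u := by rw [n3 41 (by lia), n41]
      have m12 : held d 12 τ3 = held d 12 τ :=
        held_of_nat_eq (by rw [n3 12 (by lia), n2 12 (by lia)])
      refine ⟨k, by lia, ⟨hd2.congr (n3 0 (by lia)) fun k _ => ?_, ⟨B', hB2.subset,
        E.congr (fun k hk => n3 k (by lia)) hR2⟩, ?_, ?_, ?_, ?_, ?_, ?_⟩, ?_⟩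
      · exact hA3.real k copySet_real
      · rw [m40, m41]; lia
      · rw [m41]; exact hle
      · rw [m40, hd3]; exact hB2
      · rw [hd3]; exact hp2
      · have := h.upper
        rwa [m41, m12, ← hh]
      · rw [m12]; exact h.infeasible
      · rw [m40, m41]; lia
    · refine wp.weaken (wp_setNat_seq (wp.imp (copySet_spec (d := d) (by lia) (by lia) (by lia)
        (by lia) (by simpa using hd2.dim)) fun τ3 hA3 h3 => ?_)) (by lia)
      have hd3 : held d 12 τ3 = B' := by
        rw [h3, ← E.held_eq hR2]
        exact held_of_nat_eq (by simp)
      have n3 : ∀ k, ¬ (k = 18 ∨ k = 12 ∨ k = 41) → τ3.nat k = τ2.nat k := fun k hk => by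
        rw [hA3.nat k fun h => by rw [copySet_nat] at h; lia]
        exact Memory.writeNat_nat_of_ne _ _ _ (by lia)
      have m41 : τ3.nat 41 0 = m := by
        rw [hA3.nat 41 fun h => by rw [copySet_nat] at h; lia]
        simpa [NatExpr.eval] using n42
      have m40 : τ3.nat 40 0 = l := by rw [n3 40 (by lia), n40]
      have m11 : held d 11 τ3 = held d 11 τ :=
        held_of_nat_eq (by rw [n3 11 (by lia), n2 11 (by lia)])
      refine ⟨k, by lia, ⟨hd2.congr (n3 0 (by lia)) fun k _ => ?_, ⟨B', hB2.subset,
        E.congr (fun k hk => n3 k (by lia)) hR2⟩, ?_, ?_, ?_, ?_, ?_, ?_⟩, ?_⟩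
      · exact hA3.real k copySet_real
      · rw [m40, m41]; lia
      · rw [m41]; lia
      · have := h.lower
        rwa [m40, m11, ← hl]
      · rw [m11]; exact h.feasible
      · rw [m41, hd3]; exact hB2
      · rw [hd3]; exact hp2
      · rw [m40, m41]; lia
  · rintro k τ - ⟨h, hk⟩ hp
    simp only [Test.Holds, NatExpr.eval, not_lt, not_le] at hp
    have := h.lt
    exact ⟨h, by lia⟩

/-- A basis that is optimal in the middle between the two bounds is computed; it is also optimal for
both bounds, and from it a walk leads to the basis held by array `11` or `12`, whichever differs
from it in feasibility. -/
def finish (bo ex : Program) : Program :=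
  .letReal 8 (.div (.add (.cell 6 (.var 40)) (.cell 6 (.var 41))) (.const 2)) ;;
  maximize bo ex ;;
  .cond (.realLE (.var 2) (.var 9))
    (copySet 8 12 ;; .letReal 8 (.cell 6 (.var 41)))
    (copySet 8 11 ;; .letReal 8 (.cell 6 (.var 40))) ;;
  setWeight ;; consider ;; walk bo ex

theorem Engine.finish_nat (E : Engine X O bo ex c Rep) {k : ℕ} (h : (finish bo ex).WritesNat k) :
    k ≠ 3 := by
  rintro rfl
  simp [finish, Program.WritesNat, copySet_nat, setWeight_nat, consider_nat] at h
  rcases h with h | h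
  · have := E.maximize_nat h; lia
  · have := E.walk_nat h; lia

/-- No crossing lies strictly between the two bounds, so that the basis for the middle is optimal for
both weights, and a walk to a basis of the other feasibility keeps one of the two weights. -/
theorem Engine.finish_spec (E : Engine X O bo ex c Rep) (hX : SymmExchange X) {M : ℕ}
    (hb : ∀ i, 0 < b i) (h8 : held d 8 σ = ∅) (hgrid : IsGrid a b M (σ.real 6))
    (h : BisectState X Rep a b s (held d 9 σ) M (σ.real 6) σ) (hlh : σ.nat 41 0 = σ.nat 40 0 + 1)
    (hrec : Recorded X a b s σ) (hS : ∀ A ∈ feasible X a s, A ⊆ held d 9 σ)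
    (hSb : ∀ f ∈ held d 9 σ, b f ≤ σ.real 11 0) :
    wp O (finish bo ex) (d * (4 * c + 11 * d + 43) + 28)
      (fun τ => Recorded X a b s τ ∧ IsHalf X a b s (τ.real 11 0)) σ := by
  obtain ⟨B, hBS, hB⟩ := h.rep
  have hle := h.le
  generalize hl : σ.nat 40 0 = l at *
  rw [hlh] at hle
  have ea : NatExpr.eval σ (.const 0) = 0 := rfl
  have e0 : RealExpr.eval σ (.div (.add (.cell 6 (.var 40)) (.cell 6 (.var 41))) (.const 2)) =
      (σ.real 6 (l + 1) + σ.real 6 l) / 2 := by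
    simp [RealExpr.eval, NatExpr.eval, hl, hlh, add_comm]
  refine wp.weaken (wp_setReal_seq (wp_seq (E.maximize_spec (a := a) (b := b) (s := s) hX (B := B)
    ?_ (E.writeReal hB) hBS h8)
    fun τ1 hA1 ⟨hd1, _, Z, hR1, hZ, hs1⟩ => wp_seq (T := d * 3 + 3 + 1) (Q := fun τ2 =>
      (∀ k, ¬ (k = 18 ∨ k = 8) → τ2.nat k = τ1.nat k) ∧ (∀ k, k ≠ 8 → τ2.real k = τ1.real k) ∧
      ∃ t, τ2.real 8 0 = t ∧ 0 ≤ t ∧ t ≤ 1 ∧ IsMaxOn X (held d 9 σ) (lagrange a b t) Z ∧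
      IsMaxOn X (held d 9 σ) (lagrange a b t) (held d 8 τ2) ∧
      (s ≤ ∑ i ∈ Z, a i ↔ ¬ s ≤ ∑ i ∈ held d 8 τ2, a i))
      (T' := (d * 3 + 2) + ((d * 11 + 11) + (d * (2 * c + d * 11 + 14) + 2))) ?_ ?_))
    (T := (d * (2 * c + 12) + 7 + ((d * 3 + 3 + 1) + ((d * 3 + 2) +
      ((d * 11 + 11) + (d * (2 * c + d * 11 + 14) + 2))))) + 1)
    (by ring_nf; lia)
  · exact h.data.congr (by simp) fun k hk => Memory.writeReal_real_of_ne _ _ _ (by lia)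
  · have n1 : ∀ k, ¬ (k = 5 ∨ k = 6 ∨ k = 7 ∨ k = 10 ∨ k = 18 ∨ 20 ≤ k ∧ k < 40) →
        τ1.nat k = σ.nat k := fun k hk => by
      rw [hA1.nat k fun h => by have := E.maximize_nat h; lia]
      rfl
    have r1 : ∀ k, ¬ (k = 3 ∨ k = 9 ∨ k = 8) → τ1.real k = σ.real k := fun k hk => by
      rw [hA1.real k fun h => by have := E.maximize_real h; lia]
      exact Memory.writeReal_real_of_ne _ _ _ (by lia)
    rw [ea, e0, Memory.writeReal_real_same] at hZ
    have hpq : σ.real 6 (l + 1) ≤ σ.real 6 l := hgrid.anti _ _ (Nat.le_succ l) hle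
    have hmid : ∀ t, t = σ.real 6 (l + 1) ∨ t = σ.real 6 l →
        IsMaxOn X (held d 9 σ) (lagrange a b t) Z := fun t ht =>
      IsMaxOn.of_no_crossing hX hpq ht (hgrid.gap hle) hZ
    refine wp_cond (fun hp => ?_) (fun hp => ?_)
    all_goals simp only [Test.Holds, RealExpr.eval, NatExpr.eval, hd1.rs, hs1] at hp
    · refine wp.weaken (wp_seq (copySet_spec (d := d) (by lia) (by lia) (by lia) (by lia) hd1.dim)
        fun τ2 hA2 h2 => wp_setReal ?_) le_rfl
      refine ⟨fun k hk => hA2.nat k fun h => by rw [copySet_nat] at h; lia, fun k hk => ?_, σ.real 6 (l + 1), ?_, ?_⟩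
      · rw [Memory.writeReal_real_of_ne _ _ _ hk, hA2.real k copySet_real]
      · simp only [RealExpr.eval, NatExpr.eval, Memory.writeReal_real_same]
        rw [hA2.real 6 copySet_real, hA2.nat 41 (by simp [copySet_nat]), r1 6 (by lia),
          n1 41 (by lia), hlh]
      · have e12 : held d 12 τ1 = held d 12 σ := held_of_nat_eq (n1 12 (by lia))
        have e : held d 8 (τ2.writeReal 8 0 (RealExpr.eval τ2 (.cell 6 (.var 41)))) =
          held d 12 σ := h2.trans e12
        refine ⟨(hgrid.bounds hle).1, (hgrid.bounds hle).2, hmid _ (Or.inl rfl), ?_, ?_⟩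
        · have := h.upper
          rw [hlh] at this
          exact e.symm ▸ this
        · have := h.infeasible
          simp only [NatExpr.eval, e, hp, not_le, this]
    · refine wp.weaken (wp_seq (copySet_spec (d := d) (by lia) (by lia) (by lia) (by lia) hd1.dim)
        fun τ2 hA2 h2 => wp_setReal ?_) le_rfl
      refine ⟨fun k hk => hA2.nat k fun h => by rw [copySet_nat] at h; lia, fun k hk => ?_, σ.real 6 l, ?_, ?_⟩
      · rw [Memory.writeReal_real_of_ne _ _ _ hk, hA2.real k copySet_real]
      · simp only [RealExpr.eval, NatExpr.eval, Memory.writeReal_real_same]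
        rw [hA2.real 6 copySet_real, hA2.nat 40 (by simp [copySet_nat]), r1 6 (by lia),
          n1 40 (by lia), hl]
      · have e11 : held d 11 τ1 = held d 11 σ := held_of_nat_eq (n1 11 (by lia))
        have e : held d 8 (τ2.writeReal 8 0 (RealExpr.eval τ2 (.cell 6 (.var 40)))) =
          held d 11 σ := h2.trans e11
        have hlM : l ≤ M := by lia
        refine ⟨(hgrid.bounds hlM).1, (hgrid.bounds hlM).2, hmid _ (Or.inr rfl), ?_, ?_⟩
        · have := h.lower
          rw [hl] at this
          exact e.symm ▸ this
        · have := h.feasible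
          simp only [NatExpr.eval, e, hp, this, not_true]
  · rintro τ2 - ⟨n2, r2, t, ht, ht0, ht1, hZt, hTt, hflip⟩
    have n2' : ∀ k, ¬ (k = 5 ∨ k = 6 ∨ k = 7 ∨ k = 8 ∨ k = 10 ∨ k = 18 ∨ 20 ≤ k ∧ k < 40) →
        τ2.nat k = σ.nat k := fun k hk => by
      rw [n2 k (by lia), hA1.nat k fun h => by have := E.maximize_nat h; lia]
      rfl
    have r2' : ∀ k, ¬ (k = 3 ∨ k = 9 ∨ k = 8) → τ2.real k = σ.real k := fun k hk => by
      rw [r2 k (by lia), hA1.real k fun h => by have := E.maximize_real h; lia]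
      exact Memory.writeReal_real_of_ne _ _ _ (by lia)
    have hd2 : HasData a b s τ2 := hd1.congr (n2 0 (by lia)) fun k hk => r2 k (by lia)
    have hR2 : Rep τ2 Z := E.congr (fun k hk => n2 k (by lia)) hR1
    have hrec2 : Recorded X a b s τ2 := by
      simpa only [Recorded, output_eq_held, held_of_nat_eq (n2' 4 (by lia)), r2' 11 (by lia)]
        using hrec
    refine wp_seq (setWeight_spec hd2) fun τ3 hA3 h3 => ?_
    have n3 : ∀ k, k ≠ 18 → τ3.nat k = τ2.nat k := fun k hk =>
      hA3.nat k fun h => hk (setWeight_nat.1 h)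
    have r3 : ∀ k, k ≠ 3 → τ3.real k = τ2.real k := fun k hk =>
      hA3.real k fun h => hk (setWeight_real.1 h)
    have hd3 : HasData a b s τ3 := hd2.congr (n3 0 (by lia)) fun k hk => r3 k (by lia)
    have hrec3 : Recorded X a b s τ3 := by
      simpa only [Recorded, output_eq_held, held_of_nat_eq (n3 4 (by lia)), r3 11 (by lia)]
        using hrec2
    refine wp_seq (consider_spec E hd3 (E.congr (fun k hk => n3 k (by lia)) hR2))
      fun τ4 hA4 ⟨hR4, hd4, hβ, _, hc4, hrec4⟩ => ?_
    have e8 : held d 8 τ4 = held d 8 τ2 := held_of_nat_eq (by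
      rw [hA4.nat 8 (by simp [consider_nat]), n3 8 (by lia)])
    rw [← e8] at hTt hflip
    refine E.walk_spec hX hb ht0 ht1 hd4 hR4 (hrec4 (Or.inl hrec3)) hS (fun f hf => ?_) hZt hTt
      (fun i => ?_) hflip hc4
    · refine (hSb f hf).trans (le_trans ?_ hβ)
      rw [r3 11 (by lia), r2' 11 (by lia)]
    · rw [hA4.real 3 (by simp [consider_real]), h3 i, ht]

end Engine

end BudgetedMax

namespace BudgetedMax

open RealRAM

section Engine

variable {d : ℕ} {X : Set (Finset (Fin d))} {O : Set ℕ → Prop} {bo ex : Program} {c : ℕ}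
  {Rep : Memory → Finset (Fin d) → Prop} {a b : Fin d → ℝ} {s θ : ℝ} {σ τ : Memory} {P : Program}
  {B S Z : Finset (Fin d)}

/-- The crossings are sorted, and the ends `1` and `0` are added to the list. -/
def makeGrid : Program :=
  storeCrossings ;; buildHeap ;; emptyHeap ;;
  .setReal 6 (.const 0) (.const 1) ;; .setReal 6 (.add (.var 16) (.const 1)) (.const 0)

theorem makeGrid_nat {k : ℕ} (h : makeGrid.WritesNat k) : 13 ≤ k ∧ k ≤ 19 ∨ k = 46 := by
  simp only [makeGrid, Program.WritesNat, storeCrossings_nat, buildHeap_writesNat,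
    emptyHeap_writesNat] at h
  lia

theorem makeGrid_real {k : ℕ} (h : makeGrid.WritesReal k) : k = 5 ∨ k = 6 ∨ k = 13 := by
  simp only [makeGrid, Program.WritesReal, storeCrossings_real, buildHeap_writesReal,
    emptyHeap_writesReal] at h
  lia

theorem makeGrid_spec {l : ℕ} (hd : HasData a b s σ) (h1 : 1 ≤ d) (hl : d ≤ 2 ^ l) :
    wp O makeGrid (d * d * (24 * l + 18) + 7 * d + 12)
      (fun τ => τ.nat 16 0 ≤ d * d ∧ IsGrid a b (τ.nat 16 0 + 1) (τ.real 6)) σ := by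
  have hN : 1 ≤ d * d := Nat.mul_pos h1 h1
  have hk : d * d ≤ 2 ^ (2 * l) := by
    rw [two_mul, pow_add]
    exact Nat.mul_le_mul hl hl
  have hT : (d * d - 1) * (2 * l * 6 + 6) ≤ d * d * (2 * l * 6 + 6) :=
    Nat.mul_le_mul_right _ (Nat.sub_le _ _)
  refine wp.weaken (wp_seq (storeCrossings_spec hd) fun τ1 hA1 ⟨h13, hb1, hc1⟩ =>
    wp_seq (buildHeap_spec (k := 2 * l) h13 hN hk hb1) fun τ2 hA2 ⟨hs2, hc2⟩ =>
    wp_seq (emptyHeap_spec (k := 2 * l) (N := d * d) ?_ hN hk hs2) fun τ3 hA3 ⟨hK, hs3, hc3⟩ =>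
    wp_setReal_seq (wp_setReal ?_)) (T := (d * (d * 6 + 4) + 3 * d + 6) +
      (((d * d - 1) * (2 * l * 6 + 6) + 2) + ((d * d * (2 * l * 6 + 6) + 2) + (1 + 1)))) (by lia)
  · rw [hA2.nat 13 (by simp [buildHeap_writesNat]), h13]
  · simp only [NatExpr.eval, RealExpr.eval, Memory.writeReal_real_self, Memory.writeReal_nat,
      Nat.cast_zero, Nat.cast_one]
    generalize τ3.nat 16 0 = K at *
    refine ⟨hK, ?_⟩
    -- the ends `1` and `0` at the positions `0` and `K + 1` do not touch the sorted crossings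
    have hL : ∀ i, 1 ≤ i → i ≤ K → Function.update (Function.update (τ3.real 6) 0 1) (K + 1) 0 i =
        τ3.real 6 i := fun i hi hi' => by
      rw [Function.update_of_ne (by lia), Function.update_of_ne (by lia)]
    have hL0 : Function.update (Function.update (τ3.real 6) 0 1) (K + 1) 0 0 = 1 := by simp
    have hL1 : Function.update (Function.update (τ3.real 6) 0 1) (K + 1) 0 (K + 1) = 0 := by simp
    refine ⟨fun i j hij hj => ?_, hL0, hL1, fun i j hi hj => ?_⟩
    · rcases Nat.eq_zero_or_pos i with rfl | hi
      · rw [hL0]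
        rcases Nat.eq_zero_or_pos j with rfl | hj0
        · rw [hL0]
        rcases Nat.lt_or_ge K j with hjK | hjK
        · obtain rfl : j = K + 1 := by lia
          rw [hL1]; norm_num
        · rw [hL j hj0 hjK]
          exact (hs3.bounds j hj0 hjK).2
      · rcases Nat.lt_or_ge K j with hjK | hjK
        · obtain rfl : j = K + 1 := by lia
          rw [hL1]
          rcases Nat.lt_or_ge K i with hiK | hiK
          · obtain rfl : i = K + 1 := by lia
            rw [hL1]
          · rw [hL i hi hiK]
            exact (hs3.bounds i hi hiK).1
        · rw [hL i hi (by lia), hL j (by lia) hjK]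
          exact hs3.anti i j hi hij hjK
    · obtain ⟨q, hq, hq', e⟩ := hc1 i j hi hj
      obtain ⟨q2, hq2, hq2', e2⟩ := hc2 q hq hq'
      obtain ⟨q3, hq3, hq3', e3⟩ := hc3 q2 hq2 hq2' (by rw [e2, e]; exact hi)
      exact ⟨q3, by lia, by rw [hL q3 hq3 hq3', e3, e2, e]⟩

/-- The search for two optimal bases of the same Lagrangian weight of which exactly one is feasible,
followed by a walk between them.  The current basis has the largest objective, but is infeasible;
the array `11` holds a feasible basis. -/
def search (bo ex : Program) : Program :=
  copySet 12 5 ;; makeGrid ;; .letNat 40 (.const 0) ;; .letNat 41 (.add (.var 16) (.const 1)) ;;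
  bisect bo ex ;; finish bo ex

theorem Engine.search_nat (E : Engine X O bo ex c Rep) {k : ℕ} (h : (search bo ex).WritesNat k) :
    k ≠ 3 := by
  rintro rfl
  simp only [search, Program.WritesNat, copySet_nat] at h
  have h1 := @makeGrid_nat 3
  have h2 := @Engine.bisect_nat _ _ _ _ _ _ _ E 3
  have h3 := @Engine.finish_nat _ _ _ _ _ _ _ E 3
  lia

theorem Engine.search_spec (E : Engine X O bo ex c Rep) (hX : SymmExchange X) {l : ℕ}
    (hl : d ≤ 2 ^ l) (hb : ∀ i, 0 < b i) (hd : HasData a b s σ) (hR : Rep σ B)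
    (h8 : held d 8 σ = ∅) (hB : IsMaxOn X (held d 9 σ) (lagrange a b 0) B)
    (hBs : ∑ i ∈ B, a i < s) (hF : IsMaxOn X (held d 9 σ) (lagrange a b 1) (held d 11 σ))
    (hFs : s ≤ ∑ i ∈ held d 11 σ, a i)
    (hrec : Recorded X a b s σ) (hS : ∀ A ∈ feasible X a s, A ⊆ held d 9 σ)
    (hSb : ∀ f ∈ held d 9 σ, b f ≤ σ.real 11 0) :
    wp O (search bo ex) (100 * ((c + d + 1) * (d + 1) * (l + 1)))
      (fun τ => Recorded X a b s τ ∧ IsHalf X a b s (τ.real 11 0)) σ := by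
  have h1 : 1 ≤ d := by
    rcases Nat.eq_zero_or_pos d with rfl | h
    · have : held 0 11 σ = B := Subsingleton.elim _ _
      rw [this] at hFs
      exact absurd hFs (not_le.2 hBs)
    · exact h
  have hM : d * d + 1 ≤ 2 ^ (2 * l + 1) := by
    have : d * d ≤ 2 ^ l * 2 ^ l := Nat.mul_le_mul hl hl
    rw [pow_succ, two_mul, pow_add]
    have : 0 < 2 ^ l * 2 ^ l := by positivity
    lia
  have hT : d * 3 + 2 + ((d * d * (24 * l + 18) + 7 * d + 12) +
      (((2 * l + 1) * (3 * (d * d + 1) + d * (2 * c + 15) + 16) + 1 +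
        (d * (4 * c + 11 * d + 43) + 28)) + 1 + 1)) ≤
      100 * ((c + d + 1) * (d + 1) * (l + 1)) := by
    ring_nf
    lia
  refine wp.weaken (wp_seq (copySet_spec (d := d) (by lia) (by lia) (by lia) (by lia) hd.dim)
    fun τ1 hA1 h1' => wp_seq (makeGrid_spec (hd.agree hA1 ?_ ?_) h1 hl)
    fun τ2 hA2 ⟨hK, hgrid⟩ => wp_setNat_seq (wp_setNat_seq (wp_seq (Q := fun τ =>
      BisectState X Rep a b s (held d 9 σ) (τ2.nat 16 0 + 1) (τ2.real 6) τ ∧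
        τ.nat 41 0 = τ.nat 40 0 + 1)
      (T := (2 * l + 1) * (3 * (d * d + 1) + d * (2 * c + 15) + 16) + 1) ?_
      fun τ3 hA3 ⟨hbs, hlh⟩ => ?_))) hT
  · intro k hk
    rw [copySet_nat] at hk
    lia
  · exact fun k hk => absurd hk copySet_real
  all_goals
    have n2 : ∀ k, ¬ (k = 12 ∨ 13 ≤ k ∧ k ≤ 19 ∨ k = 46) → τ2.nat k = σ.nat k := fun k hk => by
      rw [hA2.nat k fun h => by have := makeGrid_nat h; lia,
        hA1.nat k fun h => by rw [copySet_nat] at h; lia]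
    have r2 : ∀ k, ¬ (k = 5 ∨ k = 6 ∨ k = 13) → τ2.real k = σ.real k := fun k hk => by
      rw [hA2.real k fun h => by have := makeGrid_real h; lia, hA1.real k copySet_real]
    have e12 : held d 12 τ2 = B := by
      rw [held_of_nat_eq (hA2.nat 12 fun h => by have := makeGrid_nat h; lia), h1', E.held_eq hR]
    set ρ : Memory := (τ2.writeNat 40 ((NatExpr.const 0).eval τ2)
      ((NatExpr.const 0).eval τ2)) with hρ
    set ρ' : Memory := ρ.writeNat 41 ((NatExpr.const 0).eval ρ)
      ((NatExpr.add (NatExpr.var 16) (NatExpr.const 1)).eval ρ) with hρ'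
    have n3 : ∀ k, k ≠ 40 → k ≠ 41 → ρ'.nat k = τ2.nat k := fun k hk hk' => by
      rw [hρ', Memory.writeNat_nat_of_ne _ _ _ hk', hρ, Memory.writeNat_nat_of_ne _ _ _ hk]
    have e40 : ρ'.nat 40 0 = 0 := by simp [hρ', hρ, NatExpr.eval]
    have e41 : ρ'.nat 41 0 = τ2.nat 16 0 + 1 := by simp [hρ', hρ, NatExpr.eval]
    have e9 : held d 9 ρ' = held d 9 σ :=
      held_of_nat_eq (by rw [n3 9 (by lia) (by lia), n2 9 (by lia)])
    have e8 : held d 8 ρ' = ∅ := by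
      exact (held_of_nat_eq (by rw [n3 8 (by lia) (by lia), n2 8 (by lia)])).trans h8
    have e11 : held d 11 ρ' = held d 11 σ :=
      held_of_nat_eq (by rw [n3 11 (by lia) (by lia), n2 11 (by lia)])
    have e12' : held d 12 ρ' = B := by
      rw [held_of_nat_eq (n3 12 (by lia) (by lia)), e12]
    have er : ρ'.real = τ2.real := rfl
  · rw [← e9, ← er]
    refine wp.weaken (E.bisect_spec hX (M := τ2.nat 16 0 + 1) (k := 2 * l + 1) (by lia) e8
      ⟨hd.congr ?_ ?_, ⟨B, ?_, ?_⟩, ?_, ?_, ?_, ?_, ?_, ?_⟩) ?_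
    · rw [n3 0 (by lia) (by lia), n2 0 (by lia)]
    · intro k hk
      rw [er, r2 k (by lia)]
    · rw [e9]; exact hB.subset
    · exact E.congr (fun k hk => by rw [n3 k (by lia) (by lia), n2 k (by lia)]) hR
    · rw [e40, e41]; lia
    · rw [e41]
    · rw [e40, e11, e9, er, hgrid.first]; exact hF
    · rw [e11]; exact hFs
    · rw [e41, e12', e9, er, hgrid.last]; exact hB
    · rw [e12']; exact hBs
    · gcongr
  · have n4 : ∀ k, ¬ (k = 5 ∨ k = 6 ∨ k = 7 ∨ 10 ≤ k ∧ k ≤ 46) → τ3.nat k = σ.nat k :=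
      fun k hk => by
        rw [hA3.nat k fun h => by have := E.bisect_nat h; lia, n3 k (by lia) (by lia),
          n2 k (by lia)]
    have r4 : ∀ k, ¬ (k = 3 ∨ k = 8 ∨ k = 9) → τ3.real k = τ2.real k :=
      fun k hk => hA3.real k fun h => by have := E.bisect_real h; lia
    have e9' : held d 9 τ3 = held d 9 σ := held_of_nat_eq (n4 9 (by lia))
    refine E.finish_spec hX hb ?_ (M := τ2.nat 16 0 + 1) ?_ ?_ hlh ?_ ?_ ?_
    · rw [held_of_nat_eq (n4 8 (by lia)), h8]
    · rw [r4 6 (by lia)]; exact hgrid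
    · rw [e9', r4 6 (by lia)]; exact hbs
    · simpa only [Recorded, output_eq_held, held_of_nat_eq (n4 4 (by lia)), r4 11 (by lia),
        r2 11 (by lia)] using hrec
    · rw [e9']; exact hS
    · rw [e9', r4 11 (by lia), r2 11 (by lia)]; exact hSb

/-! ### The complete algorithm -/

/-- The algorithm for a feasible problem: the current basis maximizes the constraint.  The best
objective starts with `-1`, so that the first feasible basis is recorded. -/
def improve (bo ex : Program) : Program :=
  .letNat 3 (.const 1) ;; .letReal 11 (.sub (.const 0) (.const 1)) ;; consider ;; copySet 11 5 ;;
  discard bo ;; takeBest ex ;; consider ;;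
  .letReal 8 (.const 0) ;; maximize bo ex ;; consider ;;
  .cond (.realLE (.var 2) (.var 9)) .skip (search bo ex)

theorem Engine.improve_spec (E : Engine X O bo ex c Rep) (hX : SymmExchange X) {l : ℕ}
    (hl : d ≤ 2 ^ l) (hb : ∀ i, 0 < b i) (hd : HasData a b s σ) (hR : Rep σ B)
    (h8 : held d 8 σ = ∅) (h9 : held d 9 σ = Finset.univ)
    (hB : IsMaxOn X Finset.univ (lagrange a b 1) B) (hBs : s ≤ ∑ i ∈ B, a i)
    (hw : HasWeight (lagrange a b 1) σ) :
    wp O (improve bo ex) (200 * ((c + d + 1) * (d + 1) * (l + 1)))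
      (fun τ => τ.nat 3 0 = 1 ∧ Recorded X a b s τ ∧ IsHalf X a b s (τ.real 11 0)) σ := by
  have hone : lagrange a b 1 = a := by
    funext i; simp [lagrange]
  have hBX : B ∈ feasible X a s := ⟨E.mem hR, hBs⟩
  have hT : (d * 11 + 11) + ((d * 3 + 2) + ((d * (c + 9) + 4) + ((c + 3) + ((d * 11 + 11) +
      ((d * (2 * c + 12) + 7 + ((d * 11 + 11) + (100 * ((c + d + 1) * (d + 1) * (l + 1)) + 1))) +
        1))))) + 1 + 1 ≤ 200 * ((c + d + 1) * (d + 1) * (l + 1)) := by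
    ring_nf
    lia
  refine wp.weaken (wp_setNat_seq (wp_setReal_seq ?_)) hT
  set σ1 := (σ.writeNat 3 ((NatExpr.const 0).eval σ) ((NatExpr.const 1).eval σ)) with hσ1
  set σ2 := σ1.writeReal 11 ((NatExpr.const 0).eval σ1)
    ((RealExpr.sub (.const 0) (.const 1)).eval σ1) with hσ2
  have i3 : σ2.nat 3 0 = 1 := by simp [hσ2, hσ1, NatExpr.eval]
  have in' : ∀ k, k ≠ 3 → σ2.nat k = σ.nat k := fun k hk => by
    rw [hσ2, Memory.writeReal_nat, hσ1, Memory.writeNat_nat_of_ne _ _ _ hk]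
  have ir : ∀ k, k ≠ 11 → σ2.real k = σ.real k := fun k hk => by
    rw [hσ2, Memory.writeReal_real_of_ne _ _ _ hk]; rfl
  have i11 : σ2.real 11 0 < ∑ i ∈ B, b i := by
    have : 0 ≤ ∑ i ∈ B, b i := Finset.sum_nonneg fun i _ => (hb i).le
    have e : σ2.real 11 0 = -1 := by simp [hσ2, RealExpr.eval, NatExpr.eval]
    linarith
  have hd2 : HasData a b s σ2 := hd.congr (in' 0 (by lia)) fun k hk => ir k (by lia)
  refine wp_seq (consider_spec E hd2 (E.congr (fun k hk => in' k (by lia)) hR))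
    fun τ1 hA1 ⟨hR1, hd1, _, hs1, _, hrec1⟩ => ?_
  replace hrec1 := hrec1 (Or.inr ⟨hBs, i11⟩)
  have n1 : ∀ k, ¬ (k = 4 ∨ k = 18) → τ1.nat k = σ2.nat k := fun k hk =>
    hA1.nat k fun h => hk (consider_nat.1 h)
  have r1 : ∀ k, ¬ (k = 9 ∨ k = 10 ∨ k = 11) → τ1.real k = σ2.real k := fun k hk =>
    hA1.real k fun h => hk (consider_real.1 h)
  refine wp_seq (copySet_spec (d := d) (by lia) (by lia) (by lia) (by lia) hd1.dim)
    fun τ2 hA2 h2 => ?_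
  have n2 : ∀ k, ¬ (k = 11 ∨ k = 18) → τ2.nat k = τ1.nat k := fun k hk =>
    hA2.nat k fun h => by rw [copySet_nat] at h; lia
  have r2 : ∀ k, τ2.real k = τ1.real k := fun k => hA2.real k copySet_real
  have hd2' : HasData a b s τ2 := hd1.congr (n2 0 (by lia)) fun k _ => r2 k
  have hR2 : Rep τ2 B := E.congr (fun k hk => n2 k (by lia)) hR1
  rw [E.held_eq hR1] at h2
  refine wp_seq (E.discard_spec hX hd2' hR2 (hone ▸ hB) ?_ ?_ ?_ ?_)
    fun τ3 hA3 ⟨hR3, hst⟩ => ?_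
  · exact (held_of_nat_eq (by rw [n2 8 (by lia), n1 8 (by lia), in' 8 (by lia)])).trans h8
  · exact (held_of_nat_eq (by rw [n2 9 (by lia), n1 9 (by lia), in' 9 (by lia)])).trans h9
  · intro i
    rw [r2, r1 3 (by lia), ir 3 (by lia), hw i, hone]
  · rw [r2, hs1]
  have n3 : ∀ k, ¬ (k = 5 ∨ k = 6 ∨ k = 7 ∨ k = 9 ∨ k = 10 ∨ k = 44 ∨ k = 45 ∨ 20 ≤ k ∧ k < 40) →
    τ3.nat k = τ2.nat k := fun k hk => hA3.nat k fun h => hk (E.discard_nat h)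
  have r3 : ∀ k, k ≠ 12 → τ3.real k = τ2.real k := fun k hk =>
    hA3.real k fun h => hk (E.discard_real.1 h)
  have hd3 : HasData a b s τ3 := hd2'.congr (n3 0 (by lia)) fun k hk => r3 k (by lia)
  have hS : ∀ A ∈ feasible X a s, A ⊆ held d 9 τ3 := fun A hA j hj => mem_held.2 (hst.mem A hA j hj)
  refine wp_seq (E.takeBest_spec hb hd3.dim hR3 hBX hst) fun τ4 hA4 ⟨B4, hR4, hB4, hle4⟩ => ?_
  have n4 : ∀ k, ¬ (k = 5 ∨ k = 6 ∨ k = 7 ∨ k = 10 ∨ 20 ≤ k ∧ k < 40) → τ4.nat k = τ3.nat k :=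
    fun k hk => hA4.nat k fun h => hk (E.takeBest_nat h)
  have r4 : ∀ k, τ4.real k = τ3.real k := fun k => hA4.real k E.takeBest_real
  have hd4 : HasData a b s τ4 := hd3.congr (n4 0 (by lia)) fun k _ => r4 k
  have hrec4 : Recorded X a b s τ4 := by
    have e4 : output d τ4 = output d τ1 :=
      held_of_nat_eq (by rw [n4 4 (by lia), n3 4 (by lia), n2 4 (by lia)])
    have e11 : τ4.real 11 = τ1.real 11 := by rw [r4, r3 11 (by lia), r2]
    simpa only [Recorded, e4, e11] using hrec1
  refine wp_seq (consider_spec E hd4 hR4) fun τ5 hA5 ⟨hR5, hd5, _, _, hc5, hrec5⟩ => ?_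
  replace hrec5 := hrec5 (Or.inl hrec4)
  replace hc5 := hc5 hB4.2
  have n5 : ∀ k, ¬ (k = 4 ∨ k = 18) → τ5.nat k = τ4.nat k := fun k hk =>
    hA5.nat k fun h => hk (consider_nat.1 h)
  have e95 : held d 9 τ5 = held d 9 τ3 :=
    held_of_nat_eq (by rw [n5 9 (by lia), n4 9 (by lia)])
  refine wp_setReal_seq (wp_seq (E.maximize_spec (a := a) (b := b) (s := s) hX (B := B4)
    (hd5.congr rfl fun k hk => Memory.writeReal_real_of_ne _ _ _ (by lia)) (E.writeReal hR5) ?_ ?_)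
    fun τ6 hA6 ⟨hd6, _, B6, hR6, hB6, _⟩ => ?_)
  · exact (hS B4 hB4).trans e95.symm.subset
  · change held d 8 τ5 = ∅
    exact (held_of_nat_eq (by rw [n5 8 (by lia), n4 8 (by lia), n3 8 (by lia), n2 8 (by lia),
      n1 8 (by lia), in' 8 (by lia)])).trans h8
  have e0 : (τ5.writeReal 8 (NatExpr.eval τ5 (.const 0)) (RealExpr.eval τ5 (.const 0))).real 8 0 =
      0 := by simp [NatExpr.eval, RealExpr.eval]
  have e9 : held d 9 (τ5.writeReal 8 (NatExpr.eval τ5 (.const 0)) (RealExpr.eval τ5 (.const 0))) =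
      held d 9 τ3 := e95
  rw [e0, e9] at hB6
  have n6 : ∀ k, ¬ (k = 5 ∨ k = 6 ∨ k = 7 ∨ k = 10 ∨ k = 18 ∨ 20 ≤ k ∧ k < 40) →
      τ6.nat k = τ5.nat k := fun k hk => by
    rw [hA6.nat k fun h => hk (E.maximize_nat h)]; rfl
  have r6 : ∀ k, ¬ (k = 3 ∨ k = 9 ∨ k = 8) → τ6.real k = τ5.real k := fun k hk => by
    rw [hA6.real k fun h => by have := E.maximize_real h; lia,
      Memory.writeReal_real_of_ne _ _ _ (by lia)]
  have hrec6 : Recorded X a b s τ6 := by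
    have e4 : output d τ6 = output d τ5 := held_of_nat_eq (n6 4 (by lia))
    simpa only [Recorded, e4, r6 11 (by lia)] using hrec5
  refine wp_seq (consider_spec E hd6 hR6) fun τ7 hA7 ⟨hR7, hd7, hβ7, hs7, hc7, hrec7⟩ => ?_
  replace hrec7 := hrec7 (Or.inl hrec6)
  have n7 : ∀ k, ¬ (k = 4 ∨ k = 18) → τ7.nat k = τ6.nat k := fun k hk =>
    hA7.nat k fun h => hk (consider_nat.1 h)
  have n7' : ∀ k, ¬ (k = 3 ∨ k = 4 ∨ k = 5 ∨ k = 6 ∨ k = 7 ∨ k = 9 ∨ k = 10 ∨ k = 11 ∨ k = 18 ∨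
      20 ≤ k) → τ7.nat k = σ.nat k := fun k hk => by
    rw [n7 k (by lia), n6 k (by lia), n5 k (by lia), n4 k (by lia), n3 k (by lia), n2 k (by lia),
      n1 k (by lia), in' k (by lia)]
  have e73 : τ7.nat 3 0 = 1 := by
    rw [n7 3 (by lia), n6 3 (by lia), n5 3 (by lia), n4 3 (by lia), n3 3 (by lia), n2 3 (by lia),
      n1 3 (by lia), i3]
  have e79 : held d 9 τ7 = held d 9 τ3 := by
    exact (held_of_nat_eq (by rw [n7 9 (by lia), n6 9 (by lia)])).trans e95
  have e711 : held d 11 τ7 = B := by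
    exact (held_of_nat_eq (by rw [n7 11 (by lia), n6 11 (by lia), n5 11 (by lia), n4 11 (by lia),
      n3 11 (by lia)])).trans h2
  refine wp_cond (fun hp => ?_) (fun hp => ?_)
  all_goals simp only [Test.Holds, RealExpr.eval, NatExpr.eval, hd7.rs, hs7, not_le] at hp
  · refine wp.weaken (wp_skip ⟨e73, hrec7, fun z hz => ?_⟩) (by ring_nf; lia)
    have h1 := hB6.le z hz.1 (hS z hz)
    simp only [sum_lagrange, sub_zero, one_mul, zero_mul, add_zero] at h1
    have h2 := hc7 hp
    have h3 : 0 ≤ ∑ i ∈ B6, b i := Finset.sum_nonneg fun i _ => (hb i).le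
    linarith
  · refine wp.imp (E.search_spec hX hl hb hd7 hR7 ?_ (e79 ▸ hB6) hp ?_ ?_ hrec7 ?_ ?_)
      fun τ8 hA8 h => ⟨?_, h⟩
    · rw [held_of_nat_eq (n7' 8 (by lia)), h8]
    · rw [e79, e711]
      exact ⟨hB.mem, hS B hBX, fun A hA _ => hB.le A hA (Finset.subset_univ _)⟩
    · rw [e711]; exact hBs
    · rw [e79]; exact hS
    · rw [e79]
      intro f hf
      refine (hle4 f hf).trans (hc5.trans ?_)
      rw [r6 11 (by lia)] at hβ7
      exact hβ7
    · rw [hA8.nat 3 fun h => E.search_nat h rfl, e73]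

/-- All elements are made available. -/
def fillAlive : Program := .forLoop 18 (.var 0) (.setNat 9 (.var 18) (.const 1))

theorem fillAlive_nat {k : ℕ} : fillAlive.WritesNat k ↔ k = 9 ∨ k = 18 := by
  simp only [fillAlive, Program.forLoop, Program.WritesNat]; lia

theorem fillAlive_real {k : ℕ} : ¬ fillAlive.WritesReal k := by
  simp [fillAlive, Program.forLoop, Program.WritesReal]

theorem fillAlive_spec (hd : σ.nat 0 0 = d) :
    wp O fillAlive (d * 3 + 2) (fun τ => held d 9 τ = Finset.univ) σ := by
  refine (wp_forLoop (N := d) (c := 1) (fun i τ => ∀ j < i, τ.nat 9 j = 1) ?_ ?_ ?_ ?_).imp ?_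
  · simp [Program.WritesNat]
  · intro τ hA
    rw [NatExpr.eval, hA.nat 0 (by simp [Program.forLoop, Program.WritesNat])]
    exact hd
  · simp
  · intro i τ hi hA hiv hI
    refine wp_setNat fun j hj => ?_
    rw [Memory.writeNat_nat_of_ne _ _ _ (by lia)]
    simp only [NatExpr.eval, hiv, Memory.writeNat_nat]
    split_ifs with e
    · rfl
    · exact hI j (by lia)
  · intro τ _ h
    ext i
    simp [h i i.2]

/-- The algorithm, started with some basis. -/
def solve (bo ex : Program) : Program :=
  fillAlive ;; .letReal 8 (.const 1) ;; maximize bo ex ;;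
  .cond (.realLE (.var 2) (.var 9)) (improve bo ex) .skip

/-- The postcondition of the algorithm. -/
def Solved (X : Set (Finset (Fin d))) (a b : Fin d → ℝ) (s : ℝ) (τ : Memory) : Prop :=
  ((feasible X a s).Nonempty → τ.nat 3 0 = 1 ∧ IsApproxSolution (1 / 2) X a b s (output d τ)) ∧
    (feasible X a s = ∅ → τ.nat 3 0 = 0)

theorem Engine.solve_spec (E : Engine X O bo ex c Rep) (hX : SymmExchange X) {l : ℕ}
    (hl : d ≤ 2 ^ l) (hb : ∀ i, 0 < b i) (hd : HasData a b s σ) (hR : Rep σ B)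
    (h3 : σ.nat 3 0 = 0) (h8 : held d 8 σ = ∅) :
    wp O (solve bo ex) (250 * ((c + d + 1) * (d + 1) * (l + 1))) (Solved X a b s) σ := by
  have hT : (d * 3 + 2) + (((d * (2 * c + 12) + 7) +
      (200 * ((c + d + 1) * (d + 1) * (l + 1)) + 1)) + 1) ≤
      250 * ((c + d + 1) * (d + 1) * (l + 1)) := by
    ring_nf
    lia
  refine wp.weaken (wp_seq (fillAlive_spec hd.dim) fun τ1 hA1 h1 => wp_setReal_seq
    (wp_seq (E.maximize_spec (a := a) (b := b) (s := s) hX (B := B) ?_ ?_ ?_ ?_)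
    fun τ2 hA2 ⟨hd2, hw2, B2, hR2, hB2, hs2⟩ => wp_cond (fun hp => ?_) (fun hp => ?_))) hT
  all_goals
    have n1 : ∀ k, ¬ (k = 9 ∨ k = 18) → τ1.nat k = σ.nat k := fun k hk =>
      hA1.nat k fun h => hk (fillAlive_nat.1 h)
    have r1 : ∀ k, τ1.real k = σ.real k := fun k => hA1.real k fillAlive_real
  · refine hd.congr (n1 0 (by lia)) fun k hk => ?_
    rw [Memory.writeReal_real_of_ne _ _ _ (by lia), r1]
  · exact E.writeReal (E.congr (fun k hk => n1 k (by lia)) hR)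
  · exact (Finset.subset_univ B).trans h1.symm.subset
  · exact (held_of_nat_eq (n1 8 (by lia))).trans h8
  all_goals
    have e8 : (τ1.writeReal 8 (NatExpr.eval τ1 (.const 0)) (RealExpr.eval τ1 (.const 1))).real 8 0 =
      1 := by simp [NatExpr.eval, RealExpr.eval]
    have e9 : held d 9 (τ1.writeReal 8 (NatExpr.eval τ1 (.const 0))
      (RealExpr.eval τ1 (.const 1))) = Finset.univ := h1
    rw [e8, e9] at hB2
    rw [e8] at hw2
    have n2 : ∀ k, ¬ (k = 5 ∨ k = 6 ∨ k = 7 ∨ k = 9 ∨ k = 10 ∨ k = 18 ∨ 20 ≤ k ∧ k < 40) →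
        τ2.nat k = σ.nat k := fun k hk => by
      rw [hA2.nat k fun h => by have := E.maximize_nat h; lia]
      exact n1 k (by lia)
    simp only [Test.Holds, RealExpr.eval, NatExpr.eval, hd2.rs, hs2, not_le] at hp
  · refine wp.imp (E.improve_spec hX hl hb hd2 hR2 ?_ ?_ hB2 hp hw2)
      fun τ3 hA3 ⟨h1, ⟨h2, h2'⟩, h3⟩ => ⟨fun _ => ⟨h1, h2, fun y hy => ?_⟩, fun h => ?_⟩
    · rw [held_of_nat_eq (n2 8 (by lia)), h8]
    · rw [held_of_nat_eq (σ := τ1) (hA2.nat 9 fun h => by have := E.maximize_nat h; lia), h1]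
    · have := h3 y hy
      rw [h2'] at this
      linarith
    · exact absurd h (Set.nonempty_iff_ne_empty.1 ⟨_, h2⟩)
  · refine wp.weaken (wp_skip ⟨fun ⟨y, hy⟩ => ?_, fun _ => ?_⟩) (by ring_nf; lia)
    · have := hB2.le y hy.1 (Finset.subset_univ _)
      simp only [sum_lagrange, sub_self, zero_mul, one_mul, zero_add] at this
      linarith [hy.2]
    · rw [n2 3 (by lia), h3]

end Engine

end BudgetedMax

namespace BudgetedMax

open RealRAM

/-! ### Matroids given by an independence oracle -/

section Held

variable {d k : ℕ} {σ : Memory}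

theorem held_writeNat_zero (i : Fin d) : held d k (σ.writeNat k i 0) = (held d k σ).erase i := by
  ext j
  simp [Memory.writeNat_nat, Fin.ext_iff]

theorem held_writeNat_one (i : Fin d) : held d k (σ.writeNat k i 1) = insert i (held d k σ) := by
  ext j
  simp only [mem_held, Memory.writeNat_nat, true_and, Finset.mem_insert, Fin.ext_iff]
  split_ifs with h <;> simp [h]

end Held

section Matroid

variable {d : ℕ} {M : Matroid (Fin d)} {σ : Memory} {B : Finset (Fin d)} {f g : Fin d}

theorem indepOracle_iff {k : ℕ} :
    (Test.query k).Holds (indepOracle M) σ ↔ M.Indep (held d k σ : Set (Fin d)) := by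
  simp [Test.Holds, indepOracle, held]

theorem insert_erase_mem_bases (hB : B ∈ bases M) (hg : g ∈ B) (hf : f ∉ B) :
    insert f (B.erase g) ∈ bases M ↔ M.Indep (insert f (B.erase g) : Finset (Fin d)) := by
  refine ⟨fun h => Matroid.IsBase.indep h, fun h => ?_⟩
  have e : ((insert f (B.erase g) : Finset (Fin d)) : Set (Fin d)) = insert f (B : Set _) \ {g} := by
    rw [Finset.coe_insert, Finset.coe_erase, Set.insert_sdiff_singleton_comm]
    rintro rfl
    exact hf hg
  have : M.IsBase (insert f (B : Set _) \ {g}) :=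
    Matroid.IsBase.exchange_isBase_of_indep' hB (by simpa using hg) (by simpa using hf) (e ▸ h)
  rwa [← e] at this

/-- The element `y` of `B` is spanned by the rest of its fundamental circuit in `A`, which
therefore is not spanned by `B - y`. -/
theorem symmExchange_bases (hM : M.E = Set.univ) : SymmExchange (bases M) := by
  intro A hA B hB y hy
  simp only [Finset.mem_sdiff] at hy
  have hA' : M.IsBase (A : Set (Fin d)) := hA
  have hB' : M.IsBase (B : Set (Fin d)) := hB
  have hyA : y ∉ (A : Set (Fin d)) := by simpa using hy.2
  have hC := hA'.fundCircuit_isCircuit (x := y) (by simp [hM]) hyA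
  have hyC := hC.mem_closure_sdiff_singleton_of_mem (M.mem_fundCircuit y A)
  have hyB : y ∉ M.closure ((B : Set (Fin d)) \ {y}) :=
    hB'.indep.notMem_closure_sdiff_of_mem (by simpa using hy.1)
  obtain ⟨g, hg, hgB⟩ : ∃ g ∈ M.fundCircuit y A \ {y}, g ∉ M.closure ((B : Set (Fin d)) \ {y}) := by
    by_contra! h
    exact hyB (Matroid.closure_subset_closure_of_subset_closure h hyC)
  have hgA : g ∈ A := by
    simpa using (M.fundCircuit_subset_insert y A hg.1).resolve_left hg.2
  have hgB' : g ∉ B := fun h => hgB (M.subset_closure _ (by simp [hM])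
    ⟨by simpa using h, hg.2⟩)
  refine ⟨g, by simp [hgA, hgB'], ?_, ?_⟩
  · rw [insert_erase_mem_bases hA hgA hy.2]
    have := (hA'.indep.mem_fundCircuit_iff (by simp [hA'.closure_eq, hM]) hyA).1 hg.1
    rwa [← Set.insert_sdiff_singleton_comm (Ne.symm hg.2), ← Finset.coe_erase,
      ← Finset.coe_insert] at this
  · have := hB'.exchange_base_of_notMem_closure (by simpa using hy.1) hgB (by simp [hM])
    rwa [← Finset.coe_erase, ← Finset.coe_insert] at this

/-- A lightest element that can be exchanged for a given one is found by one query for each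
candidate. -/
def matroidBestOut : Program :=
  .letNat 7 (.var 0) ;;
  .forLoop 20 (.var 0)
    (.cond (.and (.and (.nonZero (.cell 5 (.var 20))) (.isZero (.cell 8 (.var 20))))
        (.not (.and (.natLT (.var 7) (.var 0)) (.realLE (.cell 3 (.var 7)) (.cell 3 (.var 20))))))
      (.setNat 5 (.var 20) (.const 0) ;; .setNat 5 (.var 6) (.const 1) ;;
        .cond (.query 5) (.letNat 7 (.var 20)) .skip ;;
        .setNat 5 (.var 6) (.const 0) ;; .setNat 5 (.var 20) (.const 1))
      .skip)

/-- The exchange of two elements. -/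
def matroidExchange : Program :=
  .setNat 5 (.var 7) (.const 0) ;; .setNat 5 (.var 6) (.const 1)

theorem matroidBestOut_spec (hd : σ.nat 0 0 = d) (hB : B ∈ bases M) (h5 : held d 5 σ = B)
    (h6 : σ.nat 6 0 = f) (hf : f ∉ B) :
    wp (indepOracle M) matroidBestOut (9 * (d + 1)) (fun τ => held d 5 τ = B ∧
      (d ≤ τ.nat 7 0 → ∀ g ∈ B, g ∉ held d 8 σ → insert f (B.erase g) ∉ bases M) ∧
      ∀ g : Fin d, τ.nat 7 0 = g → g ∈ B ∧ g ∉ held d 8 σ ∧ insert f (B.erase g) ∈ bases M ∧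
        ∀ g' ∈ B, g' ∉ held d 8 σ → insert f (B.erase g') ∈ bases M →
          σ.real 3 g ≤ σ.real 3 g') σ := by
  refine wp.weaken (wp_setNat_seq (wp.imp (wp_forLoop (N := d) (c := 7) (fun i τ =>
    held d 5 τ = B ∧
      (d ≤ τ.nat 7 0 → ∀ g : Fin d, (g : ℕ) < i → g ∈ B → g ∉ held d 8 σ →
        insert f (B.erase g) ∉ bases M) ∧
      ∀ g : Fin d, τ.nat 7 0 = g → g ∈ B ∧ g ∉ held d 8 σ ∧ insert f (B.erase g) ∈ bases M ∧
        ∀ g' : Fin d, (g' : ℕ) < i → g' ∈ B → g' ∉ held d 8 σ → insert f (B.erase g') ∈ bases M →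
          σ.real 3 g ≤ σ.real 3 g') ?_ ?_ ?_ ?_) ?_)) (T := d * (7 + 2) + 2 + 1) (by lia)
  · simp [Program.WritesNat]
  · intro τ hA
    rw [NatExpr.eval, hA.nat 0 (by simp [Program.forLoop, Program.WritesNat])]
    simpa [NatExpr.eval] using hd
  · refine ⟨h5, fun _ g hg => absurd hg (Nat.not_lt_zero _), fun g hg => ?_⟩
    simp only [NatExpr.eval, ne_eq, Nat.reduceEqDiff, not_false_eq_true,
      Memory.writeNat_nat_of_ne, Memory.writeNat_nat_same, hd] at hg
    lia
  · rintro i τ hi hA hiv ⟨hI5, hI0, hI⟩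
    have n0 : τ.nat 0 0 = d := by
      rw [hA.nat 0 (by simp [Program.forLoop, Program.WritesNat])]
      simpa [NatExpr.eval] using hd
    have n6 : τ.nat 6 0 = f := by
      rw [hA.nat 6 (by simp [Program.forLoop, Program.WritesNat])]
      simpa [NatExpr.eval] using h6
    have n8 : τ.nat 8 = σ.nat 8 := by
      rw [hA.nat 8 (by simp [Program.forLoop, Program.WritesNat])]
      simp
    have r3 : τ.real 3 = σ.real 3 := by
      rw [hA.real 3 (by simp [Program.forLoop, Program.WritesReal])]; rfl
    have m8 : (⟨i, hi⟩ : Fin d) ∈ held d 8 σ ↔ σ.nat 8 i ≠ 0 := by simp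
    have m5 : (⟨i, hi⟩ : Fin d) ∈ B ↔ τ.nat 5 i ≠ 0 := by rw [← hI5]; simp
    have key : ∀ g : Fin d, (g : ℕ) < i + 1 → (g : ℕ) < i ∨ g = ⟨i, hi⟩ := fun g hg => by
      rcases Nat.lt_succ_iff_lt_or_eq.1 hg with h | h
      · exact Or.inl h
      · exact Or.inr (Fin.ext h)
    refine wp_cond (T := 6) (fun hp => ?_) (fun hp => wp.weaken (wp_skip ?_) (by lia))
    all_goals simp only [Test.Holds, NatExpr.eval, RealExpr.eval, hiv, n0, n8, r3, Nat.le_zero] at hp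
    · have hiB := m5.2 hp.1.1
      have hi8 : (⟨i, hi⟩ : Fin d) ∉ held d 8 σ := fun h => m8.1 h hp.1.2
      refine wp_setNat_seq (wp_setNat_seq (T := 4) ?_)
      simp only [NatExpr.eval, hiv]
      set τ1 := (τ.writeNat 5 i 0).writeNat 5 ((τ.writeNat 5 i 0).nat 6 0) 1 with hτ1
      have e1 : held d 5 τ1 = insert f (B.erase ⟨i, hi⟩) := by
        rw [hτ1, Memory.writeNat_nat_of_ne _ _ _ (by lia), n6, held_writeNat_one,
          ← hI5, ← held_writeNat_zero]
      have t20 : τ1.nat 20 = τ.nat 20 := by simp [hτ1]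
      have t6 : τ1.nat 6 = τ.nat 6 := by simp [hτ1]
      have t7 : τ1.nat 7 = τ.nat 7 := by simp [hτ1]
      refine wp_seq (Q := fun ρ => held d 5 ρ = insert f (B.erase ⟨i, hi⟩) ∧
          (insert f (B.erase ⟨i, hi⟩) ∈ bases M ∧ ρ.nat 7 0 = i ∨
          insert f (B.erase ⟨i, hi⟩) ∉ bases M ∧ ρ.nat 7 0 = τ.nat 7 0)) (T := 2) (T' := 2)
        (wp_cond (T := 1) ?_ ?_) fun ρ hAρ ⟨hρ, hρ'⟩ =>
        wp_setNat_seq (wp_setNat ?_)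
      · rw [indepOracle_iff, e1, ← insert_erase_mem_bases hB hiB hf]
        refine fun h => wp_setNat ⟨?_, Or.inl ⟨h, ?_⟩⟩
        · rw [← e1]; exact held_of_nat_eq (Memory.writeNat_nat_of_ne _ _ _ (by lia))
        · simp [NatExpr.eval, t20, hiv]
      · rw [indepOracle_iff, e1, ← insert_erase_mem_bases hB hiB hf]
        exact fun h => wp_skip ⟨e1, Or.inr ⟨h, by rw [t7]⟩⟩
      · have ρ6 : ρ.nat 6 0 = f := by rw [hAρ.nat 6 (by simp [Program.WritesNat]), t6, n6]
        have ρ20 : ρ.nat 20 0 = i := by rw [hAρ.nat 20 (by simp [Program.WritesNat]), t20, hiv]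
        simp only [NatExpr.eval, ρ6, ne_eq, Nat.reduceEqDiff,
          not_false_eq_true, Memory.writeNat_nat_of_ne, ρ20]
        refine ⟨?_, ?_⟩
        · refine (held_of_nat_eq (Memory.writeNat_nat_of_ne _ _ _ (by lia))).trans ?_
          have := held_writeNat_one (σ := ρ.writeNat 5 f 0) (k := 5) (⟨i, hi⟩ : Fin d)
          rw [held_writeNat_zero, hρ] at this
          refine this.trans ?_
          rw [Finset.erase_insert (fun h => hf (Finset.mem_of_mem_erase h)),
            Finset.insert_erase hiB]
        · rcases hρ' with ⟨hX, h7⟩ | ⟨hX, h7⟩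
          · rw [h7]
            refine ⟨fun h => by lia, fun g hg => ?_⟩
            obtain rfl : g = ⟨i, hi⟩ := Fin.ext hg.symm
            refine ⟨hiB, hi8, hX, fun g' hg' hB' h8' hX' => ?_⟩
            rcases key g' hg' with hlt | rfl
            · -- the previous candidate was heavier, if there was one
              rcases Nat.lt_or_ge (τ.nat 7 0) d with h | h
              · have := (hI ⟨_, h⟩ rfl).2.2.2 g' hlt hB' h8' hX'
                have h2 : ¬ σ.real 3 (τ.nat 7 0) ≤ σ.real 3 i := fun h' => hp.2 ⟨by lia, h'⟩
                exact (not_le.1 h2).le.trans this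
              · exact absurd hX' (hI0 h g' hlt hB' h8')
            · exact le_rfl
          · rw [h7]
            refine ⟨fun h g hg hgB hg8 => ?_, fun g hg => ?_⟩
            · rcases key g hg with hlt | rfl
              · exact hI0 h g hlt hgB hg8
              · exact hX
            · obtain ⟨h1, h2, h3, h4⟩ := hI g hg
              refine ⟨h1, h2, h3, fun g' hg' hB' h8' hX' => ?_⟩
              rcases key g' hg' with hlt | rfl
              · exact h4 g' hlt hB' h8' hX'
              · exact absurd hX' hX
    · refine ⟨hI5, ?_⟩
      simp only [ne_eq, Nat.reduceEqDiff, not_false_eq_true,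
        Memory.writeNat_nat_of_ne]
      refine ⟨fun h g hg hgB hg8 => ?_, fun g hg => ?_⟩
      · rcases key g hg with hlt | rfl
        · exact hI0 h g hlt hgB hg8
        · exact absurd ⟨⟨m5.1 hgB, not_not.1 fun h' => hg8 (m8.2 h')⟩,
            fun h' => absurd h'.1 (by lia)⟩ hp
      · obtain ⟨h1, h2, h3, h4⟩ := hI g hg
        refine ⟨h1, h2, h3, fun g' hg' hB' h8' hX' => ?_⟩
        rcases key g' hg' with hlt | rfl
        · exact h4 g' hlt hB' h8' hX'
        · by_contra h
          refine hp ⟨⟨m5.1 hB', not_not.1 fun h' => h8' (m8.2 h')⟩, fun h' => h ?_⟩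
          rw [← hg]; exact h'.2
  · rintro τ - ⟨h1, h2, h3⟩
    refine ⟨h1, fun h g => h2 h g g.2, fun g hg => ?_⟩
    obtain ⟨h4, h5, h6, h7⟩ := h3 g hg
    exact ⟨h4, h5, h6, fun g' => h7 g' g'.2⟩

theorem matroid_engine (M : Matroid (Fin d)) :
    Engine (bases M) (indepOracle M) matroidBestOut matroidExchange (9 * (d + 1))
      (fun σ B => B ∈ bases M ∧ held d 5 σ = B) where
  mem h := h.1
  held_eq h := h.2
  congr h hR := ⟨hR.1, (held_of_nat_eq (h 5 (by lia))).trans hR.2⟩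
  bo_nat h := by
    simp only [matroidBestOut, Program.forLoop, Program.WritesNat] at h
    lia
  ex_nat h := by
    simp only [matroidExchange, Program.WritesNat] at h
    lia
  bo_real := by simp [matroidBestOut, Program.forLoop, Program.WritesReal]
  ex_real := by simp [matroidExchange, Program.WritesReal]
  bo_spec hd hR h6 hf := (matroidBestOut_spec hd hR.1 hR.2 h6 hf).imp
    fun τ _ h => ⟨⟨hR.1, h.1⟩, h.2⟩
  ex_spec {σ B f g} hd hR h6 h7 hf hg hX := by
    refine wp.weaken (wp_setNat_seq (wp_setNat ⟨hX, ?_⟩)) (by lia)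
    simp only [NatExpr.eval, ne_eq, Nat.reduceEqDiff, not_false_eq_true,
        Memory.writeNat_nat_of_ne, h6, h7, held_writeNat_one, held_writeNat_zero, hR.2]

/-- The greedy construction of a basis. -/
def matroidInit : Program :=
  .forLoop 20 (.var 0)
    (.setNat 5 (.var 20) (.const 1) ;; .cond (.query 5) .skip (.setNat 5 (.var 20) (.const 0)))

theorem matroidInit_nat {k : ℕ} : matroidInit.WritesNat k ↔ k = 5 ∨ k = 20 := by
  simp only [matroidInit, Program.forLoop, Program.WritesNat]
  lia

theorem matroidInit_spec (hd : σ.nat 0 0 = d) (h5 : held d 5 σ = ∅) :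
    wp (indepOracle M) matroidInit (d * 5 + 2) (fun τ => held d 5 τ ∈ bases M) σ := by
  refine (wp_forLoop (N := d) (c := 3) (fun i τ => M.Indep (held d 5 τ : Set (Fin d)) ∧
    (∀ j ∈ held d 5 τ, (j : ℕ) < i) ∧
    ∀ j : Fin d, (j : ℕ) < i → j ∈ held d 5 τ ∨ ¬ M.Indep (insert j (held d 5 τ : Set (Fin d))))
    ?_ ?_ ?_ ?_).imp ?_
  · simp [Program.WritesNat]
  · intro τ hA
    rw [NatExpr.eval, hA.nat 0 (by simp [Program.forLoop, Program.WritesNat])]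
    exact hd
  · have e : held d 5 (σ.writeNat 20 0 0) = ∅ := h5
    rw [e]
    simp
  · rintro i τ hi hA hiv ⟨hI, hI1, hI2⟩
    have hni : (⟨i, hi⟩ : Fin d) ∉ held d 5 τ := fun h => absurd (hI1 _ h) (lt_irrefl i)
    have key : ∀ g : Fin d, (g : ℕ) < i + 1 → (g : ℕ) < i ∨ g = ⟨i, hi⟩ := fun g hg => by
      rcases Nat.lt_succ_iff_lt_or_eq.1 hg with h | h
      · exact Or.inl h
      · exact Or.inr (Fin.ext h)
    refine wp_setNat_seq (wp_cond ?_ ?_)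
    all_goals
      simp only [NatExpr.eval, hiv]
      have e1 := held_writeNat_one (σ := τ) (k := 5) (⟨i, hi⟩ : Fin d)
      simp only at e1
      rw [indepOracle_iff, e1]
      intro hp
    · refine wp_skip ?_
      rw [held_of_nat_eq (Memory.writeNat_nat_of_ne _ _ _ (by lia)), e1]
      refine ⟨hp, fun j hj => ?_, fun j hj => ?_⟩
      · rcases Finset.mem_insert.1 hj with rfl | h
        · exact Nat.lt_succ_self i
        · exact (hI1 j h).trans (Nat.lt_succ_self i)
      · rcases key j hj with h | rfl
        · refine (hI2 j h).imp (Finset.mem_insert_of_mem) fun h' h'' => h' (h''.subset ?_)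
          exact Set.insert_subset_insert (by simp)
        · exact Or.inl (Finset.mem_insert_self _ _)
    · refine wp_setNat ?_
      have e2 := held_writeNat_zero (σ := τ.writeNat 5 i 1) (k := 5) (⟨i, hi⟩ : Fin d)
      simp only at e2
      simp only [NatExpr.eval, ne_eq, Nat.reduceEqDiff, not_false_eq_true,
        Memory.writeNat_nat_of_ne, hiv]
      rw [held_of_nat_eq (Memory.writeNat_nat_of_ne _ _ _ (by lia)), e2, e1,
        Finset.erase_insert hni]
      refine ⟨hI, fun j hj => (hI1 j hj).trans (Nat.lt_succ_self i), fun j hj => ?_⟩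
      rcases key j hj with h | rfl
      · exact hI2 j h
      · right
        rwa [Finset.coe_insert] at hp
  · rintro τ - ⟨h1, -, h2⟩
    exact h1.isBase_of_forall_insert fun j hj => (h2 j j.2).resolve_left (by simpa using hj.2)

end Matroid

end BudgetedMax

namespace BudgetedMax

open RealRAM

/-! ### Spanning trees of a graph given by its edges -/

section EdgeGraph

variable {n d : ℕ} {u v : Fin d → Fin n} {A B x : Finset (Fin d)} {p q : Fin n}
  {H : SimpleGraph (Fin n)}

/-- The graph that consists of the edges with the numbers in `x`. -/
def edgeGraph (u v : Fin d → Fin n) (x : Finset (Fin d)) : SimpleGraph (Fin n) :=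
  SimpleGraph.fromEdgeSet ((fun i => s(u i, v i)) '' (x : Set (Fin d)))

theorem exists_of_edgeGraph_adj (h : (edgeGraph u v x).Adj p q) : ∃ i ∈ x, s(u i, v i) = s(p, q) := by
  rw [edgeGraph, SimpleGraph.fromEdgeSet_adj] at h
  obtain ⟨⟨i, hi, e⟩, -⟩ := h
  exact ⟨i, by simpa using hi, e⟩

theorem edgeGraph_adj (hl : ∀ i, u i ≠ v i) {i : Fin d} (hi : i ∈ x) :
    (edgeGraph u v x).Adj (u i) (v i) := by
  rw [edgeGraph, SimpleGraph.fromEdgeSet_adj]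
  exact ⟨⟨i, by simpa using hi, rfl⟩, hl i⟩

theorem edgeGraph_reachable_of_eq (hl : ∀ i, u i ≠ v i) {i : Fin d} (hi : i ∈ x)
    (e : s(u i, v i) = s(p, q)) : (edgeGraph u v x).Reachable p q := by
  have := (edgeGraph_adj hl hi).reachable
  rcases Sym2.eq_iff.1 e with ⟨rfl, rfl⟩ | ⟨rfl, rfl⟩
  · exact this
  · exact this.symm

theorem reachable_of_edgeGraph (h : ∀ i ∈ x, H.Reachable (u i) (v i))
    (hpq : (edgeGraph u v x).Reachable p q) : H.Reachable p q := by
  obtain ⟨W⟩ := hpq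
  induction W with
  | nil => exact .refl _
  | cons hadj _ ih =>
    obtain ⟨i, hi, e⟩ := exists_of_edgeGraph_adj hadj
    have := h i hi
    rcases Sym2.eq_iff.1 e with ⟨rfl, rfl⟩ | ⟨rfl, rfl⟩
    · exact this.trans ih
    · exact this.symm.trans ih

theorem edgeGraph_reachable_mono (hl : ∀ i, u i ≠ v i) (h : A ⊆ B)
    (hpq : (edgeGraph u v A).Reachable p q) : (edgeGraph u v B).Reachable p q :=
  reachable_of_edgeGraph (fun _ hi => (edgeGraph_adj hl (h hi)).reachable) hpq

theorem card_edgeGraph (hI : Function.Injective fun i => s(u i, v i)) (hl : ∀ i, u i ≠ v i) :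
    Nat.card (edgeGraph u v x).edgeSet = x.card := by
  have e : (edgeGraph u v x).edgeSet = (fun i => s(u i, v i)) '' (x : Set (Fin d)) := by
    rw [edgeGraph, SimpleGraph.edgeSet_fromEdgeSet, sdiff_eq_left, Set.disjoint_left]
    rintro _ ⟨i, -, rfl⟩ h
    exact hl i (by simpa using h)
  rw [e, Nat.card_coe_set_eq, Set.ncard_image_of_injective _ hI, Set.ncard_coe_finset]

theorem mem_spanningTrees (hI : Function.Injective fun i => s(u i, v i)) (hl : ∀ i, u i ≠ v i) :
    x ∈ spanningTrees u v ↔ (edgeGraph u v x).Connected ∧ x.card + 1 = n := by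
  change (edgeGraph u v x).IsTree ↔ _
  rw [SimpleGraph.isTree_iff_connected_and_card, card_edgeGraph hI hl, Nat.card_fin]

theorem le_card_of_connected (hI : Function.Injective fun i => s(u i, v i)) (hl : ∀ i, u i ≠ v i)
    (h : (edgeGraph u v x).Connected) : n ≤ x.card + 1 := by
  have := h.card_vert_le_card_edgeSet_add_one
  rwa [card_edgeGraph hI hl, Nat.card_fin] at this

theorem not_reachable_erase (hI : Function.Injective fun i => s(u i, v i)) (hl : ∀ i, u i ≠ v i)
    (hB : B ∈ spanningTrees u v) {y : Fin d} (hy : y ∈ B) :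
    ¬ (edgeGraph u v (B.erase y)).Reachable (u y) (v y) := by
  intro h
  obtain ⟨hc, hB⟩ := (mem_spanningTrees hI hl).1 hB
  have := hc.nonempty
  have h' : (edgeGraph u v (B.erase y)).Connected := by
    refine ⟨fun p q => reachable_of_edgeGraph (fun i hi => ?_) (hc.preconnected p q)⟩
    by_cases e : i = y
    · exact e ▸ h
    · exact (edgeGraph_adj hl (Finset.mem_erase.2 ⟨e, hi⟩)).reachable
  have := le_card_of_connected hI hl h'
  rw [Finset.card_erase_of_mem hy] at this
  have := Finset.card_pos.2 ⟨y, hy⟩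
  lia

theorem reachable_erase (hl : ∀ i, u i ≠ v i) {g : Fin d} (W : (edgeGraph u v A).Walk p q)
    (hW : s(u g, v g) ∉ W.edges) : (edgeGraph u v (A.erase g)).Reachable p q := by
  induction W with
  | nil => exact .refl _
  | cons hadj W ih =>
    rw [SimpleGraph.Walk.edges_cons, List.mem_cons, not_or] at hW
    obtain ⟨i, hi, e⟩ := exists_of_edgeGraph_adj hadj
    refine (edgeGraph_reachable_of_eq hl (Finset.mem_erase.2 ⟨?_, hi⟩) e).trans (ih hW.2)
    rintro rfl
    exact hW.1 e

/-- A trail that leaves a set of vertices does so by an edge whose removal keeps the part of the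
trail before it and the part after it. -/
theorem exists_crossing_edge (hl : ∀ i, u i ≠ v i) (S : Set (Fin n))
    (W : (edgeGraph u v A).Walk p q) (hW : W.edges.Nodup) (hp : p ∈ S) (hq : q ∉ S) :
    ∃ g ∈ A, s(u g, v g) ∈ W.edges ∧ ∃ z z', s(u g, v g) = s(z, z') ∧ z ∈ S ∧ z' ∉ S ∧
      (edgeGraph u v (A.erase g)).Reachable p z ∧ (edgeGraph u v (A.erase g)).Reachable z' q := by
  induction W with
  | nil => exact absurd hp hq
  | @cons p m q hadj W ih =>
    rw [SimpleGraph.Walk.edges_cons, List.nodup_cons] at hW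
    obtain ⟨i, hi, e⟩ := exists_of_edgeGraph_adj hadj
    by_cases hm : m ∈ S
    · obtain ⟨g, hg, hgW, z, z', h1, h2, h3, h4, h5⟩ := ih hW.2 hm hq
      have hne : i ≠ g := by
        rintro rfl
        exact hW.1 (e ▸ hgW)
      exact ⟨g, hg, by simp [hgW], z, z', h1, h2, h3, (edgeGraph_reachable_of_eq hl
        (Finset.mem_erase.2 ⟨hne, hi⟩) e).trans h4, h5⟩
    · exact ⟨i, hi, by simp [e], p, m, e, hp, hm, .refl _,
        reachable_erase hl W fun h => hW.1 (e ▸ h)⟩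

/-- The edge `y` of `B` closes a cycle with a path of `A`, and the path has an edge between the
two parts of `B - y`. -/
theorem symmExchange_spanningTrees (hI : Function.Injective fun i => s(u i, v i))
    (hl : ∀ i, u i ≠ v i) : SymmExchange (spanningTrees u v) := by
  intro A hA B hB y hy
  simp only [Finset.mem_sdiff] at hy
  have hnr := not_reachable_erase hI hl hB hy.1
  obtain ⟨hAc, hAn⟩ := (mem_spanningTrees hI hl).1 hA
  obtain ⟨hBc, hBn⟩ := (mem_spanningTrees hI hl).1 hB
  have := hAc.nonempty
  obtain ⟨W, hW⟩ := hAc.exists_isPath (u y) (v y)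
  obtain ⟨g, hg, -, z, z', e, hz, hz', hpz, hzq⟩ := exists_crossing_edge hl
    {z | (edgeGraph u v (B.erase y)).Reachable (u y) z} W hW.isTrail.edges_nodup (.refl _) hnr
  have hgB : g ∉ B := by
    intro h
    have hne : g ≠ y := by
      rintro rfl
      exact hy.2 hg
    exact hz' (.trans hz (edgeGraph_reachable_of_eq hl (Finset.mem_erase.2 ⟨hne, h⟩) e))
  have hgy : insert y (A.erase g) ∈ spanningTrees u v := by
    refine (mem_spanningTrees hI hl).2 ⟨⟨fun p q =>
      reachable_of_edgeGraph (fun i hi => ?_) (hAc.preconnected p q)⟩, ?_⟩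
    · by_cases hig : i = g
      · have hyr := (edgeGraph_adj hl (Finset.mem_insert_self y (A.erase g))).reachable
        have h : (edgeGraph u v (insert y (A.erase g))).Reachable z z' :=
          (edgeGraph_reachable_mono hl (Finset.subset_insert _ _) hpz.symm).trans
            (hyr.trans (edgeGraph_reachable_mono hl (Finset.subset_insert _ _) hzq.symm))
        rw [hig]
        rcases Sym2.eq_iff.1 e with ⟨e1, e2⟩ | ⟨e1, e2⟩
        · rwa [e1, e2]
        · rw [e1, e2]; exact h.symm
      · exact (edgeGraph_adj hl (by simp [hig, hi])).reachable
    · rw [Finset.card_insert_of_notMem fun h => hy.2 (Finset.mem_of_mem_erase h),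
        Finset.card_erase_of_mem hg]
      have := Finset.card_pos.2 ⟨g, hg⟩
      lia
  refine ⟨g, by simp [hg, hgB], hgy, (mem_spanningTrees hI hl).2 ⟨⟨fun p q =>
      reachable_of_edgeGraph (fun i hi => ?_) (hBc.preconnected p q)⟩, ?_⟩⟩
  · by_cases hiy : i = y
    · -- `B - y` has only two components, so that `z'` lies in that of `v y`
      have htwo : (edgeGraph u v (B.erase y)).Reachable (v y) z' := by
        by_contra hcon
        have : ∀ p q, (edgeGraph u v B).Reachable p q →
            ((edgeGraph u v (B.erase y)).Reachable (u y) p ∨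
              (edgeGraph u v (B.erase y)).Reachable (v y) p) →
            ((edgeGraph u v (B.erase y)).Reachable (u y) q ∨
              (edgeGraph u v (B.erase y)).Reachable (v y) q) := by
          rintro p q ⟨W⟩ hp
          induction W with
          | nil => exact hp
          | cons hadj _ ih =>
            refine ih ?_
            obtain ⟨j, hj, ej⟩ := exists_of_edgeGraph_adj hadj
            by_cases hjy : j = y
            · subst hjy
              rcases Sym2.eq_iff.1 ej with ⟨e1, e2⟩ | ⟨e1, e2⟩
              · exact Or.inr (e2 ▸ .refl _)
              · exact Or.inl (e1 ▸ .refl _)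
            · have h := edgeGraph_reachable_of_eq hl (Finset.mem_erase.2 ⟨hjy, hj⟩) ej
              exact hp.imp (fun h' => h'.trans h) fun h' => h'.trans h
        exact (this _ _ (hBc.preconnected (u y) z') (Or.inl (.refl _))).elim hz' hcon
      have hg' := edgeGraph_reachable_of_eq hl (Finset.mem_insert_self g (B.erase y)) e
      rw [hiy]
      exact (edgeGraph_reachable_mono hl (Finset.subset_insert _ _) hz).trans (hg'.trans
        (edgeGraph_reachable_mono hl (Finset.subset_insert _ _) htwo.symm))
    · exact (edgeGraph_adj hl (by simp [hiy, hi])).reachable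
  · rw [Finset.card_insert_of_notMem fun h => hgB (Finset.mem_of_mem_erase h),
      Finset.card_erase_of_mem hy.1]
    have := Finset.card_pos.2 ⟨y, hy.1⟩
    lia

end EdgeGraph

end BudgetedMax

namespace BudgetedMax

open RealRAM

/-! ### Rooted forests -/

section Forest

variable {n d : ℕ} {U V par pe : ℕ → ℕ} {E : Set ℕ} {e f x y z : ℕ}

/-- The edge `e` leads from the vertex `x` to `y`.  The numbers `e ≥ d` denote additional edges
that lead to the additional vertex `n`. -/
def Joins (n d : ℕ) (U V : ℕ → ℕ) (e x y : ℕ) : Prop :=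
  e < d ∧ y < n ∧ (U e = x ∧ V e = y ∨ U e = y ∧ V e = x) ∨ d ≤ e ∧ y = n

/-- `y` is reached from `x` by following the parent pointers. -/
def Above (n : ℕ) (par : ℕ → ℕ) : ℕ → ℕ → Prop :=
  Relation.ReflTransGen fun x y => x < n ∧ y = par x

/-- The parents `par x` and the edges `pe x` from `x` to its parent, for the vertices `x < n`,
form a tree with root `n` and the set of edges `E`.  The vertices below `n` thus form a forest, whose
roots are joined to the vertex `n` by additional edges. -/
structure IsForest (n d : ℕ) (U V par pe : ℕ → ℕ) (E : Set ℕ) : Prop where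
  joins : ∀ x < n, Joins n d U V (pe x) x (par x)
  rank : ∃ h : ℕ → ℕ, ∀ x < n, h (par x) < h x
  bij : Set.BijOn pe (Set.Iio n) E

theorem Joins.le (h : Joins n d U V e x y) : y ≤ n := by
  rcases h with h | h
  · exact h.2.1.le
  · exact h.2.le

theorem Joins.symm (h : Joins n d U V e x y) (hx : x < n) (hy : y < n) : Joins n d U V e y x := by
  rcases h with h | h
  · exact Or.inl ⟨h.1, hx, h.2.2.symm⟩
  · lia

theorem Above.eq_or (h : Above n par x y) : x = y ∨ x < n ∧ Above n par (par x) y := by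
  rcases Relation.ReflTransGen.cases_head h with h | ⟨z, ⟨hx, rfl⟩, hz⟩
  · exact Or.inl h
  · exact Or.inr ⟨hx, hz⟩

theorem Above.step (hx : x < n) (h : Above n par (par x) y) : Above n par x y :=
  Relation.ReflTransGen.head ⟨hx, rfl⟩ h

theorem Above.of_root (h : Above n par x y) (hx : n ≤ par x) (hy : y < n) : x = y := by
  rcases h.eq_or with h | ⟨-, h⟩
  · exact h
  · rcases h.eq_or with h | h <;> lia

theorem not_above_self (hy : y < n) : ¬ Above n par n y := fun h => by
  rcases h.eq_or with h | h <;> lia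

/-- Changing the parent of `y` does not matter for the vertices outside the subtree of `y`. -/
theorem above_update (hz : ¬ Above n par z y) {w : ℕ} :
    Above n (Function.update par y x) z w ↔ Above n par z w := by
  constructor
  · intro h
    induction h using Relation.ReflTransGen.head_induction_on with
    | refl => exact .refl
    | @head a c hac _ ih =>
      have hne : a ≠ y := by
        rintro rfl
        exact hz .refl
      have hc := hac.2
      rw [Function.update_of_ne hne] at hc
      subst hc
      exact Above.step hac.1 (ih fun h => hz (Above.step hac.1 h))
  · intro h
    induction h using Relation.ReflTransGen.head_induction_on with
    | refl => exact .refl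
    | @head a c hac _ ih =>
      have hne : a ≠ y := by
        rintro rfl
        exact hz .refl
      obtain ⟨ha, rfl⟩ := hac
      refine Above.step ha ?_
      rw [Function.update_of_ne hne]
      exact ih fun h => hz (Above.step ha h)

/-- The ranks of the vertices may be assumed to be at most their number. -/
theorem IsForest.exists_rank (hF : IsForest n d U V par pe E) :
    ∃ h : ℕ → ℕ, (∀ x < n, h (par x) < h x) ∧ ∀ x, h x ≤ n := by
  obtain ⟨h, hh⟩ := hF.rank
  refine ⟨fun x => if x < n then ((Finset.range n).filter fun y => h y < h x).card + 1 else 0,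
    fun x hx => ?_, fun x => ?_⟩
  · simp only [if_pos hx]
    split_ifs with hp
    · refine Nat.succ_lt_succ (Finset.card_lt_card ?_)
      rw [Finset.ssubset_iff_of_subset fun y hy => ?_]
      · exact ⟨par x, by simp [hp, hh x hx], by simp⟩
      · simp only [Finset.mem_filter] at hy ⊢
        exact ⟨hy.1, hy.2.trans (hh x hx)⟩
    · lia
  · dsimp only
    split_ifs with hx
    · have : (Finset.range n).filter (fun y => h y < h x) ⊂ Finset.range n := by
        rw [Finset.ssubset_iff_of_subset (Finset.filter_subset _ _)]
        exact ⟨x, by simp [hx], by simp⟩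
      simpa using Finset.card_lt_card this
    · lia

theorem IsForest.exists_root (hF : IsForest n d U V par pe E) (hx : x < n) :
    ∃ r < n, Above n par x r ∧ d ≤ pe r := by
  obtain ⟨h, hh⟩ := hF.rank
  induction hk : h x using Nat.strong_induction_on generalizing x with
  | _ k ih =>
    rcases hF.joins x hx with ⟨-, hp, -⟩ | h1
    · obtain ⟨r, hr, h1, h2⟩ := ih (h (par x)) (hk ▸ hh x hx) hp rfl
      exact ⟨r, hr, h1.step hx, h2⟩
    · exact ⟨x, hx, .refl, h1.1⟩

/-- A subtree is moved to a vertex outside of it. -/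
theorem IsForest.reparent (hF : IsForest n d U V par pe E) (hy : y < n)
    (hz : ¬ Above n par z y) (hj : Joins n d U V e y z) (he : e ∉ E \ {pe y}) :
    IsForest n d U V (Function.update par y z) (Function.update pe y e)
      (insert e (E \ {pe y})) := by
  obtain ⟨h, hh⟩ := hF.rank
  refine ⟨fun x hx => ?_, ?_, ?_, ?_, ?_⟩
  · by_cases e : x = y
    · subst e; simpa using hj
    · rw [Function.update_of_ne e, Function.update_of_ne e]
      exact hF.joins x hx
  · classical
    refine ⟨fun x => h x + if Above n par x y then h z + 1 else 0, fun x hx => ?_⟩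
    by_cases e : x = y
    · subst e
      simp only [Function.update_self, if_neg hz, if_pos (show Above n par x x from .refl)]
      lia
    · simp only [Function.update_of_ne e]
      have h1 := hh x hx
      have h2 : Above n par x y ↔ Above n par (par x) y :=
        ⟨fun h => (h.eq_or.resolve_left e).2, fun h => h.step hx⟩
      simp only [h2]
      split_ifs <;> lia
  · intro x hx
    by_cases e : x = y
    · subst e; simp
    · rw [Function.update_of_ne e]
      exact Or.inr ⟨hF.bij.mapsTo hx, fun h => e (hF.bij.injOn hx hy h)⟩
  · intro x hx x' hx' e'
    have key : ∀ x, x ∈ Set.Iio n → x ≠ y → pe x ≠ e := fun x hx hne h =>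
      he ⟨h ▸ hF.bij.mapsTo hx, fun h' => hne (hF.bij.injOn hx hy (h.trans h'))⟩
    by_cases h1 : x = y <;> by_cases h2 : x' = y
    · rw [h1, h2]
    · subst h1
      rw [Function.update_self, Function.update_of_ne h2] at e'
      exact absurd e'.symm (key x' hx' h2)
    · subst h2
      rw [Function.update_self, Function.update_of_ne h1] at e'
      exact absurd e' (key x hx h1)
    · rw [Function.update_of_ne h1, Function.update_of_ne h2] at e'
      exact hF.bij.injOn hx hx' e'
  · rintro a (rfl | ⟨ha, hne⟩)
    · exact ⟨y, hy, by simp⟩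
    · obtain ⟨x, hx, rfl⟩ := hF.bij.surjOn ha
      refine ⟨x, hx, ?_⟩
      rw [Function.update_of_ne]
      rintro rfl
      exact hne rfl

theorem IsForest.congr (hF : IsForest n d U V par pe E) {par' pe' : ℕ → ℕ}
    (hp : ∀ x < n, par' x = par x) (he : ∀ x < n, pe' x = pe x) : IsForest n d U V par' pe' E := by
  refine ⟨fun x hx => ?_, ?_, hF.bij.congr fun x hx => (he x hx).symm⟩
  · rw [hp x hx, he x hx]
    exact hF.joins x hx
  · obtain ⟨h, hh⟩ := hF.rank
    exact ⟨h, fun x hx => by rw [hp x hx]; exact hh x hx⟩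

end Forest

/-! ### Operations on forests in memory -/

section Programs

variable {n d : ℕ} {O : Set ℕ → Prop} {U V : ℕ → ℕ} {E : Set ℕ} {e f w x y z : ℕ} {σ τ : Memory}

/-- The forest is stored in the arrays `21` and `22`. -/
def StoresForest (n d : ℕ) (U V : ℕ → ℕ) (E : Set ℕ) (σ : Memory) : Prop :=
  IsForest n d U V (σ.nat 21) (σ.nat 22) E

/-- From the vertex in the variable `24` one proceeds to its root. -/
def findRoot : Program :=
  .loop (.natLT (.cell 22 (.var 24)) (.var 0)) (.letNat 24 (.cell 21 (.var 24)))

theorem findRoot_nat {k : ℕ} : findRoot.WritesNat k ↔ k = 24 := by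
  simp only [findRoot, Program.WritesNat]

theorem findRoot_real {k : ℕ} : ¬ findRoot.WritesReal k := by
  simp [findRoot, Program.WritesReal]

theorem findRoot_spec (hd : σ.nat 0 0 = d) (hF : StoresForest n d U V E σ) (hw : σ.nat 24 0 < n) :
    wp O findRoot (n * 2 + 1) (fun τ => τ.nat 24 0 < n ∧ d ≤ σ.nat 22 (τ.nat 24 0) ∧
      Above n (σ.nat 21) (σ.nat 24 0) (τ.nat 24 0)) σ := by
  obtain ⟨h, hh, hhn⟩ := hF.exists_rank
  refine wp_loop (fun k τ => h (τ.nat 24 0) ≤ k ∧ τ.nat 24 0 < n ∧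
    Above n (σ.nat 21) (σ.nat 24 0) (τ.nat 24 0)) ⟨hhn _, hw, .refl⟩ ?_ ?_
  · rintro k τ hA ⟨hk, hlt, hab⟩ hp
    have n0 : τ.nat 0 = σ.nat 0 := hA.nat 0 (by simp [Program.WritesNat])
    have n21 : τ.nat 21 = σ.nat 21 := hA.nat 21 (by simp [Program.WritesNat])
    have n22 : τ.nat 22 = σ.nat 22 := hA.nat 22 (by simp [Program.WritesNat])
    simp only [Test.Holds, NatExpr.eval, n0, n22, hd, not_le] at hp
    refine wp_setNat ?_
    simp only [NatExpr.eval, Memory.writeNat_nat_same, n21]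
    have h1 := hh _ hlt
    refine ⟨_, h1.trans_le hk, le_rfl, ?_, hab.tail ⟨hlt, rfl⟩⟩
    rcases hF.joins _ hlt with h | h <;> lia
  · rintro k τ hA ⟨hk, hlt, hab⟩ hp
    have n0 : τ.nat 0 = σ.nat 0 := hA.nat 0 (by simp [Program.WritesNat])
    have n22 : τ.nat 22 = σ.nat 22 := hA.nat 22 (by simp [Program.WritesNat])
    simp only [Test.Holds, NatExpr.eval, n0, n22, hd, not_not] at hp
    exact ⟨hlt, hp, hab⟩

/-- The pointers on the way from the vertex `w`, in the variable `24`, up to the edge `last` are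
reversed; this edge is removed, and `w` gets the parent in the variable `25`, by the edge in the
variable `26`. -/
def reversePath (last : NatExpr) : Program :=
  .loop (.not (.and (.natLE (.cell 22 (.var 24)) last) (.natLE last (.cell 22 (.var 24)))))
    (.letNat 27 (.cell 21 (.var 24)) ;; .letNat 28 (.cell 22 (.var 24)) ;;
      .setNat 21 (.var 24) (.var 25) ;; .setNat 22 (.var 24) (.var 26) ;;
      .letNat 25 (.var 24) ;; .letNat 26 (.var 28) ;; .letNat 24 (.var 27)) ;;
  .setNat 21 (.var 24) (.var 25) ;; .setNat 22 (.var 24) (.var 26)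

theorem reversePath_nat {last : NatExpr} {k : ℕ} :
    (reversePath last).WritesNat k ↔ k = 21 ∨ k = 22 ∨ 24 ≤ k ∧ k ≤ 28 := by
  simp only [reversePath, Program.WritesNat]
  lia

theorem reversePath_real {last : NatExpr} {k : ℕ} : ¬ (reversePath last).WritesReal k := by
  simp [reversePath, Program.WritesReal]

/-- The state of the reversal of a path: if the current vertex received its new parent now, then
the result would be the forest in which the new edge replaces the edge above the current vertex. -/
structure ReversalState (n d : ℕ) (U V : ℕ → ℕ) (E : Set ℕ) (par pe h : ℕ → ℕ)
    (w x f : ℕ)     (σ : Memory) : Prop where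
  lt : σ.nat 24 0 < n
  above : Above n par (σ.nat 24 0) x
  par_eq : ∀ z < n, h z ≤ h (σ.nat 24 0) → σ.nat 21 z = par z ∧ σ.nat 22 z = pe z
  forest : IsForest n d U V (Function.update (σ.nat 21) (σ.nat 24 0) (σ.nat 25 0))
    (Function.update (σ.nat 22) (σ.nat 24 0) (σ.nat 26 0)) (insert f (E \ {pe (σ.nat 24 0)}))
  first : Function.update (σ.nat 22) (σ.nat 24 0) (σ.nat 26 0) w = f
  -- the vertices above the current one are not on the rest of the way
  apart : ∀ z, Above n (Function.update (σ.nat 21) (σ.nat 24 0) (σ.nat 25 0)) (σ.nat 24 0) z →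
    h (σ.nat 24 0) ≤ h z ∨ ¬ Above n par z x

theorem ReversalState.step {par pe h : ℕ → ℕ} (hF : IsForest n d U V par pe E)
    (hh : ∀ x < n, h (par x) < h x) (hx : x < n) (hf : f ∉ E)
    (hI : ReversalState n d U V E par pe h w x f σ) (hne : σ.nat 24 0 ≠ x)
    (h24 : τ.nat 24 0 = par (σ.nat 24 0)) (h25 : τ.nat 25 0 = σ.nat 24 0)
    (h26 : τ.nat 26 0 = pe (σ.nat 24 0))
    (h21 : τ.nat 21 = Function.update (σ.nat 21) (σ.nat 24 0) (σ.nat 25 0))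
    (h22 : τ.nat 22 = Function.update (σ.nat 22) (σ.nat 24 0) (σ.nat 26 0)) :
    ReversalState n d U V E par pe h w x f τ := by
  obtain ⟨hlt, habove, heq, hforest, hfirst, hapart⟩ := hI
  rw [← h21] at hapart hforest
  rw [← h22] at hforest hfirst
  generalize σ.nat 24 0 = c at *
  have hup := (habove.eq_or.resolve_left hne).2
  have hjc := hF.joins c hlt
  have hpn : par c < n := by
    rcases hjc with h | h
    · exact h.2.1
    · rw [h.2] at hup
      exact absurd hup (not_above_self hx)
  have hpc : par c ≠ c := fun e => by
    have := hh c hlt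
    rw [e] at this
    exact lt_irrefl _ this
  have hlt' := hh c hlt
  have hjoin : Joins n d U V (pe c) (par c) c := hjc.symm hlt hpn
  have hnab : ¬ Above n (τ.nat 21) c (par c) := fun h1 => by
    rcases hapart _ h1 with h2 | h2
    · lia
    · exact h2 hup
  have hfp : ∀ y < n, f ≠ pe y := fun y hy e => hf (e ▸ hF.bij.mapsTo hy)
  have hp22 : τ.nat 22 (par c) = pe (par c) := by
    rw [h22, Function.update_of_ne hpc]
    exact (heq _ hpn hlt'.le).2
  refine ⟨?_, ?_, ?_, ?_, ?_, ?_⟩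
  · rwa [h24]
  · rwa [h24]
  · intro z hz hle
    rw [h24] at hle
    have hzc : z ≠ c := by
      rintro rfl
      lia
    rw [h21, h22, Function.update_of_ne hzc, Function.update_of_ne hzc]
    exact heq z hz (by lia)
  · have hpe : pe c ≠ pe (par c) := fun e => hpc (hF.bij.injOn hlt hpn e).symm
    have := hforest.reparent hpn hnab hjoin (by
      rintro ⟨h1 | h1, -⟩
      · exact hfp c hlt h1.symm
      · exact h1.2 rfl)
    rw [h24, h25, h26]
    convert this using 1
    rw [hp22]
    ext a
    simp only [Set.mem_insert_iff, Set.mem_sdiff, Set.mem_singleton_iff]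
    have h1 : pe c ∈ E := hF.bij.mapsTo hlt
    have h2 := hfp _ hpn
    constructor
    · rintro (rfl | ⟨h3, h4⟩)
      · exact Or.inr ⟨Or.inl rfl, h2⟩
      · by_cases e : a = pe c
        · exact Or.inl e
        · exact Or.inr ⟨Or.inr ⟨h3, e⟩, h4⟩
    · rintro (rfl | ⟨rfl | ⟨h3, h4⟩, h5⟩)
      · exact Or.inr ⟨h1, hpe⟩
      · exact Or.inl rfl
      · exact Or.inr ⟨h3, h5⟩
  · rwa [h24, h26, Function.update_of_ne]
    rintro rfl
    exact hfp _ hpn (hfirst.symm.trans hp22)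
  · intro z hz
    rw [h24, h25] at hz
    rw [h24]
    rcases hz.eq_or with rfl | ⟨-, hz⟩
    · exact Or.inl le_rfl
    · rw [Function.update_self, above_update hnab] at hz
      refine (hapart z hz).imp_left fun h => ?_
      lia

theorem reversePath_spec {last : NatExpr} (hF : StoresForest n d U V E σ) (hw : σ.nat 24 0 < n)
    (hx : x < n) (hwx : Above n (σ.nat 21) (σ.nat 24 0) x)
    (hz : ¬ Above n (σ.nat 21) (σ.nat 25 0) x)
    (hj : Joins n d U V (σ.nat 26 0) (σ.nat 24 0) (σ.nat 25 0)) (hf : σ.nat 26 0 ∉ E)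
    (hs : ∀ τ, Agree (reversePath last) σ τ → last.eval τ = σ.nat 22 x) :
    wp O (reversePath last) (n * 8 + 3) (fun τ =>
      StoresForest n d U V (insert (σ.nat 26 0) (E \ {σ.nat 22 x})) τ ∧
        τ.nat 22 (σ.nat 24 0) = σ.nat 26 0) σ := by
  obtain ⟨h, hh, hhn⟩ := hF.exists_rank
  set par := σ.nat 21 with hpar
  set pe := σ.nat 22 with hpe
  set f := σ.nat 26 0 with hfdef
  have hzw : ¬ Above n par (σ.nat 25 0) (σ.nat 24 0) := fun h => hz (h.trans hwx)
  refine wp.weaken (wp_seq (wp_loop (c := 7) (n := n) (Q := ReversalState n d U V E par pe h (σ.nat 24 0) x f ⊓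
      fun τ => pe (τ.nat 24 0) = pe x)
    (fun k τ => h (τ.nat 24 0) ≤ k ∧ ReversalState n d U V E par pe h (σ.nat 24 0) x f τ)
    ⟨hhn _, hw, hwx, fun z _ _ => ⟨rfl, rfl⟩, ?_, by simp [hfdef], ?_⟩ ?_ ?_) fun τ hA ⟨hI, hτ⟩ =>
    wp_setNat_seq (wp_setNat ?_)) (T := (n * (7 + 1) + 1) + (1 + 1)) (by lia)
  · exact hF.reparent hw hzw hj fun h => hf h.1
  · intro z hz'
    rcases hz'.eq_or with rfl | ⟨-, hz'⟩
    · exact Or.inl le_rfl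
    · rw [Function.update_self] at hz'
      right
      intro hzx
      exact hz (((above_update hzw).1 hz').trans hzx)
  · rintro k τ hA ⟨hk, hI⟩ hp
    have hA' : Agree (reversePath last) σ τ := hA.mono (fun k => Or.inl) (fun k => Or.inl)
    have hcur := hI.par_eq _ hI.lt le_rfl
    simp only [Test.Holds, NatExpr.eval, hs τ hA', hcur.2] at hp
    have hne : τ.nat 24 0 ≠ x := fun h => hp (by rw [h]; exact ⟨le_rfl, le_rfl⟩)
    have hup := (hI.above.eq_or.resolve_left hne).2
    have hmono : h (par (τ.nat 24 0)) < h (τ.nat 24 0) := hh _ hI.lt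
    refine wp_setNat_seq (wp_setNat_seq (wp_setNat_seq (wp_setNat_seq (wp_setNat_seq
      (wp_setNat_seq (wp_setNat ?_))))))
    simp only [NatExpr.eval]
    refine ⟨h (par (τ.nat 24 0)), hmono.trans_le hk, ?_, ?_⟩
    · simp [Memory.writeNat_nat, hcur.1]
    · refine hI.step hF hh hx hf hne ?_ ?_ ?_ ?_ ?_
      · simp [Memory.writeNat_nat, hcur.1]
      · simp [Memory.writeNat_nat]
      · simp [Memory.writeNat_nat, hcur.2]
      · funext j
        simp [Memory.writeNat_nat, Function.update_apply]
      · funext j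
        simp [Memory.writeNat_nat, Function.update_apply]
  · rintro k τ hA ⟨hk, hI⟩ hp
    have hA' : Agree (reversePath last) σ τ := hA.mono (fun k => Or.inl) (fun k => Or.inl)
    have hcur := hI.par_eq _ hI.lt le_rfl
    simp only [Test.Holds, NatExpr.eval, hs τ hA', hcur.2, not_not] at hp
    exact ⟨hI, hp.1.antisymm hp.2⟩
  · simp only [StoresForest, NatExpr.eval]
    have := hI.forest
    rw [hτ] at this
    refine ⟨this.congr (fun z _ => by simp [Memory.writeNat_nat, Function.update_apply])
      (fun z _ => by simp [Memory.writeNat_nat, Function.update_apply]), ?_⟩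
    simpa [Memory.writeNat_nat, Function.update_apply] using hI.first

end Programs

end BudgetedMax

namespace BudgetedMax

open RealRAM

/-! ### Rooted spanning trees -/

section Tree

variable {n d : ℕ} {u v : Fin d → Fin n} {O : Set ℕ → Prop} {par pe : ℕ → ℕ} {E : Set ℕ}
  {B : Finset (Fin d)} {f g : Fin d} {w x : ℕ} {σ τ : Memory}

theorem pad_of_lt {α : Type*} [Zero α] (f : Fin d → α) {i : ℕ} (hi : i < d) :
    pad f i = f ⟨i, hi⟩ := dif_pos hi

/-- The ends of the edges, as they are stored in memory. -/
def ends (u : Fin d → Fin n) : ℕ → ℕ := pad fun i => (u i : ℕ)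

@[simp] theorem ends_coe (u : Fin d → Fin n) (i : Fin d) : ends u i = u i := pad_of_lt _ i.2

/-- The edges of a rooted spanning tree, with the edge `d` above the root. -/
def treeEdges (B : Finset (Fin d)) : Set ℕ := insert d (Fin.val '' (B : Set (Fin d)))

theorem coe_mem_treeEdges : (f : ℕ) ∈ treeEdges B ↔ f ∈ B := by
  simp [treeEdges, f.2.ne, Fin.val_inj]

theorem le_of_mem_treeEdges {e : ℕ} (h : e ∈ treeEdges B) (he : d ≤ e) : e = d := by
  rcases h with h | ⟨i, -, rfl⟩
  · exact h
  · exact absurd he (not_le.2 i.2)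

theorem treeEdges_swap : insert (f : ℕ) (treeEdges B \ {(g : ℕ)}) =
    treeEdges (insert f (B.erase g)) := by
  ext e
  by_cases he : e < d
  · lift e to Fin d using he
    simp only [Set.mem_insert_iff, Set.mem_sdiff, coe_mem_treeEdges, Set.mem_singleton_iff,
      Finset.mem_insert, Finset.mem_erase, ← Fin.ext_iff]
    tauto
  · have h1 : e ≠ f := fun h => he (h ▸ f.2)
    have h2 : e ≠ g := fun h => he (h ▸ g.2)
    have h3 : ∀ B : Finset (Fin d), e ∈ treeEdges B ↔ e = d := fun B =>
      ⟨fun h => le_of_mem_treeEdges h (not_lt.1 he), fun h => Or.inl h⟩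
    simp [h1, h2, h3]

theorem Joins.sym2_eq {e : Fin d} {y : ℕ} (h : Joins n d (ends u) (ends v) e x y) :
    ∃ (hx : x < n) (hy : y < n), s(u e, v e) = s(⟨x, hx⟩, ⟨y, hy⟩) := by
  rcases h with ⟨-, hy, h⟩ | h
  · simp only [ends_coe] at h
    rcases h with ⟨rfl, rfl⟩ | ⟨rfl, rfl⟩
    · exact ⟨(u e).2, hy, rfl⟩
    · exact ⟨(v e).2, hy, Sym2.eq_swap⟩
  · exact absurd h.1 (not_le.2 e.2)

theorem joins_coe (e : Fin d) : Joins n d (ends u) (ends v) e (u e) (v e) :=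
  Or.inl ⟨e.2, (v e).2, Or.inl ⟨ends_coe u e, ends_coe v e⟩⟩

theorem IsForest.reachable (hl : ∀ i, u i ≠ v i) (hF : IsForest n d (ends u) (ends v) par pe E)
    (hE : ∀ e : Fin d, (e : ℕ) ∈ E → e ∈ B) {y : ℕ} (h : Above n par x y) (hx : x < n)
    (hy : y < n) : (edgeGraph u v B).Reachable ⟨x, hx⟩ ⟨y, hy⟩ := by
  induction h using Relation.ReflTransGen.head_induction_on with
  | refl => exact .refl _
  | @head a c hac hcy ih =>
    obtain ⟨ha, rfl⟩ := hac
    have hp : par a < n := by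
      rcases (hF.joins a ha).le.lt_or_eq with h | h
      · exact h
      · rw [h] at hcy
        exact absurd hcy (not_above_self hy)
    refine .trans ?_ (ih hp)
    have hj := hF.joins a ha
    have hd : pe a < d := by
      rcases hj with h | h <;> lia
    obtain ⟨_, _, e⟩ := Joins.sym2_eq (e := ⟨pe a, hd⟩) hj
    exact edgeGraph_reachable_of_eq hl (hE _ (hF.bij.mapsTo ha)) e

theorem IsForest.mem_spanningTrees (hI : Function.Injective fun i => s(u i, v i))
    (hl : ∀ i, u i ≠ v i) (hF : IsForest n d (ends u) (ends v) par pe (treeEdges B)) :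
    B ∈ spanningTrees u v := by
  obtain ⟨r, hr, hr'⟩ := hF.bij.surjOn (Or.inl rfl : d ∈ treeEdges B)
  have hroot : ∀ p : Fin n, (edgeGraph u v B).Reachable p ⟨r, hr⟩ := fun p => by
    obtain ⟨r', hr1, hab, hd⟩ := hF.exists_root p.2
    have : pe r' = pe r := by rw [hr', le_of_mem_treeEdges (hF.bij.mapsTo hr1) hd]
    obtain rfl := hF.bij.injOn hr1 hr this
    exact hF.reachable hl (fun e => coe_mem_treeEdges.1) hab p.2 hr
  have : Nonempty (Fin n) := ⟨⟨r, hr⟩⟩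
  refine (BudgetedMax.mem_spanningTrees hI hl).2
    ⟨⟨fun p q => (hroot p).trans (hroot q).symm⟩, ?_⟩
  have h1 := hF.bij.injOn.ncard_image
  rw [hF.bij.image_eq, treeEdges, Set.ncard_insert_of_notMem, Set.ncard_image_of_injective _
    Fin.val_injective, Set.ncard_coe_finset] at h1
  · rw [h1, ← Finset.coe_Iio, Set.ncard_coe_finset, Nat.card_Iio]
  · rintro ⟨i, -, h⟩
    exact i.2.ne h

/-- The edge above `x` can be exchanged for an edge from the subtree of `x` to the root only if it
is on the cycle closed by this edge: otherwise the new edge avoids the subtree of `x`. -/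
theorem IsForest.above_of_swap (hI : Function.Injective fun i => s(u i, v i))
    (hl : ∀ i, u i ≠ v i) (hF : IsForest n d (ends u) (ends v) par pe (treeEdges B))
    (hx : x < n) (hg : pe x = g) (hv : ¬ Above n par (v f) x)
    (hX : insert f (B.erase g) ∈ spanningTrees u v) : Above n par (u f) x := by
  by_contra hu
  obtain ⟨hc, -⟩ := (BudgetedMax.mem_spanningTrees hI hl).1 hX
  have key : ∀ p q, (edgeGraph u v (insert f (B.erase g))).Reachable p q →
      (Above n par p x ↔ Above n par q x) := by
    rintro p q ⟨W⟩
    induction W with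
    | nil => rfl
    | @cons p m q hadj _ ih =>
      rw [← ih]
      obtain ⟨i, hi, e⟩ := exists_of_edgeGraph_adj hadj
      rcases Finset.mem_insert.1 hi with rfl | hi
      · rcases Sym2.eq_iff.1 e with ⟨rfl, rfl⟩ | ⟨rfl, rfl⟩
        · exact iff_of_false hu hv
        · exact iff_of_false hv hu
      · obtain ⟨hig, hiB⟩ := Finset.mem_erase.1 hi
        obtain ⟨z, hz, hzi⟩ := hF.bij.surjOn (coe_mem_treeEdges.2 hiB)
        have hzx : z ≠ x := by
          rintro rfl
          exact hig (Fin.ext (hzi.symm.trans hg))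
        have hj := hF.joins z hz
        rw [hzi] at hj
        obtain ⟨_, hp, e'⟩ := hj.sym2_eq
        have hup : Above n par z x ↔ Above n par (par z) x :=
          ⟨fun h => (h.eq_or.resolve_left hzx).2, fun h => h.step hz⟩
        rcases Sym2.eq_iff.1 (e.symm.trans e') with ⟨rfl, rfl⟩ | ⟨rfl, rfl⟩
        · exact hup
        · exact hup.symm
  exact hv ((key ⟨x, hx⟩ (v f) (hc.preconnected _ _)).1 .refl)

/-- Conversely, the exchange is possible if the edge above `x` is on the cycle, since the path
can be reversed. -/
theorem StoresForest.swap_mem (hI : Function.Injective fun i => s(u i, v i))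
    (hl : ∀ i, u i ≠ v i) (hF : StoresForest n d (ends u) (ends v) (treeEdges B) σ)
    (hf : f ∉ B) (hx : x < n) (hg : σ.nat 22 x = g) (hv : ¬ Above n (σ.nat 21) (v f) x)
    (hu : Above n (σ.nat 21) (u f) x) : insert f (B.erase g) ∈ spanningTrees u v := by
  obtain ⟨-, τ, -, -, h, -⟩ := reversePath_spec (O := noOracle) (last := .const g)
    (σ := ((σ.writeNat 24 0 (u f)).writeNat 25 0 (v f)).writeNat 26 0 f) (x := x) (E := treeEdges B)
    (U := ends u) (V := ends v) (n := n) (d := d)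
    (by simpa [StoresForest] using hF) (by simp [Memory.writeNat_nat]) hx
    (by simpa [Memory.writeNat_nat] using hu) (by simpa [Memory.writeNat_nat] using hv)
    (by simpa [Memory.writeNat_nat] using joins_coe f)
    (by simpa [Memory.writeNat_nat, coe_mem_treeEdges] using hf)
    (fun τ _ => by simp [Memory.writeNat_nat, NatExpr.eval, hg])
  simp only [ne_eq, Nat.reduceEqDiff, not_false_eq_true, Memory.writeNat_nat_of_ne,
    Memory.writeNat_nat_same, hg, treeEdges_swap] at h
  exact IsForest.mem_spanningTrees hI hl h

/-- The memory holds the numbers of edges and of vertices and the ends of the edges. -/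
structure HasGraph (u v : Fin d → Fin n) (σ : Memory) : Prop where
  edges : σ.nat 0 0 = d
  vertices : σ.nat 0 1 = n
  left : σ.nat 1 = ends u
  right : σ.nat 2 = ends v

theorem HasGraph.congr (h : HasGraph u v σ) (h' : ∀ k ≤ 2, τ.nat k = σ.nat k) :
    HasGraph u v τ := by
  refine ⟨?_, ?_, ?_, ?_⟩
  · rw [h' 0 (by lia), h.edges]
  · rw [h' 0 (by lia), h.vertices]
  · rw [h' 1 (by lia), h.left]
  · rw [h' 2 (by lia), h.right]

/-- The tree is rooted at the vertex `w`: the edge `d` above the root is exchanged for an edge above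
`w`, which has the number `d + 1` until the path is reversed, as the numbers must be distinct. -/
def makeRoot (w : NatExpr) : Program :=
  .letNat 29 w ;; .letNat 24 (.var 29) ;; .letNat 25 (.cell 0 (.const 1)) ;;
  .letNat 26 (.add (.var 0) (.const 1)) ;; reversePath (.var 0) ;; .setNat 22 (.var 29) (.var 0)

theorem makeRoot_nat {e : NatExpr} {k : ℕ} :
    (makeRoot e).WritesNat k ↔ k = 21 ∨ k = 22 ∨ 24 ≤ k ∧ k ≤ 29 := by
  simp only [makeRoot, Program.WritesNat, reversePath_nat]
  lia

theorem makeRoot_real {e : NatExpr} {k : ℕ} : ¬ (makeRoot e).WritesReal k := by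
  simp [makeRoot, Program.WritesReal, reversePath_real]

theorem makeRoot_spec {e : NatExpr} (hG : HasGraph u v σ)
    (hF : StoresForest n d (ends u) (ends v) (treeEdges B) σ) (he : e.eval σ = w) (hw : w < n) :
    wp O (makeRoot e) (n * 8 + 8)
      (fun τ => StoresForest n d (ends u) (ends v) (treeEdges B) τ ∧ τ.nat 22 w = d) σ := by
  obtain ⟨x, hx, hwx, hd⟩ := hF.exists_root hw
  have hxd := le_of_mem_treeEdges (hF.bij.mapsTo hx) hd
  have hdE : d + 1 ∉ treeEdges B := fun h => absurd (le_of_mem_treeEdges h (by lia)) (by lia)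
  refine wp_setNat_seq (wp_setNat_seq (wp_setNat_seq (wp_setNat_seq (T := n * 8 + 3 + 1)
    (wp_seq (reversePath_spec (n := n) (d := d) (U := ends u) (V := ends v) (E := treeEdges B)
      (x := x) ?_ ?_ hx ?_ ?_ ?_ ?_ ?_) fun τ hA ⟨hτ, hτ'⟩ => wp_setNat ?_))))
  all_goals simp only [NatExpr.eval, he, ne_eq, Nat.reduceEqDiff, not_false_eq_true,
    Memory.writeNat_nat_of_ne, Memory.writeNat_nat_same, hG.edges, hG.vertices] at *
  · exact hF.congr (fun _ _ => by simp) (fun _ _ => by simp)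
  · exact hw
  · exact hwx
  · exact not_above_self hx
  · exact Or.inr ⟨by lia, rfl⟩
  · exact hdE
  · intro τ hA
    rw [hA.nat 0 (by simp [reversePath_nat])]
    simp [hG.edges, hxd]
  · have h29 : τ.nat 29 0 = w := by
      rw [hA.nat 29 (by simp [reversePath_nat])]
      simp
    have h0 : τ.nat 0 0 = d := by
      rw [hA.nat 0 (by simp [reversePath_nat])]
      simpa using hG.edges
    rw [h29, h0]
    simp only [Memory.writeNat_nat_same, and_true]
    have hpar : τ.nat 21 w = n := by
      rcases hτ.joins w hw with h | h <;> lia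
    have := hτ.reparent (z := n) (e := d) hw (not_above_self hw) (Or.inr ⟨le_rfl, rfl⟩) (by
      rintro ⟨h | h, -⟩
      · lia
      · exact h.2 hxd.symm)
    rw [Function.update_eq_self_iff.2 hpar.symm, hτ', hxd] at this
    have e1 : insert d (insert (d + 1) (treeEdges B \ {d}) \ {d + 1}) = treeEdges B := by
      have h1 : d ∈ treeEdges B := Or.inl rfl
      rw [Set.insert_sdiff_of_mem _ (Set.mem_singleton _), Set.sdiff_singleton_eq_self fun h => hdE h.1,
        Set.insert_sdiff_singleton, Set.insert_eq_of_mem h1]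
    rw [e1] at this
    exact this.congr (fun _ _ => by simp) (fun _ _ => by simp [Memory.writeNat_nat_self])

/-- Among the unmarked edges on the way from the vertex in the variable `24` to the root, a lightest
one is put into the variable `7`. -/
def lightestAbove : Program :=
  .letNat 7 (.var 0) ;;
  .loop (.natLT (.cell 22 (.var 24)) (.var 0))
    (.cond (.and (.isZero (.cell 8 (.cell 22 (.var 24))))
        (.not (.and (.natLT (.var 7) (.var 0))
          (.realLE (.cell 3 (.var 7)) (.cell 3 (.cell 22 (.var 24)))))))
      (.letNat 7 (.cell 22 (.var 24))) .skip ;;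
    .letNat 24 (.cell 21 (.var 24)))

theorem lightestAbove_nat {k : ℕ} : lightestAbove.WritesNat k ↔ k = 7 ∨ k = 24 := by
  simp only [lightestAbove, Program.WritesNat]
  lia

theorem lightestAbove_real {k : ℕ} : ¬ lightestAbove.WritesReal k := by
  simp [lightestAbove, Program.WritesReal]

theorem lightestAbove_spec {U V : ℕ → ℕ} (h0 : σ.nat 0 0 = d) (hF : StoresForest n d U V E σ)
    (hw : σ.nat 24 0 = w) (hwn : w < n) :
    wp O lightestAbove (n * 4 + 2) (fun τ =>
      (d ≤ τ.nat 7 0 → ∀ z < n, Above n (σ.nat 21) w z → σ.nat 22 z < d →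
        σ.nat 8 (σ.nat 22 z) ≠ 0) ∧
      (τ.nat 7 0 < d → ∃ z < n, Above n (σ.nat 21) w z ∧ σ.nat 22 z = τ.nat 7 0 ∧
        σ.nat 8 (τ.nat 7 0) = 0 ∧ ∀ y < n, Above n (σ.nat 21) w y → σ.nat 22 y < d →
          σ.nat 8 (σ.nat 22 y) = 0 → σ.real 3 (τ.nat 7 0) ≤ σ.real 3 (σ.nat 22 y))) σ := by
  obtain ⟨h, hh, hhn⟩ := hF.exists_rank
  refine wp_setNat_seq (wp_loop (c := 3) (n := n) (fun k τ => h (τ.nat 24 0) ≤ k ∧ τ.nat 24 0 < n ∧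
    Above n (σ.nat 21) w (τ.nat 24 0) ∧
    (d ≤ τ.nat 7 0 → ∀ z < n, Above n (σ.nat 21) w z → Above n (σ.nat 21) (τ.nat 24 0) z ∨
        σ.nat 8 (σ.nat 22 z) ≠ 0) ∧
    (τ.nat 7 0 < d → ∃ z < n, Above n (σ.nat 21) w z ∧ σ.nat 22 z = τ.nat 7 0 ∧
      σ.nat 8 (τ.nat 7 0) = 0 ∧ ∀ y < n, Above n (σ.nat 21) w y →
        Above n (σ.nat 21) (τ.nat 24 0) y ∨ (σ.nat 8 (σ.nat 22 y) = 0 →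
          σ.real 3 (τ.nat 7 0) ≤ σ.real 3 (σ.nat 22 y)))) ?_ ?_ ?_)
  · have e24 : (σ.writeNat 7 ((NatExpr.const 0).eval σ) ((NatExpr.var 0).eval σ)).nat 24 0 = w := by
      simpa using hw
    have e7 : (σ.writeNat 7 ((NatExpr.const 0).eval σ) ((NatExpr.var 0).eval σ)).nat 7 0 = d := by
      simpa [NatExpr.eval] using h0
    rw [e24, e7]
    exact ⟨hhn _, hwn, .refl, fun _ z _ hz => Or.inl hz, fun h => absurd h (lt_irrefl d)⟩
  all_goals
    rintro k τ hA ⟨hk, hlt, hab, hI1, hI2⟩ hp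
    have n0 : τ.nat 0 = σ.nat 0 := by
      rw [hA.nat 0 (by simp [Program.WritesNat])]; simp
    have n8 : τ.nat 8 = σ.nat 8 := by
      rw [hA.nat 8 (by simp [Program.WritesNat])]; simp
    have n21 : τ.nat 21 = σ.nat 21 := by
      rw [hA.nat 21 (by simp [Program.WritesNat])]; simp
    have n22 : τ.nat 22 = σ.nat 22 := by
      rw [hA.nat 22 (by simp [Program.WritesNat])]; simp
    have r3 : τ.real 3 = σ.real 3 := by
      rw [hA.real 3 (by simp [Program.WritesReal])]; rfl
    simp only [Test.Holds, NatExpr.eval, n0, n22, h0] at hp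
  · rw [not_le] at hp
    set c := τ.nat 24 0 with hc
    have hpn : σ.nat 21 c < n := by
      rcases hF.joins c hlt with h | h <;> lia
    have hup := hh c hlt
    have hsplit : ∀ {z}, Above n (σ.nat 21) c z → z = c ∨ Above n (σ.nat 21) (σ.nat 21 c) z :=
      fun hz => hz.eq_or.imp Eq.symm And.right
    refine wp_seq (T := 2) (T' := 1) (Q := fun ρ => ρ.nat 24 0 = c ∧
      (d ≤ ρ.nat 7 0 → ∀ z < n, Above n (σ.nat 21) w z →
        Above n (σ.nat 21) (σ.nat 21 c) z ∨ σ.nat 8 (σ.nat 22 z) ≠ 0) ∧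
      (ρ.nat 7 0 < d → ∃ z < n, Above n (σ.nat 21) w z ∧ σ.nat 22 z = ρ.nat 7 0 ∧
        σ.nat 8 (ρ.nat 7 0) = 0 ∧ ∀ y < n, Above n (σ.nat 21) w y →
          Above n (σ.nat 21) (σ.nat 21 c) y ∨ (σ.nat 8 (σ.nat 22 y) = 0 →
            σ.real 3 (ρ.nat 7 0) ≤ σ.real 3 (σ.nat 22 y))))
      (wp_cond (T := 1) (fun ht => wp_setNat ?_) (fun ht => wp_skip ?_))
      fun ρ hAρ ⟨h24, hρ1, hρ2⟩ => wp_setNat ?_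
    · simp only [Test.Holds, NatExpr.eval, RealExpr.eval, n0, n8, n22, r3, h0, ← hc,
        Nat.le_zero] at ht
      simp only [NatExpr.eval, n22, ← hc, Memory.writeNat_nat_same]
      refine ⟨by simp [hc], fun h => absurd hp (not_lt.2 h), fun _ => ⟨c, hlt, hab, rfl, ht.1,
        fun y hy hwy => ?_⟩⟩
      rcases Nat.lt_or_ge (τ.nat 7 0) d with h7 | h7
      · obtain ⟨z, -, -, -, -, hz⟩ := hI2 h7
        rcases hz y hy hwy with h1 | h1
        · rcases hsplit h1 with rfl | h1
          · exact Or.inr fun _ => le_rfl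
          · exact Or.inl h1
        · refine Or.inr fun h2 => le_trans ?_ (h1 h2)
          exact (not_le.1 fun h3 => ht.2 ⟨by lia, h3⟩).le
      · rcases hI1 h7 y hy hwy with h1 | h1
        · rcases hsplit h1 with rfl | h1
          · exact Or.inr fun _ => le_rfl
          · exact Or.inl h1
        · exact Or.inr fun h2 => absurd h2 h1
    · simp only [Test.Holds, NatExpr.eval, RealExpr.eval, n0, n8, n22, r3, h0, ← hc,
        Nat.le_zero] at ht
      refine ⟨rfl, fun h7 z hz hwz => ?_, fun h7 => ?_⟩
      · rcases hI1 h7 z hz hwz with h1 | h1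
        · rcases hsplit h1 with rfl | h1
          · exact Or.inr fun h2 => ht ⟨h2, fun h3 => absurd h3.1 (by lia)⟩
          · exact Or.inl h1
        · exact Or.inr h1
      · obtain ⟨z, hz1, hz2, hz3, hz4, hz5⟩ := hI2 h7
        refine ⟨z, hz1, hz2, hz3, hz4, fun y hy hwy => ?_⟩
        rcases hz5 y hy hwy with h1 | h1
        · rcases hsplit h1 with rfl | h1
          · refine Or.inr fun h2 => ?_
            by_contra h4
            exact ht ⟨h2, fun h3 => h4 h3.2⟩
          · exact Or.inl h1
        · exact Or.inr h1
    · have ρ21 : ρ.nat 21 = σ.nat 21 := by rw [hAρ.nat 21 (by simp [Program.WritesNat]), n21]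
      simp only [NatExpr.eval, h24, ρ21, Memory.writeNat_nat_same]
      exact ⟨_, lt_of_lt_of_le hup hk, le_rfl, hpn, hab.tail ⟨hlt, rfl⟩, hρ1, hρ2⟩
  · rw [not_not] at hp
    have hroot : ∀ z < n, Above n (σ.nat 21) (τ.nat 24 0) z → σ.nat 22 z < d → False :=
      fun z hz h1 h2 => by
        have h3 : n ≤ σ.nat 21 (τ.nat 24 0) := by
          rcases hF.joins _ hlt with h | h <;> lia
        rw [h1.of_root h3 hz] at hp
        lia
    refine ⟨fun h7 z hz hwz hzd => (hI1 h7 z hz hwz).resolve_left fun h => hroot z hz h hzd,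
      fun h7 => ?_⟩
    obtain ⟨z, hz1, hz2, hz3, hz4, hz5⟩ := hI2 h7
    exact ⟨z, hz1, hz2, hz3, hz4, fun y hy hwy hyd =>
      (hz5 y hy hwy).resolve_left fun h => hroot y hy h hyd⟩

/-- The tree is rooted at one end of the new edge; the edges that can be removed are those above
the other end. -/
def graphBestOut : Program :=
  makeRoot (.cell 2 (.var 6)) ;; .letNat 24 (.cell 1 (.var 6)) ;; lightestAbove

/-- The exchange of two edges. -/
def graphExchange : Program :=
  makeRoot (.cell 2 (.var 6)) ;; .letNat 24 (.cell 1 (.var 6)) ;; .letNat 25 (.cell 2 (.var 6)) ;;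
  .letNat 26 (.var 6) ;; reversePath (.var 7) ;;
  .setNat 5 (.var 7) (.const 0) ;; .setNat 5 (.var 6) (.const 1)

/-- The memory holds the graph and the spanning tree `B`, as a set of edges and as a rooted tree. -/
structure HasTree (u v : Fin d → Fin n) (σ : Memory) (B : Finset (Fin d)) : Prop where
  graph : HasGraph u v σ
  held_eq : held d 5 σ = B
  forest : StoresForest n d (ends u) (ends v) (treeEdges B) σ

theorem not_above_root {r : ℕ} (hF : StoresForest n d (ends u) (ends v) E σ)
    (hr : r < n) (hd : d ≤ σ.nat 22 r) (hx : x < n) (hxd : σ.nat 22 x < d) :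
    ¬ Above n (σ.nat 21) r x := fun h => by
  have : n ≤ σ.nat 21 r := by
    rcases hF.joins r hr with h | h <;> lia
  rw [h.of_root this hx] at hd
  lia

theorem graph_engine (hI : Function.Injective fun i => s(u i, v i)) (hl : ∀ i, u i ≠ v i) :
    Engine (spanningTrees u v) O graphBestOut graphExchange (16 * (n + 1)) (HasTree u v) where
  mem h := h.forest.mem_spanningTrees hI hl
  held_eq h := h.held_eq
  congr h hR := ⟨hR.graph.congr fun k hk => h k (by lia),
    (held_of_nat_eq (h 5 (by lia))).trans hR.held_eq, by
      simpa only [StoresForest, h 21 (by lia), h 22 (by lia)] using hR.forest⟩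
  bo_nat h := by
    simp only [graphBestOut, Program.WritesNat, makeRoot_nat, lightestAbove_nat] at h
    lia
  ex_nat h := by
    simp only [graphExchange, Program.WritesNat, makeRoot_nat, reversePath_nat] at h
    lia
  bo_real := by simp [graphBestOut, Program.WritesReal, makeRoot_real, lightestAbove_real]
  ex_real := by simp [graphExchange, Program.WritesReal, makeRoot_real, reversePath_real]
  bo_spec {σ B f} hd hR h6 hf := by
    refine wp.weaken (wp_seq (makeRoot_spec (w := v f) hR.graph hR.forest ?_ (v f).2)
      fun τ1 hA1 ⟨hF1, h1⟩ => wp_setNat_seq (wp.imp (lightestAbove_spec (n := n) (d := d)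
        (U := ends u) (V := ends v) (E := treeEdges B) (w := u f) ?_ ?_ ?_ (u f).2)
        fun τ2 hA2 h2 => ?_)) (T := n * 8 + 8 + ((n * 4 + 2) + 1)) (by lia)
    · simp [NatExpr.eval, h6, hR.graph.right]
    all_goals
      have n1 : ∀ k, ¬ (k = 21 ∨ k = 22 ∨ 24 ≤ k ∧ k ≤ 29) → τ1.nat k = σ.nat k := fun k hk =>
        hA1.nat k fun h => hk (makeRoot_nat.1 h)
      have r1 : τ1.real 3 = σ.real 3 := hA1.real 3 makeRoot_real
      simp only [NatExpr.eval, ne_eq, Nat.reduceEqDiff, not_false_eq_true,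
        Memory.writeNat_nat_of_ne, Memory.writeNat_nat_same, Memory.writeNat_real,
        n1 0 (by lia), n1 1 (by lia), n1 6 (by lia), n1 8 (by lia), h6, hR.graph.left, ends_coe,
        hR.graph.edges, r1] at *
    · exact hF1.congr (fun _ _ => by simp) (fun _ _ => by simp)
    · have n2 : ∀ k, ¬ (k = 7 ∨ k = 24) → τ2.nat k = τ1.nat k := fun k hk => by
        rw [hA2.nat k fun h => hk (lightestAbove_nat.1 h), Memory.writeNat_nat_of_ne _ _ _ (by lia)]
      have hv : ∀ x < n, τ1.nat 22 x < d → ¬ Above n (τ1.nat 21) (v f) x := fun x hx hxd =>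
        not_above_root hF1 (v f).2 h1.ge hx hxd
      have hcand : ∀ g ∈ B, insert f (B.erase g) ∈ spanningTrees u v →
          ∃ z < n, τ1.nat 22 z = g ∧ Above n (τ1.nat 21) (u f) z := fun g hg hX => by
        obtain ⟨z, hz, hzg⟩ := hF1.bij.surjOn (coe_mem_treeEdges.2 hg)
        exact ⟨z, hz, hzg, hF1.above_of_swap hI hl hz hzg (hv z hz (hzg ▸ g.2)) hX⟩
      refine ⟨⟨hR.graph.congr fun k hk => ?_, ?_, ?_⟩, ?_, ?_⟩
      · rw [n2 k (by lia), n1 k (by lia)]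
      · rw [held_of_nat_eq (σ := σ) (by rw [n2 5 (by lia), n1 5 (by lia)]), hR.held_eq]
      · exact hF1.congr (fun _ _ => by rw [n2 21 (by lia)]) (fun _ _ => by rw [n2 22 (by lia)])
      · intro h7 g hg hg8 hX
        obtain ⟨z, hz, hzg, hab⟩ := hcand g hg hX
        have := h2.1 h7 z hz hab (hzg ▸ g.2)
        rw [hzg] at this
        exact hg8 (mem_held.2 this)
      · intro g hg
        rw [hg] at h2
        obtain ⟨z, hz, hab, hzg, h8, hmin⟩ := h2.2 g.2
        have hgB : g ∈ B := coe_mem_treeEdges.1 (hzg ▸ hF1.bij.mapsTo hz)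
        refine ⟨hgB, fun h => mem_held.1 h h8, hF1.swap_mem hI hl hf hz hzg
          (hv z hz (hzg ▸ g.2)) hab, fun g' hg' hg8' hX' => ?_⟩
        obtain ⟨y, hy, hyg, haby⟩ := hcand g' hg' hX'
        have := hmin y hy haby (hyg ▸ g'.2)
        rw [hyg] at this
        exact this (not_not.1 fun h => hg8' (mem_held.2 h))
  ex_spec {σ B f g} hd hR h6 h7 hf hg hX := by
    refine wp.weaken (wp_seq (makeRoot_spec (w := v f) hR.graph hR.forest ?_ (v f).2)
      fun τ1 hA1 ⟨hF1, h1⟩ => ?_) (T := n * 8 + 8 + ((n * 8 + 3 + (1 + 1)) + 1 + 1 + 1)) (by lia)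
    · simp [NatExpr.eval, h6, hR.graph.right]
    have n1 : ∀ k, ¬ (k = 21 ∨ k = 22 ∨ 24 ≤ k ∧ k ≤ 29) → τ1.nat k = σ.nat k := fun k hk =>
      hA1.nat k fun h => hk (makeRoot_nat.1 h)
    obtain ⟨x, hx, hxg⟩ := hF1.bij.surjOn (coe_mem_treeEdges.2 hg)
    have hvx := not_above_root hF1 (v f).2 h1.ge hx (hxg ▸ g.2)
    have hux := hF1.above_of_swap hI hl hx hxg hvx hX
    refine wp_setNat_seq (T := n * 8 + 3 + (1 + 1) + 1 + 1)
      (wp_setNat_seq (T := n * 8 + 3 + (1 + 1) + 1) (wp_setNat_seq (T := n * 8 + 3 + (1 + 1))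
      (wp_seq (reversePath_spec (n := n) (d := d) (U := ends u) (V := ends v) (E := treeEdges B) (x := x) ?_ ?_ hx ?_ ?_ ?_ ?_ ?_)
      fun τ2 hA2 ⟨hF2, _⟩ => wp_setNat_seq (wp_setNat ?_))))
    all_goals simp only [NatExpr.eval, ne_eq, Nat.reduceEqDiff, not_false_eq_true,
        Memory.writeNat_nat_of_ne, Memory.writeNat_nat_same, n1 1 (by lia), n1 2 (by lia),
        n1 6 (by lia), h6, hR.graph.left, hR.graph.right, ends_coe]
    · exact hF1.congr (fun _ _ => by simp) (fun _ _ => by simp)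
    · exact (u f).2
    · exact hux
    · exact hvx
    · exact joins_coe f
    · rwa [coe_mem_treeEdges]
    · intro τ hA
      rw [hA.nat 7 (by simp [reversePath_nat])]
      simp [n1 7 (by lia), h7, hxg]
    · have n2 : ∀ k, ¬ (k = 21 ∨ k = 22 ∨ 24 ≤ k ∧ k ≤ 29) → τ2.nat k = σ.nat k := fun k hk => by
        rw [hA2.nat k fun h => by have := reversePath_nat.1 h; lia,
          Memory.writeNat_nat_of_ne _ _ _ (by lia), Memory.writeNat_nat_of_ne _ _ _ (by lia),
          Memory.writeNat_nat_of_ne _ _ _ (by lia), n1 k hk]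
      simp only [NatExpr.eval, ne_eq, Nat.reduceEqDiff, not_false_eq_true,
        Memory.writeNat_nat_of_ne, Memory.writeNat_nat_same, n1 6 (by lia), h6, hxg,
        treeEdges_swap] at hF2
      rw [n2 7 (by lia), n2 6 (by lia), h6, h7]
      refine ⟨hR.graph.congr fun k hk => ?_, ?_, ?_⟩
      · rw [Memory.writeNat_nat_of_ne _ _ _ (by lia), Memory.writeNat_nat_of_ne _ _ _ (by lia),
          n2 k (by lia)]
      · rw [held_writeNat_one, held_writeNat_zero, held_of_nat_eq (σ := σ) (n2 5 (by lia)),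
          hR.held_eq]
      · exact hF2.congr (fun _ _ => by simp) (fun _ _ => by simp)

end Tree

end BudgetedMax

namespace BudgetedMax

open RealRAM

/-! ### The construction of a spanning tree -/

section Build

variable {n d : ℕ} {u v : Fin d → Fin n} {O : Set ℕ → Prop} {par pe : ℕ → ℕ} {E : Set ℕ}
  {B : Finset (Fin d)} {w x : ℕ} {σ τ : Memory}

/-- The forest without edges of the graph: each vertex `x` is a root, with the edge `d + x` above
it. -/
def emptyForest : Program :=
  .forLoop 32 (.cell 0 (.const 1))
    (.setNat 21 (.var 32) (.cell 0 (.const 1)) ;; .setNat 22 (.var 32) (.add (.var 0) (.var 32)))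

theorem emptyForest_nat {k : ℕ} : emptyForest.WritesNat k ↔ k = 21 ∨ k = 22 ∨ k = 32 := by
  simp only [emptyForest, Program.forLoop, Program.WritesNat]
  lia

theorem emptyForest_real {k : ℕ} : ¬ emptyForest.WritesReal k := by
  simp [emptyForest, Program.forLoop, Program.WritesReal]

theorem emptyForest_spec {U V : ℕ → ℕ} (h0 : σ.nat 0 0 = d) (h1 : σ.nat 0 1 = n) :
    wp O emptyForest (n * 4 + 2) (StoresForest n d U V (Set.Ico d (d + n))) σ := by
  refine (wp_forLoop (N := n) (c := 2)
    (fun i τ => ∀ j < i, τ.nat 21 j = n ∧ τ.nat 22 j = d + j) ?_ ?_ ?_ ?_).imp ?_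
  · simp [Program.WritesNat]
  · intro τ hA
    simp only [NatExpr.eval]
    rw [hA.nat 0 (by simp [Program.forLoop, Program.WritesNat]), h1]
  · simp
  · intro i τ hi hA hiv hI
    have n0 : τ.nat 0 = σ.nat 0 := hA.nat 0 (by simp [Program.forLoop, Program.WritesNat])
    refine wp_setNat_seq (wp_setNat fun j hj => ?_)
    by_cases e : j = i
    · subst e
      simp [Memory.writeNat_nat, NatExpr.eval, hiv, n0, h0, h1]
    · have := hI j (by lia)
      simpa [Memory.writeNat_nat, NatExpr.eval, hiv, e] using this
  · intro τ _ h
    refine ⟨fun x hx => Or.inr ⟨?_, (h x hx).1⟩, ⟨fun x => if x < n then 1 else 0, fun x hx => ?_⟩,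
      ?_, ?_, ?_⟩
    · rw [(h x hx).2]; lia
    · simp [(h x hx).1, hx]
    · intro x hx
      rw [(h x hx).2]
      simp only [Set.mem_Iio] at hx
      simp only [Set.mem_Ico]
      lia
    · intro x hx y hy e
      rw [(h x hx).2, (h y hy).2] at e
      lia
    · intro e he
      simp only [Set.mem_Ico] at he
      refine ⟨e - d, by simp only [Set.mem_Iio]; lia, ?_⟩
      rw [(h _ (by lia)).2]
      lia

/-- The edge in the variable `32` is added to the forest if its ends are in different trees. -/
def addEdge : Program :=
  .letNat 24 (.cell 1 (.var 32)) ;; findRoot ;; .letNat 33 (.var 24) ;;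
  .letNat 24 (.cell 2 (.var 32)) ;; findRoot ;;
  .cond (.and (.natLE (.var 33) (.var 24)) (.natLE (.var 24) (.var 33))) .skip
    (.letNat 7 (.cell 22 (.var 24)) ;; .letNat 24 (.cell 2 (.var 32)) ;;
      .letNat 25 (.cell 1 (.var 32)) ;; .letNat 26 (.var 32) ;; reversePath (.var 7) ;;
      .setNat 5 (.var 32) (.const 1) ;; .letNat 31 (.add (.var 31) (.const 1)))

theorem addEdge_nat {k : ℕ} : addEdge.WritesNat k ↔
    k = 5 ∨ k = 7 ∨ k = 21 ∨ k = 22 ∨ 24 ≤ k ∧ k ≤ 28 ∨ k = 31 ∨ k = 33 := by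
  simp only [addEdge, Program.WritesNat, findRoot_nat, reversePath_nat]
  lia

theorem addEdge_real {k : ℕ} : ¬ addEdge.WritesReal k := by
  simp [addEdge, Program.WritesReal, findRoot_real, reversePath_real]

/-- The memory holds a forest in the graph, as a set `B` of edges and with parent pointers, and the
number of its edges. -/
structure HasForest (u v : Fin d → Fin n) (B : Finset (Fin d)) (σ : Memory) : Prop where
  graph : HasGraph u v σ
  held_eq : held d 5 σ = B
  card : σ.nat 31 0 = B.card
  forest : ∃ E, StoresForest n d (ends u) (ends v) E σ ∧ ∀ e : Fin d, (e : ℕ) ∈ E ↔ e ∈ B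

theorem HasForest.congr (h : HasForest u v B σ)
    (h' : ∀ k, k ≤ 2 ∨ k = 5 ∨ k = 21 ∨ k = 22 ∨ k = 31 → τ.nat k = σ.nat k) :
    HasForest u v B τ := by
  refine ⟨h.graph.congr fun k hk => h' k (by lia), ?_, ?_, ?_⟩
  · rw [held_of_nat_eq (h' 5 (by lia)), h.held_eq]
  · rw [h' 31 (by lia), h.card]
  · simpa only [StoresForest, h' 21 (by lia), h' 22 (by lia)] using h.forest

theorem addEdge_spec (hl : ∀ i, u i ≠ v i) {f : Fin d} (hF : HasForest u v B σ)
    (hf : σ.nat 32 0 = f) (hfB : f ∉ B) :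
    wp O addEdge (n * 12 + 15) (fun τ => ∃ B', B ⊆ B' ∧ B' ⊆ insert f B ∧ HasForest u v B' τ ∧
      (edgeGraph u v B').Reachable (u f) (v f)) σ := by
  obtain ⟨hG, h5, h31, E, hFE, hEB⟩ := hF
  refine wp.weaken (wp_setNat_seq (wp_seq (findRoot_spec (n := n) (d := d) (U := ends u)
    (V := ends v) (E := E) ?_ ?_ ?_) fun τ1 hA1 ⟨hr1, hd1, hab1⟩ => wp_setNat_seq (wp_setNat_seq
    (wp_seq (findRoot_spec (n := n) (d := d) (U := ends u) (V := ends v) (E := E) ?_ ?_ ?_)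
      fun τ2 hA2 ⟨hr2, hd2, hab2⟩ => wp_cond (T := n * 8 + 9) (fun hp => ?_) (fun hp => ?_)))))
    (T := n * 2 + 1 + (n * 2 + 1 + (n * 8 + 9 + 1) + 1 + 1) + 1) (by lia)
  all_goals try simp only [NatExpr.eval, ne_eq, Nat.reduceEqDiff, not_false_eq_true,
    Memory.writeNat_nat_of_ne, Memory.writeNat_nat_same, hf, hG.left, ends_coe]
  · simpa using hG.edges
  · exact hFE.congr (fun _ _ => by simp) (fun _ _ => by simp)
  · exact (u f).2
  all_goals
    have n1 : ∀ k, k ≠ 24 → τ1.nat k = σ.nat k := fun k hk => by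
      rw [hA1.nat k fun h => hk (findRoot_nat.1 h), Memory.writeNat_nat_of_ne _ _ _ hk]
  · simpa [n1 0 (by lia)] using hG.edges
  · exact hFE.congr (fun _ _ => by simp [n1 21 (by lia)]) (fun _ _ => by simp [n1 22 (by lia)])
  · simp only [n1 32 (by lia), n1 2 (by lia), hf, hG.right, ends_coe]
    exact (v f).2
  all_goals
    have n2 : ∀ k, k ≠ 24 → k ≠ 33 → τ2.nat k = σ.nat k := fun k hk hk' => by
      rw [hA2.nat k fun h => hk (findRoot_nat.1 h), Memory.writeNat_nat_of_ne _ _ _ hk,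
        Memory.writeNat_nat_of_ne _ _ _ hk', n1 k hk]
    have h33 : τ2.nat 33 0 = τ1.nat 24 0 := by
      rw [hA2.nat 33 fun h => by have := findRoot_nat.1 h; lia]
      simp [NatExpr.eval]
    simp only [NatExpr.eval, ne_eq, Nat.reduceEqDiff, not_false_eq_true,
      Memory.writeNat_nat_of_ne, Memory.writeNat_nat_same, hf, hG.left, hG.right, ends_coe,
      n1 32 (by lia), n1 2 (by lia), n1 21 (by lia), n1 22 (by lia)] at hab1 hab2 hd1 hd2
    simp only [Test.Holds, NatExpr.eval, h33] at hp
  · have e : τ1.nat 24 0 = τ2.nat 24 0 := hp.1.antisymm hp.2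
    refine wp.weaken (wp_skip ⟨B, subset_rfl, Finset.subset_insert _ _, ?_, ?_⟩) (by lia)
    · exact HasForest.congr ⟨hG, h5, h31, E, hFE, hEB⟩ fun k hk => n2 k (by lia) (by lia)
    · rw [e] at hab1
      have h1 := hFE.reachable hl (fun e => (hEB e).1) hab1 (u f).2 hr2
      have h2 := hFE.reachable hl (fun e => (hEB e).1) hab2 (v f).2 hr2
      exact h1.trans h2.symm
  · have hne : τ2.nat 24 0 ≠ τ1.nat 24 0 := fun e => hp ⟨e.ge, e.le⟩
    have hnab : ¬ Above n (σ.nat 21) (u f) (τ2.nat 24 0) := fun hab => by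
      have hroot : ∀ r < n, d ≤ σ.nat 22 r → n ≤ σ.nat 21 r := fun r hr hd => by
        rcases hFE.joins r hr with h | h <;> lia
      rcases Relation.ReflTransGen.total_of_right_unique
        (fun a b c hb hc => hb.2.trans hc.2.symm) hab hab1 with h | h
      · exact hne (Above.of_root h (hroot _ hr2 hd2) hr1)
      · exact hne (Above.of_root h (hroot _ hr1 hd1) hr2).symm
    refine wp_setNat_seq (T := n * 8 + 3 + (1 + 1) + 1 + 1 + 1)
      (wp_setNat_seq (T := n * 8 + 3 + (1 + 1) + 1 + 1) (wp_setNat_seq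
      (T := n * 8 + 3 + (1 + 1) + 1) (wp_setNat_seq (T := n * 8 + 3 + (1 + 1))
      (wp_seq (reversePath_spec (n := n) (d := d) (U := ends u) (V := ends v) (E := E)
      (x := τ2.nat 24 0) ?_ ?_ ?_ ?_ ?_ ?_ ?_ ?_)
      fun τ3 hA3 ⟨hF3, _⟩ => wp_setNat_seq (wp_setNat ?_)))))
    all_goals try simp only [NatExpr.eval, ne_eq, Nat.reduceEqDiff, not_false_eq_true,
      Memory.writeNat_nat_of_ne, Memory.writeNat_nat_same, n2 1 (by lia) (by lia),
      n2 2 (by lia) (by lia), n2 21 (by lia) (by lia), n2 22 (by lia) (by lia),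
      n2 32 (by lia) (by lia), hf, hG.left, hG.right, ends_coe]
    · exact hFE.congr (fun _ _ => by simp [n2 21 (by lia) (by lia)])
        (fun _ _ => by simp [n2 22 (by lia) (by lia)])
    · exact (v f).2
    · exact hr2
    · exact hab2
    · exact hnab
    · exact (joins_coe f).symm (u f).2 (v f).2
    · rwa [hEB]
    · intro τ hA
      rw [hA.nat 7 (by simp [reversePath_nat])]
      simp
    · simp only [NatExpr.eval, ne_eq, Nat.reduceEqDiff, not_false_eq_true,
        Memory.writeNat_nat_of_ne, Memory.writeNat_nat_same, n2 22 (by lia) (by lia),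
        n2 32 (by lia) (by lia), hf] at hF3
      have n3 : ∀ k, ¬ (k = 7 ∨ k = 21 ∨ k = 22 ∨ k = 33 ∨ 24 ≤ k ∧ k ≤ 28) →
          τ3.nat k = σ.nat k := fun k hk => by
        rw [hA3.nat k fun h => by have := reversePath_nat.1 h; lia,
          Memory.writeNat_nat_of_ne _ _ _ (by lia), Memory.writeNat_nat_of_ne _ _ _ (by lia),
          Memory.writeNat_nat_of_ne _ _ _ (by lia), Memory.writeNat_nat_of_ne _ _ _ (by lia),
          n2 k (by lia) (by lia)]
      rw [n3 32 (by lia), hf, n3 31 (by lia), h31]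
      refine ⟨insert f B, Finset.subset_insert _ _, subset_rfl, ⟨hG.congr fun k hk => ?_, ?_, ?_,
        _, hF3.congr (fun _ _ => by simp) (fun _ _ => by simp), fun e => ?_⟩,
        (edgeGraph_adj hl (Finset.mem_insert_self _ _)).reachable⟩
      · rw [Memory.writeNat_nat_of_ne _ _ _ (by lia), Memory.writeNat_nat_of_ne _ _ _ (by lia),
          n3 k (by lia)]
      · rw [held_of_nat_eq (Memory.writeNat_nat_of_ne _ _ _ (by lia)), held_writeNat_one,
          held_of_nat_eq (σ := σ) (n3 5 (by lia)), h5]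
      · rw [Memory.writeNat_nat_same, Finset.card_insert_of_notMem hfB]
      · have : (e : ℕ) ≠ σ.nat 22 (τ2.nat 24 0) := fun h => absurd hd2 (by rw [← h]; lia)
        simp [this, hEB, Fin.ext_iff]

end Build

end BudgetedMax

namespace BudgetedMax

open RealRAM

section Graph

variable {n d : ℕ} {u v : Fin d → Fin n} {O : Set ℕ → Prop} {a b : Fin d → ℝ} {s : ℝ}
  {B : Finset (Fin d)} {σ τ : Memory}

/-- A maximal forest is built by adding all edges in turn. -/
def buildForest : Program := emptyForest ;; .forLoop 32 (.var 0) addEdge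

theorem buildForest_nat {k : ℕ} : buildForest.WritesNat k ↔
    k = 5 ∨ k = 7 ∨ k = 21 ∨ k = 22 ∨ 24 ≤ k ∧ k ≤ 28 ∨ 31 ≤ k ∧ k ≤ 33 := by
  simp only [buildForest, Program.forLoop, Program.WritesNat, emptyForest_nat, addEdge_nat]
  lia

theorem buildForest_real {k : ℕ} : ¬ buildForest.WritesReal k := by
  simp [buildForest, Program.forLoop, Program.WritesReal, emptyForest_real, addEdge_real]

theorem buildForest_spec (hl : ∀ i, u i ≠ v i) (hG : HasGraph u v σ) (h5 : held d 5 σ = ∅)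
    (h31 : σ.nat 31 0 = 0) :
    wp O buildForest ((n * 4 + 2) + (d * (n * 12 + 15 + 2) + 2))
      (fun τ => ∃ B, HasForest u v B τ ∧ ∀ j, (edgeGraph u v B).Reachable (u j) (v j)) σ := by
  refine wp_seq (emptyForest_spec (n := n) (d := d) (U := ends u) (V := ends v) hG.edges
    hG.vertices) fun τ1 hA1 h1 => (wp_forLoop (N := d) (fun i τ => ∃ B, HasForest u v B τ ∧
      (∀ j ∈ B, (j : ℕ) < i) ∧
      ∀ j : Fin d, (j : ℕ) < i → (edgeGraph u v B).Reachable (u j) (v j)) ?_ ?_ ?_ ?_).imp ?_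
  all_goals
    have n1 : ∀ k, ¬ (k = 21 ∨ k = 22 ∨ k = 32) → τ1.nat k = σ.nat k := fun k hk =>
      hA1.nat k fun h => hk (emptyForest_nat.1 h)
  · rw [addEdge_nat]; lia
  · intro τ hA
    simp only [NatExpr.eval]
    rw [hA.nat 0 (by simp [Program.forLoop, Program.WritesNat, addEdge_nat]), n1 0 (by lia),
      hG.edges]
  · refine ⟨∅, ⟨?_, ?_, ?_, _, h1, fun e => ?_⟩, by simp, by simp⟩
    · refine hG.congr fun k hk => ?_
      rw [Memory.writeNat_nat_of_ne _ _ _ (by lia), n1 k (by lia)]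
    · rw [held_of_nat_eq (Memory.writeNat_nat_of_ne _ _ _ (by lia)),
        held_of_nat_eq (σ := σ) (n1 5 (by lia)), h5]
    · rw [Memory.writeNat_nat_of_ne _ _ _ (by lia), n1 31 (by lia), h31, Finset.card_empty]
    · simp
  · rintro i τ hi hA hiv ⟨B, hB, hBi, hr⟩
    refine (addEdge_spec (f := ⟨i, hi⟩) hl hB hiv fun h => lt_irrefl i (hBi _ h)).imp
      fun τ' _ ⟨B', hBB', hB'B, hF, hr'⟩ => ⟨B', hF.congr fun k hk =>
        Memory.writeNat_nat_of_ne _ _ _ (by lia), fun j hj => ?_, fun j hj => ?_⟩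
    · rcases Finset.mem_insert.1 (hB'B hj) with rfl | h
      · exact Nat.lt_succ_self i
      · exact (hBi j h).trans (Nat.lt_succ_self i)
    · rcases Nat.lt_succ_iff_lt_or_eq.1 hj with h | h
      · exact edgeGraph_reachable_mono hl hBB' (hr j h)
      · obtain rfl : j = ⟨i, hi⟩ := Fin.ext h
        exact hr'
  · rintro τ - ⟨B, hB, -, hr⟩
    exact ⟨B, hB, fun j => hr j j.2⟩

theorem IsForest.ncard {U V par pe : ℕ → ℕ} {E : Set ℕ} (hF : IsForest n d U V par pe E) :
    E.ncard = n := by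
  rw [← hF.bij.image_eq, hF.bij.injOn.ncard_image, ← Finset.coe_Iio, Set.ncard_coe_finset,
    Nat.card_Iio]

/-- A maximal forest is a spanning tree if there is one at all. -/
theorem HasForest.card_eq (hI : Function.Injective fun i => s(u i, v i)) (hl : ∀ i, u i ≠ v i)
    (hF : HasForest u v B σ) (hr : ∀ j, (edgeGraph u v B).Reachable (u j) (v j))
    (hne : (spanningTrees u v).Nonempty) : B.card + 1 = n := by
  obtain ⟨A, hA⟩ := hne
  obtain ⟨hc, -⟩ := (mem_spanningTrees hI hl).1 hA
  have hnon := hc.nonempty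
  have hBc : (edgeGraph u v B).Connected :=
    ⟨fun p q => reachable_of_edgeGraph (fun j _ => hr j) (hc.preconnected p q)⟩
  refine le_antisymm ?_ (le_card_of_connected hI hl hBc)
  obtain ⟨E, hFE, hEB⟩ := hF.forest
  -- one of the edges to the additional vertex is left
  obtain ⟨r, hr, -, hd⟩ := hFE.exists_root hnon.some.2
  have hsub : insert (σ.nat 22 r) (Fin.val '' (B : Set (Fin d))) ⊆ E := by
    rintro _ (rfl | ⟨e, he, rfl⟩)
    · exact hFE.bij.mapsTo hr
    · exact (hEB e).2 he
  have hE : E.Finite := hFE.bij.finite_iff_finite.1 (Set.finite_Iio n)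
  have := Set.ncard_le_ncard hsub hE
  rwa [Set.ncard_insert_of_notMem, Set.ncard_image_of_injective _ Fin.val_injective,
    Set.ncard_coe_finset, hFE.ncard] at this
  rintro ⟨i, -, h⟩
  have := i.2
  lia

/-- The edge above the root of the only tree of the forest gets the number `d`. -/
def rootForest : Program := .letNat 24 (.const 0) ;; findRoot ;; .setNat 22 (.var 24) (.var 0)

theorem rootForest_nat {k : ℕ} : rootForest.WritesNat k ↔ k = 22 ∨ k = 24 := by
  simp only [rootForest, Program.WritesNat, findRoot_nat]
  lia

theorem rootForest_real {k : ℕ} : ¬ rootForest.WritesReal k := by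
  simp [rootForest, Program.WritesReal, findRoot_real]

theorem rootForest_spec (hF : HasForest u v B σ) (hB : B.card + 1 = n) :
    wp O rootForest (n * 2 + 3) (fun τ => HasTree u v τ B) σ := by
  obtain ⟨hG, h5, -, E, hFE, hEB⟩ := hF
  refine wp_setNat_seq (T := n * 2 + 1 + 1) (wp_seq (findRoot_spec (n := n) (d := d) (U := ends u)
    (V := ends v) (E := E) ?_ ?_ ?_) fun τ hA ⟨hr, hd, _⟩ => wp_setNat ?_)
  · simpa [NatExpr.eval] using hG.edges
  · exact hFE.congr (fun _ _ => by simp) (fun _ _ => by simp)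
  · simp only [NatExpr.eval, Memory.writeNat_nat_same]
    lia
  · have n1 : ∀ k, k ≠ 24 → τ.nat k = σ.nat k := fun k hk => by
      rw [hA.nat k fun h => hk (findRoot_nat.1 h), Memory.writeNat_nat_of_ne _ _ _ hk]
    simp only [NatExpr.eval, n1 0 (by lia), hG.edges]
    rw [Memory.writeNat_nat_of_ne _ _ _ (by lia)] at hd
    generalize τ.nat 24 0 = r at *
    refine ⟨hG.congr fun k hk => ?_, ?_, ?_⟩
    · rw [Memory.writeNat_nat_of_ne _ _ _ (by lia), n1 k (by lia)]
    · rw [held_of_nat_eq (Memory.writeNat_nat_of_ne _ _ _ (by lia)),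
        held_of_nat_eq (σ := σ) (n1 5 (by lia)), h5]
    · -- there is only one edge to the additional vertex
      have hsub : Fin.val '' (B : Set (Fin d)) ⊆ E := by
        rintro _ ⟨e, he, rfl⟩
        exact (hEB e).2 he
      have hrE : σ.nat 22 r ∈ E := hFE.bij.mapsTo hr
      have hr' : σ.nat 22 r ∉ Fin.val '' (B : Set (Fin d)) := by
        rintro ⟨i, -, h⟩
        have := i.2
        lia
      have hE : E = insert (σ.nat 22 r) (Fin.val '' (B : Set (Fin d))) := by
        refine (Set.eq_of_subset_of_ncard_le (Set.insert_subset hrE hsub) ?_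
          (hFE.bij.finite_iff_finite.1 (Set.finite_Iio n))).symm
        rw [Set.ncard_insert_of_notMem hr', Set.ncard_image_of_injective _ Fin.val_injective,
          Set.ncard_coe_finset, hFE.ncard, hB]
      have hdB : d ∉ Fin.val '' (B : Set (Fin d)) := by
        rintro ⟨i, -, h⟩
        exact i.2.ne h
      have hpar : σ.nat 21 r = n := by
        rcases hFE.joins r hr with h | h <;> lia
      have hE' : E \ {σ.nat 22 r} = Fin.val '' (B : Set (Fin d)) := by
        rw [hE, Set.insert_sdiff_of_mem _ (Set.mem_singleton _),
          Set.sdiff_singleton_eq_self hr']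
      have := hFE.reparent (z := n) (e := d) hr (not_above_self hr) (Or.inr ⟨le_rfl, rfl⟩)
        (by rwa [hE'])
      rw [Function.update_eq_self_iff.2 hpar.symm, hE'] at this
      refine this.congr (fun _ _ => ?_) (fun _ _ => ?_)
      · rw [Memory.writeNat_nat_of_ne _ _ _ (by lia), n1 21 (by lia)]
      · rw [Memory.writeNat_nat_self, n1 22 (by lia)]

/-! ### The algorithms and their running times -/

/-- The algorithm for spanning trees.  A graph with too few edges is recognized at once. -/
def graphProgram : Program :=
  .cond (.natLE (.cell 0 (.const 1)) (.add (.var 0) (.const 1)))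
    (buildForest ;;
      .cond (.and (.natLE (.add (.var 31) (.const 1)) (.cell 0 (.const 1)))
          (.natLE (.cell 0 (.const 1)) (.add (.var 31) (.const 1))))
        (rootForest ;; solve graphBestOut graphExchange) .skip)
    .skip

theorem solved_of_isEmpty {X : Set (Finset (Fin d))} (hX : ¬ X.Nonempty) (h : τ.nat 3 0 = 0) :
    Solved X a b s τ :=
  ⟨fun ⟨y, hy⟩ => absurd ⟨y, hy.1⟩ hX, fun _ => h⟩

theorem graphProgram_spec {l : ℕ} (hI : Function.Injective fun i => s(u i, v i))
    (hl : ∀ i, u i ≠ v i) (hdl : d ≤ 2 ^ l) (hb : ∀ i, 0 < b i) :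
    wp O graphProgram (9000 * ((d + 1) * (d + 1) * (l + 1))) (Solved (spanningTrees u v) a b s)
      (graphInput u v a b s) := by
  set σ := graphInput u v a b s with hσ
  have hG : HasGraph u v σ := ⟨rfl, rfl, rfl, rfl⟩
  have hd : HasData a b s σ := ⟨rfl, rfl, rfl, rfl⟩
  have h1 : 1 ≤ (d + 1) * (d + 1) * (l + 1) := Nat.mul_pos (Nat.mul_pos d.succ_pos d.succ_pos)
    l.succ_pos
  by_cases hn : n ≤ d + 1
  · have hT : (n * 4 + 2) + (d * (n * 12 + 15 + 2) + 2) + ((n * 2 + 3) +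
        250 * ((16 * (n + 1) + d + 1) * (d + 1) * (l + 1)) + 1) + 1 ≤
        9000 * ((d + 1) * (d + 1) * (l + 1)) := by
      have e1 : (16 * (n + 1) + d + 1) * (d + 1) * (l + 1) ≤
          33 * ((d + 1) * (d + 1) * (l + 1)) := by
        rw [← mul_assoc, ← mul_assoc]
        gcongr
        lia
      have e2 : d * (n * 12 + 15 + 2) ≤ d * ((d + 1) * 12 + 15 + 2) := by gcongr
      have e3 : (d + 1) * (d + 1) * 1 ≤ (d + 1) * (d + 1) * (l + 1) := by gcongr; lia
      lia
    refine wp.weaken (wp_cond (T := (n * 4 + 2) + (d * (n * 12 + 15 + 2) + 2) + ((n * 2 + 3) +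
        250 * ((16 * (n + 1) + d + 1) * (d + 1) * (l + 1)) + 1)) (fun _ => ?_) (fun hp => ?_)) hT
    · refine wp_seq (buildForest_spec hl hG (by ext; simp [hσ, graphInput]) rfl)
        fun τ1 hA1 ⟨B, hB, hr⟩ => wp_cond (fun hp => ?_) (fun hp => ?_)
      all_goals
        simp only [Test.Holds, NatExpr.eval, hB.card, hB.graph.vertices] at hp
        have n1 : ∀ k, ¬ (k = 5 ∨ k = 7 ∨ k = 21 ∨ k = 22 ∨ 24 ≤ k ∧ k ≤ 28 ∨ 31 ≤ k ∧ k ≤ 33) →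
          τ1.nat k = σ.nat k := fun k hk => hA1.nat k fun h => hk (buildForest_nat.1 h)
      · refine wp_seq (rootForest_spec hB (hp.1.antisymm hp.2)) fun τ2 hA2 h2 => ?_
        have n2 : ∀ k, k ≠ 22 → k ≠ 24 → τ2.nat k = τ1.nat k := fun k hk hk' =>
          hA2.nat k fun h => by have := rootForest_nat.1 h; lia
        refine (graph_engine hI hl).solve_spec (symmExchange_spanningTrees hI hl) hdl hb
          (hd.congr ?_ fun k _ => ?_) h2 ?_ ?_
        · rw [n2 0 (by lia) (by lia), n1 0 (by lia)]
        · rw [hA2.real k rootForest_real, hA1.real k buildForest_real]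
        · rw [n2 3 (by lia) (by lia), n1 3 (by lia)]; rfl
        · rw [held_of_nat_eq (σ := σ) (by rw [n2 8 (by lia) (by lia), n1 8 (by lia)])]
          ext; simp [hσ, graphInput]
      · refine wp.weaken (wp_skip (solved_of_isEmpty (fun hne => ?_) ?_)) (by lia)
        · have := hB.card_eq hI hl hr hne
          exact hp ⟨this.le, this.ge⟩
        · rw [n1 3 (by lia)]; rfl
    · simp only [Test.Holds, NatExpr.eval, hG.edges, hG.vertices] at hp
      exact absurd hn hp
  · refine wp.weaken (wp_cond (T := 1) (fun hp => ?_) (fun _ => wp_skip (solved_of_isEmpty ?_ rfl)))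
      (by lia)
    · simp only [Test.Holds, NatExpr.eval, hG.edges, hG.vertices] at hp
      exact absurd hp hn
    · rintro ⟨A, hA⟩
      have h2 := ((mem_spanningTrees hI hl).1 hA).2
      have h3 := Finset.card_le_univ A
      rw [Fintype.card_fin] at h3
      lia

/-- The algorithm for matroids. -/
def matroidProgram : Program := matroidInit ;; solve matroidBestOut matroidExchange

theorem matroidProgram_spec {l : ℕ} {M : Matroid (Fin d)} (hM : M.E = Set.univ) (hdl : d ≤ 2 ^ l)
    (hb : ∀ i, 0 < b i) :
    wp (indepOracle M) matroidProgram (2600 * ((d + 1) * (d + 1) * (l + 1)))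
      (Solved (bases M) a b s) (matroidInput a b s) := by
  set σ := matroidInput a b s with hσ
  have hd : HasData a b s σ := ⟨rfl, rfl, rfl, rfl⟩
  have hT : d * 5 + 2 + 250 * ((9 * (d + 1) + d + 1) * (d + 1) * (l + 1)) ≤
      2600 * ((d + 1) * (d + 1) * (l + 1)) := by
    have e3 : (d + 1) * (d + 1) * 1 ≤ (d + 1) * (d + 1) * (l + 1) := by gcongr; lia
    lia
  refine wp.weaken (wp_seq (matroidInit_spec hd.dim (by ext; simp [hσ, matroidInput]))
    fun τ hA h => ?_) hT
  have n1 : ∀ k, k ≠ 5 → k ≠ 20 → τ.nat k = σ.nat k := fun k hk hk' =>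
    hA.nat k fun h => by have := matroidInit_nat.1 h; lia
  refine (matroid_engine M).solve_spec (symmExchange_bases hM) hdl hb
    (hd.congr (n1 0 (by lia) (by lia)) fun k _ => hA.real k ?_) ⟨h, rfl⟩ ?_ ?_
  · simp [matroidInit, Program.forLoop, Program.WritesReal]
  · rw [n1 3 (by lia) (by lia)]; rfl
  · rw [held_of_nat_eq (n1 8 (by lia) (by lia))]
    ext; simp [hσ, matroidInput]

theorem solvesWithin_of_wp {P : Program} {X : Set (Finset (Fin d))} {T : ℕ} {T' : ℝ}
    (h : wp O P T (Solved X a b s) σ) (hT : (T : ℝ) ≤ T') :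
    SolvesWithin O P σ (1 / 2) X a b s T' := by
  obtain ⟨t, τ, hr, ht, h1, h2⟩ := h
  exact ⟨t, τ, hr, (Nat.cast_le.2 ht).trans hT, h1, h2⟩

/-- One factor `log m` would do; the second one is bounded below by `log 2`. -/
theorem clog_add_one_le {m : ℕ} (hm : 2 ≤ m) : (Nat.clog 2 m : ℝ) + 1 ≤ 7 * Real.log m ^ 2 := by
  have h2 : 0.69 < Real.log 2 := by linarith [Real.log_two_gt_d9]
  have hm' : Real.log 2 ≤ Real.log m := Real.log_le_log (by norm_num) (by exact_mod_cast hm)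
  have h1 : 2 ^ (Nat.clog 2 m - 1) < m := Nat.pow_pred_clog_lt_self (by lia) (by lia)
  have h3 : ((Nat.clog 2 m - 1 : ℕ) : ℝ) * Real.log 2 ≤ Real.log m := by
    rw [← Real.log_pow]
    exact Real.log_le_log (by positivity) (by exact_mod_cast h1.le)
  rw [Nat.cast_sub (Nat.clog_pos (by lia) hm), Nat.cast_one] at h3
  nlinarith

end Graph

end BudgetedMax

open RealRAM BudgetedMax in
theorem mainTheorem5 :
    (∃ (P : Program) (C : ℝ), ∀ (n d : ℕ) (G : SimpleGraph (Fin n)) (u v : Fin d → Fin n)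
      (a b : Fin d → ℝ) (s : ℝ), IsEdgeList G u v → (∀ i, 0 < a i) → (∀ i, 0 < b i) →
        SolvesWithin noOracle P (graphInput u v a b s) (1 / 2) (spanningTrees u v) a b s
          (C * ((d : ℝ) ^ 2 * Real.log n ^ 2 + n * Real.log d ^ 3 + 1))) ∧
    (∃ (P : Program) (C : ℝ), ∀ (d : ℕ) (M : Matroid (Fin d)) (a b : Fin d → ℝ) (s : ℝ),
      M.E = Set.univ → (∀ i, 0 < a i) → (∀ i, 0 < b i) →
        SolvesWithin (indepOracle M) P (matroidInput a b s) (1 / 2) (bases M) a b s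
          (C * ((d : ℝ) ^ 2 * Real.log d ^ 2 + M.eRank.toNat * Real.log d ^ 3 + 1))) := by
  refine ⟨⟨graphProgram, 504000, fun n d G u v a b s hE _ hb => ?_⟩,
    ⟨matroidProgram, 60000, fun d M a b s hM _ hb => ?_⟩⟩
  · have hI : Function.Injective fun i => s(u i, v i) := Set.injOn_univ.1 hE.injOn
    have hl : ∀ i, u i ≠ v i := fun i => G.ne_of_adj (hE.mapsTo (Set.mem_univ i))
    have h1 : 0 ≤ (n : ℝ) * Real.log d ^ 3 :=
      mul_nonneg n.cast_nonneg (pow_nonneg (Real.log_natCast_nonneg d) 3)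
    rcases Nat.eq_zero_or_pos d with rfl | hd
    · refine solvesWithin_of_wp (graphProgram_spec (l := 0) hI hl (by lia) hb) ?_
      norm_num
    · have hn : 2 ≤ n := by
        have h := Fin.val_ne_of_ne (hl ⟨0, hd⟩)
        have h2 := (u ⟨0, hd⟩).2
        have h3 := (v ⟨0, hd⟩).2
        lia
      -- a graph on `n` vertices has at most `n ^ 2` edges
      have hdn : d ≤ 2 ^ (2 * Nat.clog 2 n) := by
        have hinj : Function.Injective fun i => (u i, v i) := fun i j h => hI (by
          have := Prod.ext_iff.1 h
          simp only at this
          simp only [this.1, this.2])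
        have h2 := Fintype.card_le_of_injective _ hinj
        rw [Fintype.card_prod, Fintype.card_fin, Fintype.card_fin] at h2
        have h3 := Nat.le_pow_clog (b := 2) (by lia) n
        rw [two_mul, pow_add]
        exact h2.trans (Nat.mul_le_mul h3 h3)
      refine solvesWithin_of_wp (graphProgram_spec hI hl hdn hb) ?_
      have hlog := clog_add_one_le hn
      have hd' : (1 : ℝ) ≤ d := by exact_mod_cast hd
      have h4 : ((d : ℝ) + 1) * (d + 1) ≤ 4 * (d : ℝ) ^ 2 := by nlinarith
      have h5 : (2 * (Nat.clog 2 n : ℝ) + 1) ≤ 14 * Real.log n ^ 2 := by linarith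
      push_cast
      have h6 := mul_le_mul h4 h5 (by positivity) (by positivity)
      linarith
  · have h1 : 0 ≤ (M.eRank.toNat : ℝ) * Real.log d ^ 3 :=
      mul_nonneg (Nat.cast_nonneg _) (pow_nonneg (Real.log_natCast_nonneg d) 3)
    have h2 : 0 ≤ (d : ℝ) ^ 2 * Real.log d ^ 2 := by positivity
    rcases Nat.lt_or_ge d 2 with hd | hd
    · refine solvesWithin_of_wp (matroidProgram_spec (l := 0) hM (by lia) hb) ?_
      have hd' : (d : ℝ) ≤ 1 := by exact_mod_cast Nat.lt_succ_iff.1 hd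
      have hd0 : (0 : ℝ) ≤ d := d.cast_nonneg
      push_cast
      nlinarith
    · refine solvesWithin_of_wp (matroidProgram_spec hM (Nat.le_pow_clog (by lia) d) hb) ?_
      have hlog := clog_add_one_le hd
      have hd' : (2 : ℝ) ≤ d := by exact_mod_cast hd
      have h4 : ((d : ℝ) + 1) * (d + 1) ≤ 3 * (d : ℝ) ^ 2 := by nlinarith
      push_cast
      have h6 := mul_le_mul h4 hlog (by positivity) (by positivity)
      linarith
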